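/- **Setting.** Let $M$ be a complex manifold of dimension $d$ with an open cover $\mathcal U=\{U_i\}_{i\in I}$, and write $U_{i_0\dots i_\ell}=U_{i_0}\cap\dots\cap U_{i_\ell}$. Its Čech nerve is the simplicial complex manifold $\check N\mathcal U$ with $\check N\mathcal U_\ell=\coprod_{i_0,\dots,i_\ell\in I}U_{i_0\dots i_\ell}$. * For a complex manifold $X$, $\mathbf{HVB}(X)$ is the nerve of the groupoid whose objects are pairs $(E,\nabla)$ of a holomorphic vector bundle with a holomorphic connection, and whose morphisms are the isomorphisms of holomorphic vector bundles (not required to preserve connections). Pullback makes $\mathbf{HVB}$ a simplicial presheaf on complex manifolds. * For a cochain complex $C$ in degrees $\ge 0$, $C[u]^{\le 0}=Q(C)$ is the chain complex given in chain degree $n\ge 1$ by $\prod_{m+n=2k}C^m u^k$, and in chain degree $0$ by the cocycles in $\prod_{m=2k}C^mu^k$ ($u$ has degree $-2$; the differential is that of $C$, coefficientwise). For a chain complex $A$ in degrees $\geq 0$, $DK(A)$ is the simplicial set $DK(A)_n=\mathrm{Hom}(N(\mathbb Z\Delta^n),A)$ of chain maps from the normalized chains, and $\mathbf\Omega(X)=DK(\Omega^\bullet_{hol}(X)[u]^{\le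 0})$, where $\Omega^\bullet_{hol}(X)$ is the complex of holomorphic forms with zero differential. * $\check C^m(\mathcal U,\Omega_{hol})=\prod_{\ell+q=m}\prod_{i_0,\dots,i_\ell}\Omega^q_{hol}(U_{i_0\dots i_\ell})$, with the Čech differential $\delta$. * For a cosimplicial simplicial set $X^\bullet$, $\mathrm{Tot}(X^\bullet)$ is the equalizer of $\prod_\ell (X^\ell)^{\Delta^\ell}\rightrightarrows\prod_{[\ell]\to[m]}(X^m)^{\Delta^\ell}$. **Statement.** 1. There is exactly one map of simplicial presheaves $\mathbf{Ch}:\mathbf{HVB}\to\mathbf\Omega$ with the following property. Let a simplex of $\mathbf{HVB}(X)$ be given, and let $\sigma$ be an $\ell$-dimensional face (or degeneracy of a face) of it, that is, a sequence $E_0\xrightarrow{f_1}\cdots\xrightarrow{f_\ell}E_\ell$ with composite $f$. Then $\mathbf{Ch}$ of the simplex takes on the generator $\sigma$ the value $\mathrm{tr}\big(f^{-1}\,\nabla(f_\ell)\wedge\dots\wedge\nabla(f_1)\big)\,u^\ell$ (for $\ell=0$: the locally constant function $\mathrm{rank}(E_0)$). Here $\nabla(f_j)$ is formed with the induced connection on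 $\mathrm{Hom}(E_{j-1},E_j)$. Hence $\mathbf{Ch}(\check N\mathcal U):\mathbf{HVB}(\check N\mathcal U)\to\mathbf\Omega(\check N\mathcal U)$ is a map of cosimplicial simplicial sets and induces a simplicial map $\mathrm{Tot}(\mathbf{Ch}(\check N\mathcal U)):\mathrm{Tot}(\mathbf{HVB}(\check N\mathcal U))\to\mathrm{Tot}(\mathbf\Omega(\check N\mathcal U))$. 2. Restriction to the pieces of $\check N\mathcal U$ is, for every $q$, an isomorphism of cosimplicial abelian groups from $\Omega^q_{hol}(\check N\mathcal U_\bullet)$ to $[\ell]\mapsto\prod_{i_0,\dots,i_\ell}\Omega^q_{hol}(U_{i_0\dots i_\ell})$. 3. There is a weak equivalence of simplicial sets $w:\mathrm{Tot}(\mathbf\Omega(\check N\mathcal U))\to DK\big(\check C^\bullet(\mathcal U,\Omega_{hol})[u]^{\le 0}\big)$ given by the Eilenberg–Zilber map. Explicitly, let $x=(x_\ell)_\ell$ be an $n$-simplex of the source, so $x_\ell:\Delta^\ell\times\Delta^n\to\mathbf\Omega(\check N\mathcal U_\ell)$. On a $p$-dimensional simplex $\sigma$ of $\Delta^n$, the coefficient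 of $u^k$ of $w(x)$ in $\prod_{i_0,\dots,i_\ell}\Omega^q_{hol}(U_{i_0\dots i_\ell})$, where $\ell+q+p=2k$, is $$(-1)^{p(p-1)/2}\sum_{(\mu,\nu)}\mathrm{sgn}(\mu,\nu)\;x_\ell\big(s_\mu\iota_\ell,\,s_\nu\sigma\big)_{k,q}.$$ The sum is over all $(p,\ell)$-shuffles, $\iota_\ell$ is the top simplex of $\Delta^\ell$, $s_\mu,s_\nu$ are the iterated degeneracies at the positions $\mu$ and $\nu$, and $y_{k,q}$ is the part in $\Omega^q_{hol}u^k$ of the value of a $(p+\ell)$-simplex $y$ of $\mathbf\Omega(\check N\mathcal U_\ell)$ on the top generator. 4. The values of the composite $w\circ\mathrm{Tot}(\mathbf{Ch}(\check N\mathcal U)):\mathrm{Tot}(\mathbf{HVB}(\check N\mathcal U))\to DK\big(\check C^\bullet(\mathcal U,\Omega_{hol})[u]^{\le 0}\big)$ are polynomials in $u$ of degree at most $d$. -/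

import Mathlib

open CategoryTheory Opposite Simplicial MonoidalCategory TopologicalSpace Topology
open scoped Manifold ContDiff

universe u w

noncomputable section

namespace ChernTot

section SigmaManifold

variable {n : ℕ} {ι : Type u} {X : ι → Type u} [∀ i, TopologicalSpace (X i)]
  [∀ i, ChartedSpace (EuclideanSpace ℂ (Fin n)) (X i)]

/-- The disjoint union of a family of manifolds, with the charts of its pieces. -/
instance sigmaChartedSpace :
    ChartedSpace (EuclideanSpace ℂ (Fin n)) (Σ i, X i) where
  atlas := ⋃ i, (fun e => e.lift_openEmbedding (IsOpenEmbedding.sigmaMk (i := i))) ''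
    atlas (EuclideanSpace ℂ (Fin n)) (X i)
  chartAt p := (chartAt (EuclideanSpace ℂ (Fin n)) p.2).lift_openEmbedding
    (IsOpenEmbedding.sigmaMk (i := p.1))
  mem_chart_source p := by
    rw [OpenPartialHomeomorph.lift_openEmbedding_source]
    exact ⟨p.2, mem_chart_source _ p.2, rfl⟩
  chart_mem_atlas p := Set.mem_iUnion.2 ⟨p.1, _, chart_mem_atlas _ p.2, rfl⟩

theorem sigma_chartAt (i : ι) (x : X i) :
    chartAt (EuclideanSpace ℂ (Fin n)) (⟨i, x⟩ : Σ i, X i) =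
      (chartAt (EuclideanSpace ℂ (Fin n)) x).lift_openEmbedding
        (IsOpenEmbedding.sigmaMk (i := i)) := rfl

theorem sigma_chartAt_apply (i : ι) (x y : X i) :
    chartAt (EuclideanSpace ℂ (Fin n)) (⟨i, x⟩ : Σ i, X i) ⟨i, y⟩ =
      chartAt (EuclideanSpace ℂ (Fin n)) x y :=
  OpenPartialHomeomorph.lift_openEmbedding_apply _ _

instance sigmaIsManifold [∀ i, IsManifold 𝓘(ℂ, EuclideanSpace ℂ (Fin n)) ω (X i)] :
    IsManifold 𝓘(ℂ, EuclideanSpace ℂ (Fin n)) ω (Σ i, X i) where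
  compatible {e} e' he he' := by
    obtain ⟨i, f, hf, rfl⟩ := Set.mem_iUnion.1 he
    obtain ⟨j, f', hf', rfl⟩ := Set.mem_iUnion.1 he'
    by_cases hij : i = j
    · subst hij
      rw [f.lift_openEmbedding_trans f' IsOpenEmbedding.sigmaMk]
      exact HasGroupoid.compatible hf hf'
    · apply ContDiffGroupoid.mem_of_source_eq_empty
      ext x
      refine ⟨fun ⟨hx₁, hx₂⟩ => ?_, fun hx => hx.elim⟩
      simp at hx₂
      obtain ⟨y, hy, hy'⟩ := hx₂
      exact hij hy'.1.symm

theorem contMDiff_sigmaMk (i : ι) :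
    ContMDiff 𝓘(ℂ, EuclideanSpace ℂ (Fin n)) 𝓘(ℂ, EuclideanSpace ℂ (Fin n)) ω
      (fun x : X i => (⟨i, x⟩ : Σ i, X i)) := by
  intro x
  rw [contMDiffAt_iff]
  refine ⟨continuous_sigmaMk.continuousAt, ?_⟩
  apply contDiffWithinAt_id.congr_of_eventuallyEq; swap
  · simp [extChartAt, sigma_chartAt_apply]
  have : (chartAt (EuclideanSpace ℂ (Fin n)) x).target ∈
      𝓝 (chartAt (EuclideanSpace ℂ (Fin n)) x x) :=
    (chartAt _ x).open_target.mem_nhds (mem_chart_target _ x)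
  simp only [modelWithCornersSelf_coe, Set.range_id, nhdsWithin_univ]
  filter_upwards [by simpa using this] with y hy
  simp [extChartAt, sigma_chartAt_apply, (chartAt (EuclideanSpace ℂ (Fin n)) x).right_inv hy]

theorem contMDiff_sigma {m : ℕ} {N : Type u} [TopologicalSpace N]
    [ChartedSpace (EuclideanSpace ℂ (Fin m)) N] {f : (Σ i, X i) → N}
    (hf : ∀ i, ContMDiff 𝓘(ℂ, EuclideanSpace ℂ (Fin n)) 𝓘(ℂ, EuclideanSpace ℂ (Fin m)) ω
      (fun x : X i => f ⟨i, x⟩)) :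
    ContMDiff 𝓘(ℂ, EuclideanSpace ℂ (Fin n)) 𝓘(ℂ, EuclideanSpace ℂ (Fin m)) ω f := by
  rintro ⟨i, x⟩
  rw [contMDiffAt_iff]
  refine ⟨(continuous_sigma fun j => (hf j).continuous).continuousAt, ?_⟩
  have h := (contMDiffAt_iff.1 (hf i x)).2
  have e : extChartAt 𝓘(ℂ, EuclideanSpace ℂ (Fin n)) (⟨i, x⟩ : Σ i, X i) ⟨i, x⟩ =
      extChartAt 𝓘(ℂ, EuclideanSpace ℂ (Fin n)) x x := by
    simp [extChartAt, sigma_chartAt_apply]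
  rw [e]
  refine h.congr_of_eventuallyEq (Filter.Eventually.of_forall fun y => ?_) ?_
  · simp [extChartAt, sigma_chartAt]
  · simp [extChartAt, sigma_chartAt]

end SigmaManifold

/-- Complex manifolds. -/
structure CMan : Type (u + 1) where
  dim : ℕ
  carrier : Type u
  [top : TopologicalSpace carrier]
  [charted : ChartedSpace (EuclideanSpace ℂ (Fin dim)) carrier]
  [mfd : IsManifold 𝓘(ℂ, EuclideanSpace ℂ (Fin dim)) ω carrier]

attribute [instance] CMan.top CMan.charted CMan.mfd

instance : CoeSort CMan.{u} (Type u) := ⟨CMan.carrier⟩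

/-- The model with corners. -/
abbrev CMan.I (X : CMan.{u}) : ModelWithCorners ℂ (EuclideanSpace ℂ (Fin X.dim))
    (EuclideanSpace ℂ (Fin X.dim)) := 𝓘(ℂ, EuclideanSpace ℂ (Fin X.dim))

/-- The holomorphic tangent space. -/
abbrev CMan.T (X : CMan.{u}) (x : X) : Type := TangentSpace X.I x

instance : Category CMan.{u} where
  Hom X Y := C^ω⟮X.I, X; Y.I, Y⟯
  id X := ContMDiffMap.id
  comp f g := g.comp f

instance {X Y : CMan.{u}} : CoeFun (X ⟶ Y) (fun _ => X → Y) :=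
  ⟨fun f => DFunLike.coe (F := C^ω⟮X.I, X; Y.I, Y⟯) f⟩

theorem CMan.hom_contMDiff {X Y : CMan.{u}} (f : X ⟶ Y) : ContMDiff X.I Y.I ω f :=
  ContMDiffMap.contMDiff (n := ω) f

theorem CMan.comp_apply {X Y Z : CMan.{u}} (f : X ⟶ Y) (g : Y ⟶ Z) (x : X) :
    (f ≫ g) x = g (f x) := rfl

theorem CMan.id_apply {X : CMan.{u}} (x : X) : (𝟙 X : X ⟶ X) x = x := rfl

/-- The function `f` is holomorphic near `x`. -/
abbrev HolFn (X : CMan.{u}) (f : X → ℂ) (x : X) : Prop := ContMDiffAt X.I 𝓘(ℂ, ℂ) ω f x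

/-- The vector field `V` is holomorphic near `x`. -/
def HolVF (X : CMan.{u}) (V : Π x : X, X.T x) (x : X) : Prop :=
  ContMDiffAt X.I X.I.tangent ω (fun y => (⟨y, V y⟩ : TangentBundle X.I X)) x

/-- The derivative of a function along a tangent vector. -/
def dfn (X : CMan.{u}) (f : X → ℂ) (x : X) : X.T x →ₗ[ℂ] ℂ := (mvfderiv X.I f x).toLinearMap

/-- The derivative of a holomorphic map. -/
def dmap {X Y : CMan.{u}} (φ : X ⟶ Y) (x : X) : X.T x →ₗ[ℂ] Y.T (φ x) :=
  (mfderiv X.I Y.I φ x).toLinearMap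

theorem HolFn.eventually {X : CMan.{u}} {f : X → ℂ} {x : X} (h : HolFn X f x) :
    ∀ᶠ y in 𝓝 x, HolFn X f y := (contMDiffAt_iff_contMDiffAt_nhds (by simp)).1 h

theorem HolVF.eventually {X : CMan.{u}} {V : Π x : X, X.T x} {x : X} (h : HolVF X V x) :
    ∀ᶠ y in 𝓝 x, HolVF X V y := (contMDiffAt_iff_contMDiffAt_nhds (by simp)).1 h

theorem HolFn.mdiff {X : CMan.{u}} {f : X → ℂ} {x : X} (h : HolFn X f x) :
    MDifferentiableAt X.I 𝓘(ℂ, ℂ) f x := ContMDiffAt.mdifferentiableAt h (by simp)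

theorem dfn_add {X : CMan.{u}} {f g : X → ℂ} {x : X} (hf : HolFn X f x) (hg : HolFn X g x) :
    dfn X (fun y => f y + g y) x = dfn X f x + dfn X g x := by
  have := mvfderiv_add hf.mdiff hg.mdiff
  ext v
  exact congrArg (fun L => L v) this

theorem dfn_mul {X : CMan.{u}} {f g : X → ℂ} {x : X} (hf : HolFn X f x) (hg : HolFn X g x) :
    dfn X (fun y => f y * g y) x = f x • dfn X g x + g x • dfn X f x := by
  have := mvfderiv_mul hf.mdiff hg.mdiff
  ext v
  exact congrArg (fun L => L v) this

theorem dfn_congr {X : CMan.{u}} {f g : X → ℂ} {x : X} (h : ∀ᶠ y in 𝓝 x, f y = g y) :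
    dfn X f x = dfn X g x := by
  have h' : f =ᶠ[𝓝 x] g := h
  ext v
  simp only [dfn, mvfderiv]
  have e := h'.mfderiv_eq (I := X.I) (I' := 𝓘(ℂ, ℂ))
  have := congrArg (fun L : EuclideanSpace ℂ (Fin X.dim) →L[ℂ] ℂ => L v) e
  exact this

theorem CMan.hom_mdiff {X Y : CMan.{u}} (φ : X ⟶ Y) (x : X) :
    MDifferentiableAt X.I Y.I φ x := (X.hom_contMDiff φ x).mdifferentiableAt (by simp)

theorem dmap_id {X : CMan.{u}} (x : X) : dmap (𝟙 X) x = LinearMap.id := by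
  have : mfderiv X.I X.I (fun x : X => x) x = _ := mfderiv_id
  ext v
  exact congrArg (fun L => L v) this

theorem dmap_comp {X Y Z : CMan.{u}} (φ : X ⟶ Y) (ψ : Y ⟶ Z) (x : X) :
    dmap (φ ≫ ψ) x = dmap ψ (φ x) ∘ₗ dmap φ x := by
  have := mfderiv_comp x (CMan.hom_mdiff ψ (φ x)) (CMan.hom_mdiff φ x)
  ext v
  exact congrArg (fun L => L v) this

theorem dfn_comp {X Y : CMan.{u}} (φ : X ⟶ Y) {f : Y → ℂ} {x : X} (hf : HolFn Y f (φ x)) :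
    dfn X (fun y => f (φ y)) x = dfn Y f (φ x) ∘ₗ dmap φ x := by
  ext v
  exact mvfderiv_comp_apply x hf.mdiff (CMan.hom_mdiff φ x) v

theorem HolFn.comp {X Y : CMan.{u}} (φ : X ⟶ Y) {f : Y → ℂ} {x : X} (hf : HolFn Y f (φ x)) :
    HolFn X (fun y => f (φ y)) x :=
  ContMDiffAt.comp x hf (CMan.hom_contMDiff φ x)

theorem HolFn.const (X : CMan.{u}) (c : ℂ) (x : X) : HolFn X (fun _ => c) x := contMDiffAt_const

theorem HolFn.add' {X : CMan.{u}} {f g : X → ℂ} {x : X} (hf : HolFn X f x) (hg : HolFn X g x) :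
    HolFn X (fun y => f y + g y) x := ContMDiffAt.add hf hg

theorem HolFn.mul' {X : CMan.{u}} {f g : X → ℂ} {x : X} (hf : HolFn X f x) (hg : HolFn X g x) :
    HolFn X (fun y => f y * g y) x := by
  exact ContMDiffAt.smul hf hg

theorem HolFn.sum' {X : CMan.{u}} {ι : Type*} (s : Finset ι) {f : ι → X → ℂ} {x : X}
    (hf : ∀ i ∈ s, HolFn X (f i) x) :
    HolFn X (fun y => ∑ i ∈ s, f i y) x := contMDiffAt_finsetSum hf

theorem HolFn.prod' {X : CMan.{u}} {ι : Type*} (s : Finset ι) {f : ι → X → ℂ} {x : X}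
    (hf : ∀ i ∈ s, HolFn X (f i) x) :
    HolFn X (fun y => ∏ i ∈ s, f i y) x := contMDiffAt_finsetProd hf

theorem HolFn.congr' {X : CMan.{u}} {f g : X → ℂ} {x : X} (hf : HolFn X f x)
    (h : ∀ᶠ y in 𝓝 x, g y = f y) : HolFn X g x := ContMDiffAt.congr_of_eventuallyEq hf h

/-- The image of a holomorphic vector field under a locally holomorphic map is a holomorphic
vector field along the map. -/
theorem mfderiv_holVF {X : CMan.{u}} {V : Π x : X, X.T x} {x : X} (hV : HolVF X V x) {m : ℕ}
    {Y : Type*} [TopologicalSpace Y] [ChartedSpace (EuclideanSpace ℂ (Fin m)) Y]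
    [IsManifold 𝓘(ℂ, EuclideanSpace ℂ (Fin m)) ω Y] {φ : X → Y}
    (hφ : ContMDiffAt X.I 𝓘(ℂ, EuclideanSpace ℂ (Fin m)) ω φ x) :
    ContMDiffAt X.I (𝓘(ℂ, EuclideanSpace ℂ (Fin m))).tangent ω
      (fun y => (⟨φ y, mfderiv X.I 𝓘(ℂ, EuclideanSpace ℂ (Fin m)) φ y (V y)⟩ :
        TangentBundle 𝓘(ℂ, EuclideanSpace ℂ (Fin m)) Y)) x := by
  have h1 := hφ.mfderiv_const (m := ω) (by simp)
  exact ContMDiffAt.clm_apply_of_inCoordinates (b₁ := fun y => y) (b₂ := φ) (v := fun y => V y) h1 hV hφ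

theorem HolVF.dfn {X : CMan.{u}} {V : Π x : X, X.T x} {x : X} (hV : HolVF X V x) {f : X → ℂ}
    (hf : HolFn X f x) : HolFn X (fun y => dfn X f y (V y)) x := by
  have h1 := ContMDiffAt.mfderiv_const (m := ω) hf (by simp)
  have h2 := ContMDiffAt.clm_apply_of_inCoordinates (b₁ := fun y => y) (b₂ := f)
    (v := fun y => V y) h1 hV hf
  exact (contMDiff_snd_tangentBundle_modelSpace ℂ 𝓘(ℂ, ℂ)).contMDiffAt.comp x h2

/-- Locally, the image of a holomorphic vector field under a holomorphic map is a combination of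
holomorphic vector fields on the target. -/
theorem HolVF.exists_expand {X Y : CMan.{u}} (φ : X ⟶ Y) {V : Π x : X, X.T x} {x : X}
    (hV : HolVF X V x) :
    ∃ (W : Fin Y.dim → Π y : Y, Y.T y) (a : Fin Y.dim → X → ℂ),
      (∀ j, HolVF Y (W j) (φ x)) ∧ (∀ j, HolFn X (a j) x) ∧
      ∀ᶠ z in 𝓝 x, dmap φ z (V z) = ∑ j, a j z • W j (φ z) := by
  let b : Module.Basis (Fin Y.dim) ℂ (EuclideanSpace ℂ (Fin Y.dim)) :=
    (EuclideanSpace.basisFun (Fin Y.dim) ℂ).toBasis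
  let e := trivializationAt (EuclideanSpace ℂ (Fin Y.dim)) (TangentSpace Y.I) (φ x)
  have hm : φ x ∈ e.baseSet := FiberBundle.mem_baseSet_trivializationAt' (φ x)
  have h1 := mfderiv_holVF hV (CMan.hom_contMDiff φ x)
  have h2 := (Bundle.contMDiffAt_totalSpace.1 h1).2
  refine ⟨e.localFrame b, fun j z => b.repr ((e ⟨φ z, dmap φ z (V z)⟩).2) j, fun j => ?_,
    fun j => ?_, ?_⟩
  · exact contMDiffAt_localFrame_of_mem ω e b j hm
  · have : ContMDiff 𝓘(ℂ, EuclideanSpace ℂ (Fin Y.dim)) 𝓘(ℂ, ℂ) ω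
        (fun v : EuclideanSpace ℂ (Fin Y.dim) => b.repr v j) :=
      (LinearMap.toContinuousLinearMap (b.coord j)).contMDiff
    exact this.contMDiffAt.comp x h2
  · have : ∀ᶠ z in 𝓝 x, φ z ∈ e.baseSet :=
      (CMan.hom_contMDiff φ).continuous.continuousAt.eventually (e.open_baseSet.mem_nhds hm)
    filter_upwards [this] with z hz
    have h3 := (e.basisAt b hz).sum_repr (dmap φ z (V z))
    rw [← h3]
    refine Finset.sum_congr rfl fun j _ => ?_
    rw [h3, e.localFrame_apply_of_mem_baseSet b hz]
    congr 1

/-- The group of holomorphic `k`-forms on `X`: families of alternating forms on the tangent spaces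
whose value on holomorphic vector fields near any point is a holomorphic function near that
point. -/
def HolForm (X : CMan.{u}) (k : ℕ) : AddSubgroup (Π x : X, X.T x [⋀^Fin k]→ₗ[ℂ] ℂ) where
  carrier := {η | ∀ (x : X) (V : Fin k → Π y : X, X.T y), (∀ i, HolVF X (V i) x) →
    HolFn X (fun y => η y (fun i => V i y)) x}
  zero_mem' := fun x _ _ => HolFn.const X 0 x
  add_mem' := fun h h' x V hV => (h x V hV).add' (h' x V hV)
  neg_mem' := fun h x V hV => ContMDiffAt.neg (h x V hV)

/-- Pullback of holomorphic forms. -/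
def HolForm.pull {X Y : CMan.{u}} (φ : X ⟶ Y) (k : ℕ) : HolForm Y k →+ HolForm X k where
  toFun η := ⟨fun x => (η.1 (φ x)).compLinearMap (dmap φ x), by
    intro x V hV
    choose W a hW ha h using fun i => (hV i).exists_expand φ
    have key : HolFn X (fun z => ∑ r : Fin k → Fin Y.dim, (∏ i, a i (r i) z) *
        η.1 (φ z) (fun i => W i (r i) (φ z))) x :=
      HolFn.sum' _ fun r _ => HolFn.mul' (HolFn.prod' _ fun i _ => ha i (r i))
        (HolFn.comp φ (η.2 (φ x) (fun i => W i (r i)) fun i => hW i (r i)))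
    refine key.congr' ?_
    filter_upwards [Filter.eventually_all.2 h] with z hz
    change η.1 (φ z) (fun i => dmap φ z (V i z)) = _
    rw [funext hz]
    have := (η.1 (φ z)).toMultilinearMap.map_sum (fun i j => a i j z • W i j (φ z))
    refine this.trans (Finset.sum_congr rfl fun r _ => ?_)
    exact (η.1 (φ z)).toMultilinearMap.map_smul_univ (fun i => a i (r i) z)
      (fun i => W i (r i) (φ z))⟩
  map_zero' := rfl
  map_add' _ _ := rfl

/-- The presheaf of groups of holomorphic `k`-forms on the category of complex manifolds. -/
def holForms (k : ℕ) : CMan.{u}ᵒᵖ ⥤ AddCommGrpCat.{u} where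
  obj X := AddCommGrpCat.of (HolForm X.unop k)
  map φ := AddCommGrpCat.ofHom (HolForm.pull φ.unop k)
  map_id X := by
    ext η x v
    change η.1 x (fun i => dmap (𝟙 X.unop) x (v i)) = η.1 x v
    simp only [dmap_id]
    rfl
  map_comp {X Y Z} φ ψ := by
    ext η x v
    change η.1 _ (fun i => dmap (ψ.unop ≫ φ.unop) x (v i)) =
      η.1 (φ.unop (ψ.unop x)) (fun i => dmap φ.unop (ψ.unop x) (dmap ψ.unop x (v i)))
    simp only [dmap_comp]
    rfl

/-- The sections `e i` form a holomorphic frame at `x`. Sections are all families of vectors in the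
fibres, and `H σ x` says that the section `σ` is holomorphic near `x`. -/
structure IsFrame {X : CMan.{u}} {fib : X → Type u} [∀ x, AddCommGroup (fib x)]
    [∀ x, Module ℂ (fib x)] (H : (Π x, fib x) → X → Prop) {r : ℕ} (e : Fin r → Π x, fib x)
    (x : X) : Prop where
  indep : LinearIndependent ℂ (fun i => e i x)
  span : ⊤ ≤ Submodule.span ℂ (Set.range fun i => e i x)
  iff : ∀ σ, H σ x ↔ ∃ c : Fin r → X → ℂ, (∀ i, HolFn X (c i) x) ∧
    ∀ᶠ y in 𝓝 x, σ y = ∑ i, c i y • e i y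

/-- The vector spaces `fib x` with the holomorphic sections `H` form a holomorphic vector bundle
(of finite, locally constant rank): there are local holomorphic frames. -/
def IsHolBundle {X : CMan.{u}} (fib : X → Type u) [∀ x, AddCommGroup (fib x)]
    [∀ x, Module ℂ (fib x)] (H : (Π x, fib x) → X → Prop) : Prop :=
  ∀ x₀, ∃ (r : ℕ) (e : Fin r → Π x, fib x), ∀ᶠ x in 𝓝 x₀, IsFrame H e x

/-- `D` is a holomorphic connection on the holomorphic vector bundle given by `fib` and `H`. It acts
on germs of holomorphic sections; its values on other sections carry no information and are set
to zero. -/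
structure IsHolConnection {X : CMan.{u}} {fib : X → Type u} [∀ x, AddCommGroup (fib x)]
    [∀ x, Module ℂ (fib x)] (H : (Π x, fib x) → X → Prop)
    (D : (Π x, fib x) → Π x, X.T x →ₗ[ℂ] fib x) : Prop where
  add : ∀ {σ τ x}, H σ x → H τ x → D (fun y => σ y + τ y) x = D σ x + D τ x
  leibniz : ∀ {f : X → ℂ} {σ x}, HolFn X f x → H σ x → ∀ v,
    D (fun y => f y • σ y) x v = dfn X f x v • σ x + f x • D σ x v
  congr : ∀ {σ τ x}, H σ x → (∀ᶠ y in 𝓝 x, τ y = σ y) → D τ x = D σ x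
  hol : ∀ {σ x}, H σ x → ∀ {V : Π y, X.T y}, HolVF X V x → H (fun y => D σ y (V y)) x
  junk : ∀ {σ x}, ¬ H σ x → D σ x = 0

/-- A holomorphic vector bundle with a holomorphic connection. -/
structure HVBObj (X : CMan.{u}) : Type (u + 1) where
  fib : X → Type u
  [grp : ∀ x, AddCommGroup (fib x)]
  [mod : ∀ x, Module ℂ (fib x)]
  HolAt : (Π x, fib x) → X → Prop
  nabla : (Π x, fib x) → Π x, X.T x →ₗ[ℂ] fib x
  isBundle : IsHolBundle fib HolAt
  isConn : IsHolConnection HolAt nabla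

attribute [instance] HVBObj.grp HVBObj.mod

theorem dfn_const (X : CMan.{u}) (c : ℂ) (x : X) : dfn X (fun _ => c) x = 0 := by
  have := mvfderiv_const (I := X.I) c (x := x)
  ext v
  exact congrArg (fun L => L v) this

namespace HVBObj

variable {X Y Z : CMan.{u}} (E : HVBObj X)

theorem holAt_congr {σ τ : Π x, E.fib x} {x : X} (h : E.HolAt σ x)
    (e : ∀ᶠ y in 𝓝 x, τ y = σ y) : E.HolAt τ x := by
  obtain ⟨r, b, hb⟩ := E.isBundle x
  obtain ⟨c, hc, h'⟩ := (hb.self_of_nhds.iff σ).1 h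
  refine (hb.self_of_nhds.iff τ).2 ⟨c, hc, ?_⟩
  filter_upwards [e, h'] with y h1 h2
  rw [h1, h2]

theorem holAt_add {σ τ : Π x, E.fib x} {x : X} (h : E.HolAt σ x) (h' : E.HolAt τ x) :
    E.HolAt (fun y => σ y + τ y) x := by
  obtain ⟨r, b, hb⟩ := E.isBundle x
  obtain ⟨c, hc, h⟩ := (hb.self_of_nhds.iff σ).1 h
  obtain ⟨c', hc', h'⟩ := (hb.self_of_nhds.iff τ).1 h'
  refine (hb.self_of_nhds.iff _).2 ⟨fun i y => c i y + c' i y, fun i => (hc i).add' (hc' i), ?_⟩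
  filter_upwards [h, h'] with y h1 h2
  simp only [h1, h2, add_smul, Finset.sum_add_distrib]

theorem holAt_smul {f : X → ℂ} {σ : Π x, E.fib x} {x : X} (hf : HolFn X f x)
    (h : E.HolAt σ x) : E.HolAt (fun y => f y • σ y) x := by
  obtain ⟨r, b, hb⟩ := E.isBundle x
  obtain ⟨c, hc, h⟩ := (hb.self_of_nhds.iff σ).1 h
  refine (hb.self_of_nhds.iff _).2 ⟨fun i y => f y * c i y, fun i => hf.mul' (hc i), ?_⟩
  filter_upwards [h] with y h1
  simp only [h1, Finset.smul_sum, mul_smul]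

theorem holAt_zero (x : X) : E.HolAt (fun _ => 0) x := by
  obtain ⟨r, b, hb⟩ := E.isBundle x
  exact (hb.self_of_nhds.iff _).2 ⟨fun _ _ => 0, fun i => HolFn.const X 0 x, by simp⟩

theorem holAt_sum {ι : Type*} (s : Finset ι) {σ : ι → Π x, E.fib x} {x : X}
    (h : ∀ i ∈ s, E.HolAt (σ i) x) : E.HolAt (fun y => ∑ i ∈ s, σ i y) x := by
  classical
  induction s using Finset.induction_on with
  | empty => simpa using E.holAt_zero x
  | insert a s ha ih =>
    simp only [Finset.sum_insert ha]
    exact E.holAt_add (h a (by simp)) (ih fun i hi => h i (by simp [hi]))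

theorem holAt_eventually {σ : Π x, E.fib x} {x : X} (h : E.HolAt σ x) :
    ∀ᶠ y in 𝓝 x, E.HolAt σ y := by
  obtain ⟨r, b, hb⟩ := E.isBundle x
  obtain ⟨c, hc, h⟩ := (hb.self_of_nhds.iff σ).1 h
  filter_upwards [hb, Filter.eventually_all.2 fun i => (hc i).eventually,
    eventually_eventually_nhds.2 h] with y h1 h2 h3
  exact (h1.iff σ).2 ⟨c, h2, h3⟩

theorem frame_holAt {r : ℕ} {e : Fin r → Π x, E.fib x} {x : X} (h : IsFrame E.HolAt e x)
    (i : Fin r) : E.HolAt (e i) x :=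
  (h.iff _).2 ⟨fun j _ => if j = i then 1 else 0, fun j => HolFn.const X _ x, by simp⟩

theorem nabla_zero (x : X) : E.nabla (fun _ => 0) x = 0 := by
  ext v
  have := E.isConn.leibniz (HolFn.const X 0 x) (E.holAt_zero x) v
  simpa using this

theorem nabla_sum {ι : Type*} (s : Finset ι) {σ : ι → Π x, E.fib x} {x : X}
    (h : ∀ i ∈ s, E.HolAt (σ i) x) :
    E.nabla (fun y => ∑ i ∈ s, σ i y) x = ∑ i ∈ s, E.nabla (σ i) x := by
  classical
  induction s using Finset.induction_on with
  | empty => simpa using E.nabla_zero x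
  | insert a s ha ih =>
    simp only [Finset.sum_insert ha]
    rw [E.isConn.add (h a (by simp)) (E.holAt_sum s fun i hi => h i (by simp [hi])),
      ih fun i hi => h i (by simp [hi])]

/-! Pullback along a holomorphic map. -/

/-- A presentation of a section of the pullback bundle near `y`, as a combination with holomorphic
coefficients of pulled back holomorphic sections. -/
structure Pres (φ : Y ⟶ X) (σ : Π y, E.fib (φ y)) (y : Y) where
  ι : Type
  [fin : Fintype ι]
  c : ι → Y → ℂ
  s : ι → Π x, E.fib x
  hc : ∀ i, HolFn Y (c i) y
  hs : ∀ i, E.HolAt (s i) (φ y)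
  eq : ∀ᶠ z in 𝓝 y, σ z = ∑ i, c i z • s i (φ z)

attribute [instance] Pres.fin

variable {E} in
/-- The covariant derivative of a presented section for the pullback connection. -/
def Pres.deriv {φ : Y ⟶ X} {σ : Π y, E.fib (φ y)} {y : Y} (p : E.Pres φ σ y) :
    Y.T y →ₗ[ℂ] E.fib (φ y) :=
  ∑ i, ((dfn Y (p.c i) y).smulRight (p.s i (φ y)) +
    p.c i y • (E.nabla (p.s i) (φ y) ∘ₗ dmap φ y))

variable {E} in
theorem Pres.deriv_apply {φ : Y ⟶ X} {σ : Π y, E.fib (φ y)} {y : Y} (p : E.Pres φ σ y)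
    (v : Y.T y) : p.deriv v = ∑ i, (dfn Y (p.c i) y v • p.s i (φ y) +
      p.c i y • E.nabla (p.s i) (φ y) (dmap φ y v)) := by
  simp [Pres.deriv, LinearMap.sum_apply]

theorem dfn_sum {ι : Type*} (s : Finset ι) {f : ι → X → ℂ} {x : X}
    (h : ∀ i ∈ s, HolFn X (f i) x) :
    dfn X (fun y => ∑ i ∈ s, f i y) x = ∑ i ∈ s, dfn X (f i) x := by
  classical
  induction s using Finset.induction_on with
  | empty => simpa using dfn_const X 0 x
  | insert a s ha ih =>
    simp only [Finset.sum_insert ha]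
    rw [dfn_add (h a (by simp)) (HolFn.sum' s fun i hi => h i (by simp [hi])),
      ih fun i hi => h i (by simp [hi])]

variable {E} in
/-- Any presentation can be rewritten through a given frame. -/
theorem Pres.exists_frame {φ : Y ⟶ X} {σ : Π y, E.fib (φ y)} {y : Y} (p : E.Pres φ σ y)
    {r : ℕ} {e : Fin r → Π x, E.fib x} (he : IsFrame E.HolAt e (φ y)) :
    ∃ C : Fin r → Y → ℂ, (∀ j, HolFn Y (C j) y) ∧
      (∀ᶠ z in 𝓝 y, σ z = ∑ j, C j z • e j (φ z)) ∧
      ∀ v, p.deriv v = ∑ j, (dfn Y (C j) y v • e j (φ y) +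
        C j y • E.nabla (e j) (φ y) (dmap φ y v)) := by
  choose g hg hs using fun i => (he.iff (p.s i)).1 (p.hs i)
  have hcont : Filter.Tendsto φ (𝓝 y) (𝓝 (φ y)) :=
    (CMan.hom_contMDiff φ).continuous.continuousAt
  have hgφ := fun i j => HolFn.comp φ (hg i j)
  refine ⟨fun j z => ∑ i, p.c i z * g i j (φ z),
    fun j => HolFn.sum' _ fun i _ => (p.hc i).mul' (hgφ i j), ?_, fun v => ?_⟩
  · filter_upwards [p.eq, hcont.eventually (Filter.eventually_all.2 hs)] with z h1 h2
    rw [h1]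
    simp only [h2, Finset.smul_sum, Finset.sum_smul, mul_smul]
    exact Finset.sum_comm
  · rw [p.deriv_apply]
    have hn : ∀ i, E.nabla (p.s i) (φ y) (dmap φ y v) =
        ∑ j, (dfn X (g i j) (φ y) (dmap φ y v) • e j (φ y) +
          g i j (φ y) • E.nabla (e j) (φ y) (dmap φ y v)) := by
      intro i
      have h0 := E.isConn.congr (E.holAt_sum (x := φ y) Finset.univ fun j _ =>
        E.holAt_smul (hg i j) (E.frame_holAt he j)) (hs i)
      rw [h0, E.nabla_sum _ fun j _ => E.holAt_smul (hg i j) (E.frame_holAt he j),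
        LinearMap.sum_apply]
      exact Finset.sum_congr rfl fun j _ => E.isConn.leibniz (hg i j) (E.frame_holAt he j) _
    have hd : ∀ j, dfn Y (fun z => ∑ i, p.c i z * g i j (φ z)) y v =
        ∑ i, (p.c i y * dfn X (g i j) (φ y) (dmap φ y v) + g i j (φ y) * dfn Y (p.c i) y v) := by
      intro j
      rw [dfn_sum _ fun i _ => (p.hc i).mul' (hgφ i j), LinearMap.sum_apply]
      refine Finset.sum_congr rfl fun i _ => ?_
      rw [dfn_mul (p.hc i) (hgφ i j), dfn_comp φ (hg i j)]
      rfl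
    simp only [hn, hd]
    have hs' : ∀ i, p.s i (φ y) = ∑ j, g i j (φ y) • e j (φ y) := fun i => (hs i).self_of_nhds
    simp only [hs', Finset.smul_sum, Finset.sum_smul, ← Finset.sum_add_distrib]
    rw [Finset.sum_comm]
    refine Finset.sum_congr rfl fun j _ => Finset.sum_congr rfl fun i _ => ?_
    module

variable {E} in
theorem Pres.deriv_congr {φ : Y ⟶ X} {σ τ : Π y, E.fib (φ y)} {y : Y} (p : E.Pres φ σ y)
    (q : E.Pres φ τ y) (h : ∀ᶠ z in 𝓝 y, τ z = σ z) : p.deriv = q.deriv := by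
  obtain ⟨r, e, he⟩ := E.isBundle (φ y)
  obtain ⟨C, hC, hC1, hC2⟩ := p.exists_frame he.self_of_nhds
  obtain ⟨C', hC', hC1', hC2'⟩ := q.exists_frame he.self_of_nhds
  have hcont : Filter.Tendsto φ (𝓝 y) (𝓝 (φ y)) :=
    (CMan.hom_contMDiff φ).continuous.continuousAt
  have key : ∀ᶠ z in 𝓝 y, ∀ j, C j z = C' j z := by
    filter_upwards [hC1, hC1', h, hcont.eventually he] with z h1 h2 h3 h4
    have h5 : ∑ j, (C j z - C' j z) • e j (φ z) = 0 := by
      simp only [sub_smul, Finset.sum_sub_distrib]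
      rw [← h1, ← h2, h3, sub_self]
    intro j
    exact sub_eq_zero.1 (Fintype.linearIndependent_iff.1 h4.indep _ h5 j)
  ext v
  rw [hC2, hC2']
  refine Finset.sum_congr rfl fun j _ => ?_
  rw [dfn_congr (key.mono fun z hz => hz j), key.self_of_nhds j]

/-- The holomorphic sections of the pullback bundle. -/
def PullHol (φ : Y ⟶ X) (σ : Π y, E.fib (φ y)) (y : Y) : Prop := Nonempty (E.Pres φ σ y)

open Classical in
/-- The pullback connection. -/
def pullNabla (φ : Y ⟶ X) (σ : Π y, E.fib (φ y)) (y : Y) : Y.T y →ₗ[ℂ] E.fib (φ y) :=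
  if h : E.PullHol φ σ y then (Classical.choice h).deriv else 0

theorem pullNabla_eq {φ : Y ⟶ X} {σ : Π y, E.fib (φ y)} {y : Y} (p : E.Pres φ σ y) :
    E.pullNabla φ σ y = p.deriv := by
  have h : E.PullHol φ σ y := ⟨p⟩
  rw [pullNabla, dif_pos h]
  exact Pres.deriv_congr _ _ (Filter.Eventually.of_forall fun _ => rfl)

theorem pullNabla_junk {φ : Y ⟶ X} {σ : Π y, E.fib (φ y)} {y : Y} (h : ¬ E.PullHol φ σ y) :
    E.pullNabla φ σ y = 0 := dif_neg h

variable {E} in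
/-- Presentations persist nearby. -/
theorem Pres.eventually {φ : Y ⟶ X} {σ : Π y, E.fib (φ y)} {y : Y} (p : E.Pres φ σ y) :
    ∀ᶠ z in 𝓝 y, ∃ q : E.Pres φ σ z, ∀ v, q.deriv v =
      ∑ i, (dfn Y (p.c i) z v • p.s i (φ z) +
      p.c i z • E.nabla (p.s i) (φ z) (dmap φ z v)) := by
  have hcont : Filter.Tendsto φ (𝓝 y) (𝓝 (φ y)) :=
    (CMan.hom_contMDiff φ).continuous.continuousAt
  filter_upwards [eventually_eventually_nhds.2 p.eq,
    Filter.eventually_all.2 fun i => (p.hc i).eventually,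
    hcont.eventually (Filter.eventually_all.2 fun i => E.holAt_eventually (p.hs i))]
    with z h1 h2 h3
  exact ⟨⟨p.ι, p.c, p.s, h2, h3, h1⟩, fun v => Pres.deriv_apply _ v⟩

theorem isFrame_pull {φ : Y ⟶ X} {y : Y} {r : ℕ} {e : Fin r → Π x, E.fib x}
    (he : IsFrame E.HolAt e (φ y)) :
    IsFrame (fib := fun y => E.fib (φ y)) (E.PullHol φ) (fun i z => e i (φ z)) y where
  indep := he.indep
  span := he.span
  iff σ := by
    constructor
    · rintro ⟨p⟩
      obtain ⟨C, hC, hC1, -⟩ := p.exists_frame he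
      exact ⟨C, hC, hC1⟩
    · rintro ⟨c, hc, h⟩
      exact ⟨⟨Fin r, c, e, hc, E.frame_holAt he, h⟩⟩

theorem pull_isBundle (φ : Y ⟶ X) : IsHolBundle (fun y => E.fib (φ y)) (E.PullHol φ) := by
  intro y
  obtain ⟨r, e, he⟩ := E.isBundle (φ y)
  have hcont : Filter.Tendsto φ (𝓝 y) (𝓝 (φ y)) :=
    (CMan.hom_contMDiff φ).continuous.continuousAt
  exact ⟨r, fun i z => e i (φ z), (hcont.eventually he).mono fun z hz => E.isFrame_pull hz⟩

theorem pull_isConn (φ : Y ⟶ X) :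
    IsHolConnection (fib := fun y => E.fib (φ y)) (E.PullHol φ) (E.pullNabla φ) where
  add := by
    rintro σ τ y ⟨p⟩ ⟨q⟩
    let h : E.Pres φ (fun z => σ z + τ z) y :=
      ⟨p.ι ⊕ q.ι, Sum.elim p.c q.c, Sum.elim p.s q.s, by rintro (i | i); exacts [p.hc i, q.hc i],
        by rintro (i | i); exacts [p.hs i, q.hs i], by
        filter_upwards [p.eq, q.eq] with z h1 h2
        simp [h1, h2]⟩
    rw [E.pullNabla_eq h, E.pullNabla_eq p, E.pullNabla_eq q]
    ext v
    rw [LinearMap.add_apply, h.deriv_apply, p.deriv_apply, q.deriv_apply]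
    exact Fintype.sum_sum_type _
  leibniz := by
    rintro f σ y hf ⟨p⟩ v
    let h : E.Pres φ (fun z => f z • σ z) y :=
      ⟨p.ι, fun i z => f z * p.c i z, p.s, fun i => hf.mul' (p.hc i), p.hs, by
        filter_upwards [p.eq] with z h1
        simp [h1, Finset.smul_sum, mul_smul]⟩
    rw [E.pullNabla_eq h, E.pullNabla_eq p, h.deriv_apply, p.deriv_apply, p.eq.self_of_nhds]
    simp only [Finset.smul_sum, ← Finset.sum_add_distrib]
    refine Finset.sum_congr rfl fun i _ => ?_
    change dfn Y (fun z => f z * p.c i z) y v • p.s i (φ y) +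
      (f y * p.c i y) • E.nabla (p.s i) (φ y) (dmap φ y v) = _
    rw [dfn_mul hf (p.hc i)]
    simp only [LinearMap.add_apply, LinearMap.smul_apply, smul_eq_mul]
    module
  congr := by
    rintro σ τ y ⟨p⟩ h
    let q : E.Pres φ τ y := ⟨p.ι, p.c, p.s, p.hc, p.hs, by
      filter_upwards [p.eq, h] with z h1 h2
      rw [h2, h1]⟩
    rw [E.pullNabla_eq p, E.pullNabla_eq q]
    exact (p.deriv_congr q h).symm
  hol := by
    rintro σ y ⟨p⟩ V hV
    obtain ⟨W, a, hW, ha, hWa⟩ := hV.exists_expand φ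
    refine ⟨⟨p.ι ⊕ p.ι × Fin X.dim,
      Sum.elim (fun i z => dfn Y (p.c i) z (V z)) (fun k z => p.c k.1 z * a k.2 z),
      Sum.elim p.s (fun k x => E.nabla (p.s k.1) x (W k.2 x)), ?_, ?_, ?_⟩⟩
    · rintro (i | k)
      exacts [hV.dfn (p.hc i), (p.hc k.1).mul' (ha k.2)]
    · rintro (i | k)
      exacts [p.hs i, E.isConn.hol (p.hs k.1) (hW k.2)]
    · filter_upwards [p.eventually, hWa] with z h1 h2
      obtain ⟨q, hq⟩ := h1
      rw [E.pullNabla_eq q, hq, h2, Fintype.sum_sum_type, Finset.sum_add_distrib]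
      congr 1
      rw [Fintype.sum_prod_type]
      refine Finset.sum_congr rfl fun i _ => ?_
      simp only [map_sum, map_smul, Finset.smul_sum, Sum.elim_inr, mul_smul]
  junk := fun h => dif_neg h

/-- Morphisms are isomorphisms of holomorphic vector bundles; they need not respect the
connections. -/
@[ext]
structure Hom (E F : HVBObj X) : Type u where
  equiv : ∀ x, E.fib x ≃ₗ[ℂ] F.fib x
  hol : ∀ σ x, E.HolAt σ x ↔ F.HolAt (fun y => equiv y (σ y)) x

instance : Category (HVBObj X) where
  Hom := Hom
  id E := ⟨fun _ => LinearEquiv.refl ℂ _, fun _ _ => Iff.rfl⟩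
  comp f g := ⟨fun x => (f.equiv x).trans (g.equiv x), fun σ x => (f.hol σ x).trans (g.hol _ x)⟩

theorem mk_eq {fib : X → Type u} [∀ x, AddCommGroup (fib x)] [∀ x, Module ℂ (fib x)]
    {H H' : (Π x, fib x) → X → Prop} {D D' : (Π x, fib x) → Π x, X.T x →ₗ[ℂ] fib x}
    (h1 : IsHolBundle fib H) (h2 : IsHolConnection H D) (h1' : IsHolBundle fib H')
    (h2' : IsHolConnection H' D') (hH : H = H') (hD : D = D') :
    HVBObj.mk fib H D h1 h2 = HVBObj.mk fib H' D' h1' h2' := by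
  subst hH hD
  rfl

theorem hom_heq {E E' F F' : HVBObj X} (hE : E = E') (hF : F = F') (f : E ⟶ F) (g : E' ⟶ F')
    (h : ∀ x, HEq (Hom.equiv f x) (Hom.equiv g x)) : HEq f g := by
  subst hE hF
  exact heq_of_eq (Hom.ext (funext fun x => eq_of_heq (h x)))

/-- The pullback of a holomorphic vector bundle with connection. -/
def pull (φ : Y ⟶ X) : HVBObj Y where
  fib y := E.fib (φ y)
  HolAt := E.PullHol φ
  nabla := E.pullNabla φ
  isBundle := E.pull_isBundle φ
  isConn := E.pull_isConn φ

variable {E} in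
theorem Hom.pullHol {F : HVBObj X} (f : Hom E F) (φ : Y ⟶ X) (σ : Π y, E.fib (φ y)) (y : Y)
    (h : E.PullHol φ σ y) : F.PullHol φ (fun z => f.equiv (φ z) (σ z)) y := by
  obtain ⟨p⟩ := h
  refine ⟨⟨p.ι, p.c, fun i x => f.equiv x (p.s i x), p.hc, fun i => (f.hol _ _).1 (p.hs i), ?_⟩⟩
  filter_upwards [p.eq] with z hz
  simp [hz]

variable {E} in
/-- The inverse isomorphism. -/
def Hom.symm {F : HVBObj X} (f : Hom E F) : Hom F E where
  equiv x := (f.equiv x).symm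
  hol σ x := by simp [f.hol]

/-- Pullback is functorial in the bundle. -/
def pullFunctor (φ : Y ⟶ X) : HVBObj X ⥤ HVBObj Y where
  obj E := E.pull φ
  map {E F} f := ⟨fun y => Hom.equiv f (φ y), fun σ y => ⟨Hom.pullHol f φ σ y, fun h => by
    have := Hom.pullHol (Hom.symm f) φ _ y h
    have e : (fun z => (Hom.symm f).equiv (φ z) (Hom.equiv f (φ z) (σ z))) = σ :=
      funext fun z => LinearEquiv.symm_apply_apply _ _
    exact (congrArg (fun s => E.PullHol φ s y) e).mp this⟩⟩

theorem pull_id : E.pull (𝟙 X) = E := by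
  have hp : ∀ {σ : Π x, E.fib x} {x : X}, E.HolAt σ x →
      ∃ p : E.Pres (𝟙 X) σ x, p.deriv = E.nabla σ x := by
    intro σ x h
    refine ⟨⟨Unit, fun _ _ => 1, fun _ => σ, fun _ => HolFn.const X 1 x, fun _ => h, ?_⟩, ?_⟩
    · exact Filter.Eventually.of_forall fun z => by
        change σ z = ∑ i : Unit, (1 : ℂ) • σ z
        simp
    · ext v
      refine (Pres.deriv_apply _ v).trans ?_
      change ∑ i : Unit, (dfn X (fun _ => 1) x v • σ x + (1 : ℂ) • E.nabla σ x (dmap (𝟙 X) x v)) = _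
      rw [dfn_const, dmap_id]
      simp only [LinearMap.zero_apply, zero_smul, zero_add, one_smul, Finset.univ_unique,
        Finset.sum_const, Finset.card_singleton]
      rfl
  have hH : E.PullHol (𝟙 X) = E.HolAt := by
    funext σ x
    refine propext ⟨?_, fun h => ⟨(hp h).choose⟩⟩
    rintro ⟨p⟩
    exact E.holAt_congr (E.holAt_sum Finset.univ fun i _ => E.holAt_smul (p.hc i) (p.hs i)) p.eq
  refine mk_eq _ _ _ _ hH ?_
  funext σ x
  by_cases h : E.HolAt σ x
  · obtain ⟨p, hp⟩ := hp h
    exact (E.pullNabla_eq p).trans hp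
  · rw [E.isConn.junk h]
    exact dif_neg (by rwa [hH])

theorem pull_comp (ψ : Z ⟶ Y) (φ : Y ⟶ X) : E.pull (ψ ≫ φ) = (E.pull φ).pull ψ := by
  have hp : ∀ {σ : Π z, E.fib (φ (ψ z))} {z : Z} (p : E.Pres (ψ ≫ φ) σ z),
      ∃ q : (E.pull φ).Pres ψ σ z, q.deriv = p.deriv := by
    intro σ z p
    let s : ∀ i, E.Pres φ (fun y => p.s i (φ y)) (ψ z) := fun i =>
      ⟨Unit, fun _ _ => 1, fun _ => p.s i, fun _ => HolFn.const Y 1 _, fun _ => p.hs i,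
        Filter.Eventually.of_forall fun z => by simp⟩
    refine ⟨@Pres.mk _ _ (E.pull φ) ψ σ z p.ι p.fin p.c (fun i y => p.s i (φ y)) p.hc
      (fun i => ⟨s i⟩) p.eq, ?_⟩
    ext v
    refine (Pres.deriv_apply _ v).trans (Eq.trans ?_ (Pres.deriv_apply p v).symm)
    refine Finset.sum_congr rfl fun i _ => ?_
    congr 2
    change E.pullNabla φ (fun y => p.s i (φ y)) (ψ z) (dmap ψ z v) = _
    rw [E.pullNabla_eq (s i), Pres.deriv_apply, dmap_comp]
    change ∑ j : Unit, (dfn Y (fun _ => 1) (ψ z) _ • _ + (1 : ℂ) • E.nabla (p.s i) _ _) = _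
    rw [dfn_const]
    simp only [LinearMap.zero_apply, zero_smul, zero_add, one_smul, Finset.univ_unique,
      Finset.sum_const, Finset.card_singleton]
    rfl
  have hH : E.PullHol (ψ ≫ φ) = (E.pull φ).PullHol ψ := by
    funext σ z
    refine propext ⟨fun ⟨p⟩ => ⟨(hp p).choose⟩, ?_⟩
    rintro ⟨⟨ι, c, s, hc, hs, eq⟩⟩
    have hcont : Filter.Tendsto ψ (𝓝 z) (𝓝 (ψ z)) :=
      (CMan.hom_contMDiff ψ).continuous.continuousAt
    have p : ∀ i, E.Pres φ (s i) (ψ z) := fun i => Classical.choice (hs i)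
    let _ : ∀ i, Fintype (p i).ι := fun i => (p i).fin
    refine ⟨⟨Σ i, (p i).ι, fun k w => c k.1 w * (p k.1).c k.2 (ψ w),
      fun k => (p k.1).s k.2, fun k => (hc k.1).mul' (HolFn.comp ψ ((p k.1).hc k.2)),
      fun k => (p k.1).hs k.2, ?_⟩⟩
    filter_upwards [eq, hcont.eventually (Filter.eventually_all.2 fun i => (p i).eq)]
      with w h1 h2
    refine h1.trans (Eq.trans ?_ (Fintype.sum_sigma _).symm)
    refine Finset.sum_congr rfl fun i _ => ?_
    rw [h2]
    change (c i w • (∑ j, (p i).c j (ψ w) • (p i).s j (φ (ψ w)) : E.fib (φ (ψ w))) :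
      E.fib (φ (ψ w))) = ∑ j, (c i w * (p i).c j (ψ w)) • (p i).s j (φ (ψ w))
    simp only [Finset.smul_sum, mul_smul]
  refine mk_eq _ _ _ _ hH ?_
  funext σ z
  by_cases h : E.PullHol (ψ ≫ φ) σ z
  · obtain ⟨p⟩ := h
    obtain ⟨q, hq⟩ := hp p
    exact (E.pullNabla_eq p).trans (hq.symm.trans ((E.pull φ).pullNabla_eq q).symm)
  · exact (E.pullNabla_junk h).trans ((E.pull φ).pullNabla_junk (by rwa [← hH])).symm

end HVBObj

/-- The presheaf of groupoids of holomorphic vector bundles with connection. -/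
def HVBCat : CMan.{u}ᵒᵖ ⥤ Cat.{u, u + 1} where
  obj X := Cat.of (HVBObj X.unop)
  map φ := (HVBObj.pullFunctor φ.unop).toCatHom
  map_id X := by
    ext1
    exact CategoryTheory.Functor.hext (fun E => E.pull_id) fun E F f =>
      HVBObj.hom_heq E.pull_id F.pull_id _ _ fun x => HEq.rfl
  map_comp φ ψ := by
    ext1
    exact CategoryTheory.Functor.hext (fun E => E.pull_comp ψ.unop φ.unop) fun E F f =>
      HVBObj.hom_heq (E.pull_comp ψ.unop φ.unop) (F.pull_comp ψ.unop φ.unop) _ _ fun x => HEq.rfl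

/-- The simplicial presheaf `HVB`. -/
def HVB : CMan.{u}ᵒᵖ ⥤ SSet.{u + 1} := HVBCat ⋙ nerveFunctor.{u, u + 1}

/-- A cochain complex of abelian groups, from its groups and its differential. -/
def cochains (X : ℕ → AddCommGrpCat.{u}) (d : ∀ n, X n →+ X (n + 1))
    (h : ∀ n x, d (n + 1) (d n x) = 0) : CochainComplex AddCommGrpCat.{u} ℕ :=
  CochainComplex.of X (fun n => AddCommGrpCat.ofHom (d n)) fun n => by
    ext x
    exact h n x

/-- The complex of holomorphic forms with zero differential. -/
def holComplex : CManᵒᵖ ⥤ CochainComplex AddCommGrpCat.{u} ℕ where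
  obj X := { X := fun q => (holForms q).obj X, d := fun _ _ => 0 }
  map φ := { f := fun q => (holForms q).map φ }

section Q

variable (C : CochainComplex AddCommGrpCat.{u} ℕ)

/-- Elements of cohomological degree `-n` of `C[[u]]`, truncated to nonpositive degrees. The
component with index `(k, m)` is the coefficient, in `C.X m`, of `u ^ k`, where `u` has
degree `-2`. In degree `0` all components have to be cocycles. -/
def QX (n : ℕ) : AddSubgroup (Π p : {p : ℕ × ℕ // p.2 + n = 2 * p.1}, C.X p.1.2) where
  carrier := {c | n = 0 → ∀ p, C.d p.1.2 (p.1.2 + 1) (c p) = 0}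
  zero_mem' := fun _ p => map_zero (C.d p.1.2 (p.1.2 + 1)).hom
  add_mem' := fun h h' hn p => by
    change C.d p.1.2 (p.1.2 + 1) (_ + _) = 0
    rw [map_add, h hn p, h' hn p, add_zero]
  neg_mem' := fun h hn p => by
    change C.d p.1.2 (p.1.2 + 1) (-_) = 0
    rw [map_neg, h hn p, neg_zero]

/-- The differential on `C[[u]]`, coefficientwise the differential of `C`. -/
def Qd (n : ℕ) : QX C (n + 1) →+ QX C n where
  toFun c := ⟨fun p => match p with
    | ⟨(_, 0), _⟩ => 0
    | ⟨(k, m + 1), h⟩ => C.d m (m + 1) (c.1 ⟨(k, m), by simp only at h ⊢; omega⟩), by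
      rintro - ⟨⟨k, m⟩, h⟩
      cases m with
      | zero => exact map_zero (C.d 0 1).hom
      | succ m =>
        exact ConcreteCategory.congr_hom (C.d_comp_d m (m + 1) (m + 1 + 1)) _⟩
  map_zero' := by
    ext ⟨⟨k, m⟩, h⟩
    cases m with
    | zero => rfl
    | succ m => exact map_zero (C.d m (m + 1)).hom
  map_add' c c' := by
    ext ⟨⟨k, m⟩, h⟩
    cases m with
    | zero => exact (add_zero (0 : C.X 0)).symm
    | succ m => exact map_add (C.d m (m + 1)).hom _ _

/-- The chain complex `C[[u]]` truncated to nonpositive degrees, chain degree `n` being cohomological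
degree `-n`. -/
def QObj : ChainComplex AddCommGrpCat.{u} ℕ :=
  ChainComplex.of (fun n => AddCommGrpCat.of (QX C n)) (fun n => AddCommGrpCat.ofHom (Qd C n))
    fun n => by
      ext c ⟨⟨k, m⟩, h⟩
      match m with
      | 0 => rfl
      | 1 => exact map_zero (C.d 0 1).hom
      | m + 2 => exact ConcreteCategory.congr_hom (C.d_comp_d m (m + 1) (m + 1 + 1)) _

theorem QObj_d (n : ℕ) : (QObj C).d (n + 1) n = AddCommGrpCat.ofHom (Qd C n) :=
  ChainComplex.of_d (fun n => AddCommGrpCat.of (QX C n)) (fun n => AddCommGrpCat.ofHom (Qd C n)) n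

variable {C} in
/-- Functoriality of `C[[u]]`. -/
def QMap {D : CochainComplex AddCommGrpCat.{u} ℕ} (f : C ⟶ D) (n : ℕ) : QX C n →+ QX D n where
  toFun c := ⟨fun p => f.f p.1.2 (c.1 p), fun hn p => by
    have := ConcreteCategory.congr_hom (f.comm p.1.2 (p.1.2 + 1)) (c.1 p)
    refine this.trans ?_
    change f.f _ (C.d _ _ (c.1 p)) = 0
    rw [c.2 hn p, map_zero]⟩
  map_zero' := by
    ext p
    exact map_zero (f.f p.1.2).hom
  map_add' c c' := by
    ext p
    exact map_add (f.f p.1.2).hom _ _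

end Q

/-- The functor `C ↦ C[[u]]`, truncated to nonpositive degrees. -/
def Q : CochainComplex AddCommGrpCat.{u} ℕ ⥤ ChainComplex AddCommGrpCat.{u} ℕ where
  obj C := QObj C
  map {C D} f := ChainComplex.ofHom (fun n => AddCommGrpCat.ofHom (QMap f n))
    fun n => by
      rw [QObj_d, QObj_d]
      refine AddCommGrpCat.hom_ext (AddMonoidHom.ext fun c => Subtype.ext (funext ?_))
      rintro ⟨⟨k, m⟩, h⟩
      cases m with
      | zero => exact (map_zero (f.f 0).hom).symm
      | succ m => exact ConcreteCategory.congr_hom (f.comm m (m + 1)) _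
  map_id C := rfl
  map_comp f g := rfl

/-- The Dold-Kan functor: the `n`-simplices of `DK C` are the chain maps to `C` from the
normalized integral chains on the standard `n`-simplex. -/
def DK : ChainComplex AddCommGrpCat.{u} ℕ ⥤ SSet.{u} :=
  yoneda ⋙ (Functor.whiskeringLeft _ _ _).obj
    (SSet.stdSimplex.{u} ⋙
      SSet.normalizedChainComplexFunctorObj (AddCommGrpCat.of (ULift.{u} ℤ))).op

/-- The value of a simplex of `DK C` on the generator given by a simplex of the standard
simplex. -/
def DKval {C : ChainComplex AddCommGrpCat.{u} ℕ} {n : SimplexCategory} (x : (DK.obj C).obj (op n))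
    {p : ℕ} (σ : ⦋p⦌ ⟶ n) : C.X p :=
  let f : (SSet.stdSimplex.{u}.obj n).normalizedChainComplex
    (AddCommGrpCat.of (ULift.{u} ℤ)) ⟶ C := x
  (f.f p).hom ((SSet.ιNormalizedChainComplex (SSet.stdSimplex.{u}.obj n)
    (R := AddCommGrpCat.of (ULift.{u} ℤ)) (SSet.stdSimplex.objEquiv.symm σ)).hom (ULift.up 1))

/-- The Dold-Kan functor, raised to the universe of the nerve of the groupoid of bundles. -/
def DKu : ChainComplex AddCommGrpCat.{u} ℕ ⥤ SSet.{u + 1} := DK ⋙ SSet.uliftFunctor.{u + 1, u}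

/-- The simplicial presheaf of holomorphic forms. -/
def Omega : CMan.{u}ᵒᵖ ⥤ SSet.{u + 1} := holComplex ⋙ Q ⋙ DKu

/-! Covers and their Cech complexes. -/

section Cech

variable {M : CMan.{u}}

/-- An open subset of a complex manifold, as a complex manifold. -/
def openMan (V : Opens M) : CMan.{u} where
  dim := M.dim
  carrier := V

/-- The inclusion of open subsets. -/
def openIncl {V W : Opens M} (h : V ≤ W) : openMan V ⟶ openMan W :=
  (⟨Set.inclusion h, contMDiff_inclusion h⟩ : C^ω⟮M.I, V; M.I, W⟯)

variable {I : Type u} (U : I → Opens M)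

/-- The intersection of the members of the cover with the given indices. -/
def inter {l : ℕ} (a : Fin (l + 1) → I) : Opens M :=
  ⟨{x | ∀ j, x ∈ U (a j)}, by
    simp only [Set.ofPred_forall]
    exact isOpen_iInter_of_finite fun j => (U (a j)).isOpen⟩

theorem inter_le {l m : ℕ} (a : Fin (m + 1) → I) (θ : Fin (l + 1) → Fin (m + 1)) :
    inter U a ≤ inter U (a ∘ θ) := fun _ h j => h (θ j)

theorem contMDiff_reindex {l m : ℕ} (θ : Fin (l + 1) → Fin (m + 1)) :
    ContMDiff M.I M.I ω (fun x : Σ a : Fin (m + 1) → I, inter U a =>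
      (⟨x.1 ∘ θ, Set.inclusion (inter_le U x.1 θ) x.2⟩ : Σ a : Fin (l + 1) → I, inter U a)) := by
  refine contMDiff_sigma fun a => ?_
  have h := contMDiff_sigmaMk (n := M.dim) (X := fun a : Fin (l + 1) → I => inter U a) (a ∘ θ)
  exact h.comp (contMDiff_inclusion (inter_le U a θ))

/-- The Cech nerve of a cover: in degree `l`, the disjoint union of the `(l+1)`-fold
intersections. -/
def cechNerve : SimplexCategoryᵒᵖ ⥤ CMan.{u} where
  obj l :=
    { dim := M.dim
      carrier := Σ a : Fin (l.unop.len + 1) → I, inter U a }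
  map {m l} θ := (⟨_, contMDiff_reindex U θ.unop.toOrderHom⟩ :
    C^ω⟮M.I, Σ a : Fin (m.unop.len + 1) → I, inter U a;
      M.I, Σ a : Fin (l.unop.len + 1) → I, inter U a⟯)
  map_id _ := rfl
  map_comp _ _ := rfl

/-- The inclusion of a piece into the Cech nerve. -/
def pieceIncl {l : SimplexCategory} (a : Fin (l.len + 1) → I) :
    openMan (inter U a) ⟶ (cechNerve U).obj (op l) :=
  (⟨fun x => ⟨a, x⟩, contMDiff_sigmaMk (X := fun a => inter U a) a⟩ :
    C^ω⟮M.I, inter U a; M.I, Σ a : Fin (l.len + 1) → I, inter U a⟯)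

variable (F : CMan.{u}ᵒᵖ ⥤ AddCommGrpCat.{u})

/-- The cosimplicial group of Cech cochains with values in a presheaf. -/
def cechCosimplicial : CosimplicialObject AddCommGrpCat.{u} where
  obj l := AddCommGrpCat.of (Π a : Fin (l.len + 1) → I, F.obj (op (openMan (inter U a))))
  map {l m} θ := AddCommGrpCat.ofHom
    { toFun := fun c a => F.map (openIncl (inter_le U a θ.toOrderHom)).op (c (a ∘ θ.toOrderHom))
      map_zero' := by
        funext a
        exact map_zero (F.map (openIncl (inter_le U a θ.toOrderHom)).op).hom
      map_add' := fun c c' => by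
        funext a
        exact map_add (F.map (openIncl (inter_le U a θ.toOrderHom)).op).hom _ _ }
  map_id l := by
    refine AddCommGrpCat.hom_ext (AddMonoidHom.ext fun c => funext fun a => ?_)
    exact ConcreteCategory.congr_hom (F.map_id (op (openMan (inter U a)))) (c a)
  map_comp {l m n} θ θ' := by
    refine AddCommGrpCat.hom_ext (AddMonoidHom.ext fun c => funext fun a => ?_)
    exact ConcreteCategory.congr_hom (F.map_comp
      (openIncl (inter_le U (a ∘ θ'.toOrderHom) θ.toOrderHom)).op
      (openIncl (inter_le U a θ'.toOrderHom)).op) (c ((a ∘ θ'.toOrderHom) ∘ θ.toOrderHom))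

/-- The comparison of the values of a presheaf on the Cech nerve with its Cech cochains, by
restriction to the pieces. -/
def restrictPieces : (cechNerve U).rightOp ⋙ F ⟶ cechCosimplicial U F where
  app l := AddCommGrpCat.ofHom
    { toFun := fun c a => F.map (pieceIncl U a).op c
      map_zero' := by
        funext a
        exact map_zero (F.map (pieceIncl U a).op).hom
      map_add' := fun c c' => by
        funext a
        exact map_add (F.map (pieceIncl U a).op).hom _ _ }
  naturality l m θ := by
    refine AddCommGrpCat.hom_ext (AddMonoidHom.ext fun c => funext fun a => ?_)
    have e : pieceIncl U a ≫ (cechNerve U).map θ.op =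
      openIncl (inter_le U a θ.toOrderHom) ≫ pieceIncl U (a ∘ θ.toOrderHom) := rfl
    have h1 := ConcreteCategory.congr_hom
      (F.map_comp ((cechNerve U).map θ.op).op (pieceIncl U a).op) c
    have h2 := ConcreteCategory.congr_hom
      (F.map_comp (pieceIncl U (a ∘ θ.toOrderHom)).op (openIncl (inter_le U a θ.toOrderHom)).op) c
    exact h1.symm.trans ((congrArg (fun f => F.map f.op c) e).trans h2)

/-- The complex of Cech cochains with values in holomorphic `q`-forms. -/
def cechForms (q : ℕ) : CochainComplex AddCommGrpCat.{u} ℕ :=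
  (AlgebraicTopology.alternatingCofaceMapComplex _).obj (cechCosimplicial U (holForms q))

/-- The group of Cech-Hodge cochains of degree `m`: Cech `l`-cochains with values in holomorphic
`q`-forms for all `l + q = m`. -/
abbrev CechX (m : ℕ) : Type u := Π b : {b : ℕ × ℕ // b.1 + b.2 = m}, (cechForms U b.1.2).X b.1.1

/-- The Cech differential on Cech-Hodge cochains. -/
def cechd (m : ℕ) : CechX U m →+ CechX U (m + 1) where
  toFun c := fun b => match b with
    | ⟨(0, _), _⟩ => 0
    | ⟨(l + 1, q), h⟩ => (cechForms U q).d l (l + 1) (c ⟨(l, q), by simp only at h ⊢; omega⟩)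
  map_zero' := by
    funext ⟨⟨l, q⟩, h⟩
    cases l with
    | zero => rfl
    | succ l => exact map_zero ((cechForms U q).d l (l + 1)).hom
  map_add' c c' := by
    funext ⟨⟨l, q⟩, h⟩
    cases l with
    | zero => exact (add_zero (0 : (cechForms U q).X 0)).symm
    | succ l => exact map_add ((cechForms U q).d l (l + 1)).hom _ _

theorem cechd_cechd (m : ℕ) (c : CechX U m) : cechd U (m + 1) (cechd U m c) = 0 := by
  funext ⟨⟨l, q⟩, h⟩
  match l with
  | 0 => rfl
  | 1 => exact map_zero ((cechForms U q).d 0 1).hom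
  | l + 2 =>
    have := (cechForms U q).d_comp_d l (l + 1) (l + 1 + 1)
    exact ConcreteCategory.congr_hom this _

/-- The Cech-Hodge complex, with the Cech differential. -/
def cech : CochainComplex AddCommGrpCat.{u} ℕ :=
  CochainComplex.of (fun m => AddCommGrpCat.of (CechX U m))
    (fun m => AddCommGrpCat.ofHom (cechd U m)) fun m =>
      AddCommGrpCat.hom_ext (AddMonoidHom.ext fun c => cechd_cechd U m c)

/-- The component of a Cech-Hodge cochain on an `(l+1)`-fold intersection, in form degree `q`. -/
def cechComp {m l q : ℕ} (c : (cech U).X m) (h : l + q = m) (a : Fin (l + 1) → I) :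
    HolForm (openMan (inter U a)) q :=
  (c : CechX U m) ⟨(l, q), h⟩ a

end Cech

/-! Totalization and weak equivalences. -/

/-- Totalization of a cosimplicial simplicial set: the equalizer of the two natural maps from the
product of the simplicial sets of maps from the standard `l`-simplex to the `l`-th level. -/
def Tot : (SimplexCategory ⥤ SSet.{w}) ⥤ SSet.{w} where
  obj X :=
    { obj := fun n => {x : Π l : SimplexCategory,
        (SSet.stdSimplex.{w}.obj l ⊗ SSet.stdSimplex.{w}.obj n.unop ⟶ X.obj l) //
        ∀ ⦃l m : SimplexCategory⦄ (ρ : l ⟶ m),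
          (SSet.stdSimplex.{w}.map ρ ▷ SSet.stdSimplex.{w}.obj n.unop) ≫ x m = x l ≫ X.map ρ}
      map := fun {n n'} θ => TypeCat.ofHom fun x =>
        ⟨fun l => (SSet.stdSimplex.{w}.obj l ◁ SSet.stdSimplex.{w}.map θ.unop) ≫ x.1 l,
          fun l m ρ => by
            rw [Category.assoc, ← x.2 ρ, ← MonoidalCategory.whisker_exchange_assoc]⟩
      map_id := fun n => by
        refine ConcreteCategory.hom_ext _ _ fun x => Subtype.ext (funext fun l => ?_)
        refine (congrArg (fun f => (SSet.stdSimplex.{w}.obj l ◁ f) ≫ x.1 l)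
          (SSet.stdSimplex.{w}.map_id n.unop)).trans ?_
        rw [MonoidalCategory.whiskerLeft_id, Category.id_comp]
        rfl
      map_comp := fun {n n' n''} θ θ' => by
        refine ConcreteCategory.hom_ext _ _ fun x => Subtype.ext (funext fun l => ?_)
        refine (congrArg (fun f => (SSet.stdSimplex.{w}.obj l ◁ f) ≫ x.1 l)
          (SSet.stdSimplex.{w}.map_comp θ'.unop θ.unop)).trans ?_
        rw [MonoidalCategory.whiskerLeft_comp, Category.assoc]
        rfl }
  map {X Y} f :=
    { app := fun n => TypeCat.ofHom fun x => ⟨fun l => x.1 l ≫ f.app l, fun l m ρ => by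
        rw [← Category.assoc, x.2 ρ, Category.assoc, f.naturality, Category.assoc]⟩
      naturality := fun n n' θ => by
        refine ConcreteCategory.hom_ext _ _ fun x => Subtype.ext (funext fun l => ?_)
        exact Category.assoc _ _ _ }
  map_id X := by
    refine NatTrans.ext (funext fun n => ?_)
    refine ConcreteCategory.hom_ext _ _ fun x => Subtype.ext (funext fun l => ?_)
    exact Category.comp_id _
  map_comp f g := by
    refine NatTrans.ext (funext fun n => ?_)
    refine ConcreteCategory.hom_ext _ _ fun x => Subtype.ext (funext fun l => ?_)
    exact (Category.assoc _ _ _).symm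

/-- Weak equivalences of simplicial sets: maps that induce bijections on homotopy classes of maps to
every Kan complex. (Equivalently, the geometric realization induces isomorphisms on all homotopy
groups.) -/
def IsWeakEquivalence {X Y : SSet.{w}} (f : X ⟶ Y) : Prop :=
  ∀ K : SSet.{w}, SSet.KanComplex K →
    (∀ h : X ⟶ K, ∃ g : Y ⟶ K, Nonempty (SSet.Homotopy (f ≫ g) h)) ∧
    (∀ g g' : Y ⟶ K, Nonempty (SSet.Homotopy (f ≫ g) (f ≫ g')) → Nonempty (SSet.Homotopy g g'))

/-! The Chern character. -/

section Chern

variable {X : CMan.{u}}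

/-- The derivative of an isomorphism of bundles with connection, with respect to the induced
connection on the bundle of homomorphisms. -/
theorem exists_homNabla {E F : HVBObj X} (f : E ⟶ F) (y : X) :
    ∃ A : X.T y →ₗ[ℂ] E.fib y →ₗ[ℂ] F.fib y, ∀ s : Π x, E.fib x, E.HolAt s y → ∀ v,
      A v (s y) = F.nabla (fun x => HVBObj.Hom.equiv f x (s x)) y v -
        HVBObj.Hom.equiv f y (E.nabla s y v) := by
  obtain ⟨r, e, he⟩ := E.isBundle y
  have he := he.self_of_nhds
  let b : Module.Basis (Fin r) ℂ (E.fib y) := Module.Basis.mk he.indep he.span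
  let g := HVBObj.Hom.equiv f
  have hg : ∀ {s : Π x, E.fib x}, E.HolAt s y → F.HolAt (fun x => g x (s x)) y :=
    fun h => (HVBObj.Hom.hol f _ _).1 h
  let D : Fin r → X.T y →ₗ[ℂ] F.fib y := fun i =>
    F.nabla (fun x => g x (e i x)) y - (g y).toLinearMap ∘ₗ E.nabla (e i) y
  refine ⟨∑ i, LinearMap.smulRightₗ (b.coord i) ∘ₗ D i, fun s hs v => ?_⟩
  obtain ⟨c, hc, hs'⟩ := (he.iff s).1 hs
  have h1 : E.nabla s y v = ∑ i, (dfn X (c i) y v • e i y + c i y • E.nabla (e i) y v) := by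
    rw [E.isConn.congr (E.holAt_sum Finset.univ fun i _ =>
      E.holAt_smul (hc i) (E.frame_holAt he i)) hs',
      E.nabla_sum _ fun i _ => E.holAt_smul (hc i) (E.frame_holAt he i), LinearMap.sum_apply]
    exact Finset.sum_congr rfl fun i _ => E.isConn.leibniz (hc i) (E.frame_holAt he i) v
  have h2 : F.nabla (fun x => g x (s x)) y v =
      ∑ i, (dfn X (c i) y v • g y (e i y) + c i y • F.nabla (fun x => g x (e i x)) y v) := by
    have hev : ∀ᶠ x in 𝓝 y, g x (s x) = ∑ i, c i x • g x (e i x) := by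
      filter_upwards [hs'] with x hx
      rw [hx]
      simp
    rw [F.isConn.congr (F.holAt_sum Finset.univ fun i _ =>
      F.holAt_smul (hc i) (hg (E.frame_holAt he i))) hev,
      F.nabla_sum _ fun i _ => F.holAt_smul (hc i) (hg (E.frame_holAt he i)),
      LinearMap.sum_apply]
    exact Finset.sum_congr rfl fun i _ => F.isConn.leibniz (hc i) (hg (E.frame_holAt he i)) v
  have h3 : ∀ i, b.coord i (s y) = c i y := by
    intro i
    have hb : ∀ j, e j y = b j := fun j => (Module.Basis.mk_apply he.indep he.span j).symm
    rw [hs'.self_of_nhds]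
    simp only [hb]
    simp [Finsupp.single_apply]
  change _ = F.nabla (fun x => g x (s x)) y v - g y (E.nabla s y v)
  rw [h1, h2, LinearMap.sum_apply, LinearMap.sum_apply, map_sum, ← Finset.sum_sub_distrib]
  refine Finset.sum_congr rfl fun i _ => ?_
  change b.coord i (s y) • D i v = _
  rw [h3]
  simp only [D, LinearMap.sub_apply, LinearMap.comp_apply, map_add, map_smul]
  change c i y • (_ - g y _) = _
  module

/-- The derivative `∇ f` of an isomorphism `f` of bundles with connection, at a point. It is
characterized by `(∇ f) s = ∇ (f s) - f (∇ s)` for holomorphic sections `s`. -/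
def homNabla {E F : HVBObj X} (f : E ⟶ F) (y : X) : X.T y →ₗ[ℂ] E.fib y →ₗ[ℂ] F.fib y :=
  (exists_homNabla f y).choose

/-- For `E 0 → ⋯ → E l`, the composite `∇ f_l (v 0) ∘ ⋯ ∘ ∇ f_1 (v (l - 1))`, up to stage `j`. -/
def nablaPath {l : ℕ} (x : ComposableArrows (HVBObj X) l) (y : X) (v : Fin l → X.T y)
    (j : Fin (l + 1)) : (x.obj 0).fib y →ₗ[ℂ] (x.obj j).fib y :=
  Fin.induction (motive := fun j => (x.obj 0).fib y →ₗ[ℂ] (x.obj j).fib y) LinearMap.id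
    (fun i P => homNabla (x.map (homOfLE i.castSucc_le_succ)) y (v i.rev) ∘ₗ P) j

/-- The value at a point of the form `tr (f⁻¹ ∇ f_l ∧ ⋯ ∧ ∇ f_1)`, where `f` is the
composite of the isomorphisms `f_1, …, f_l`. -/
def traceForm {l : ℕ} (x : ComposableArrows (HVBObj X) l) (y : X) (v : Fin l → X.T y) : ℂ :=
  ∑ π : Equiv.Perm (Fin l), (Equiv.Perm.sign π : ℤ) •
    LinearMap.trace ℂ ((x.obj 0).fib y)
      ((HVBObj.Hom.equiv (x.map (homOfLE (Fin.zero_le (Fin.last l)))) y).symm.toLinearMap ∘ₗ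
        nablaPath x y (v ∘ π) (Fin.last l))

/-- The map `Ch` sends a sequence of isomorphisms of bundles with connection to the simplex whose
value on an `l`-dimensional face is `tr (f⁻¹ ∇ f_l ∧ ⋯ ∧ ∇ f_1) u ^ l`. -/
def IsChernCharacter (Ch : HVB.{u} ⟶ Omega.{u}) : Prop :=
  ∀ (X : CMan.{u}) (n : SimplexCategory) (x : (HVB.obj (op X)).obj (op n)) (l : ℕ) (σ : ⦋l⦌ ⟶ n)
    (p : {p : ℕ × ℕ // p.2 + l = 2 * p.1}) (y : X) (v : Fin p.1.2 → X.T y),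
    let c : QX (holComplex.obj (op X)) l :=
      DKval (C := Q.obj (holComplex.obj (op X))) ((Ch.app (op X)).app (op n) x).down σ
    let η : HolForm X p.1.2 := c.1 p
    let x' : ComposableArrows (HVBObj X) l := (HVB.obj (op X)).map σ.op x
    η.1 y v = if h : l = p.1.2 then traceForm x' y (v ∘ Fin.cast h) else 0

end Chern

/-! The comparison map. -/

/-- The monotone map that increases by one at the steps in `S` and is constant at the other
steps. -/
def stepMap {N r : ℕ} (S : Finset (Fin N)) (h : S.card = r) : ⦋N⦌ ⟶ ⦋r⦌ :=
  SimplexCategory.mkHom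
    { toFun := fun t => ⟨(S.filter fun j => j.val < t.val).card,
        Nat.lt_succ_of_le (h ▸ Finset.card_filter_le _ _)⟩
      monotone' := fun _ _ hst => Finset.card_le_card fun j hj => by
        simp only [Finset.mem_filter] at hj ⊢
        exact ⟨hj.1, hj.2.trans_le hst⟩ }

/-- The sign of a shuffle. -/
def shuffleSign {N : ℕ} (S : Finset (Fin N)) : ℤ :=
  (-1) ^ ((S ×ˢ Sᶜ).filter fun ab => ab.2 < ab.1).card

theorem card_compl_shuffle {p l : ℕ} {S : Finset (Fin (p + l))} (h : S.card = p) :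
    Sᶜ.card = l := by
  rw [Finset.card_compl, Fintype.card_fin, h]
  omega

variable {M : CMan.{u}} {I : Type u} (U : I → Opens M)

/-- The map `w` is given by the Eilenberg-Zilber map. Its value on a `p`-dimensional face `σ` of the
standard simplex has as Cech component on an `(l+1)`-fold intersection, in form degree `q`, the
signed sum over all `(p, l)`-shuffles of the values of the given point of the totalization on the
corresponding `(p + l)`-simplices of the product of the standard simplices. -/
def IsEZMap (w : Tot.obj ((cechNerve U).rightOp ⋙ Omega.{u}) ⟶ DKu.obj (Q.obj (cech U))) : Prop :=
  ∀ (n : SimplexCategory) (x : (Tot.obj ((cechNerve U).rightOp ⋙ Omega.{u})).obj (op n)) (p : ℕ)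
    (σ : ⦋p⦌ ⟶ n) (k l q : ℕ) (h : l + q + p = 2 * k) (a : Fin (l + 1) → I),
    let c : QX (cech U) p := DKval (C := Q.obj (cech U)) (w.app (op n) x).down σ
    let N : CMan.{u} := (cechNerve U).obj (op ⦋l⦌)
    let val (S : {S : Finset (Fin (p + l)) // S.card = p}) : QX (holComplex.obj (op N)) (p + l) :=
      DKval (C := Q.obj (holComplex.obj (op N)))
        ((x.1 ⦋l⦌).app (op ⦋p + l⦌)
          (SSet.stdSimplex.objEquiv.symm (stepMap S.1ᶜ (card_compl_shuffle S.2)),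
            SSet.stdSimplex.objEquiv.symm (stepMap S.1 S.2 ≫ σ))).down (𝟙 ⦋p + l⦌)
    cechComp U (c.1 ⟨(k, l + q), h⟩) rfl a =
      (-1 : ℤ) ^ (p * (p - 1) / 2) • ∑ S, shuffleSign S.1 •
        HolForm.pull (pieceIncl U (l := ⦋l⦌) a) q ((val S).1 ⟨(k, q), by simp only; omega⟩)

/-- The map of totalizations induced by a map of simplicial presheaves on the Cech nerve. -/
abbrev totMap {F G : CMan.{u}ᵒᵖ ⥤ SSet.{u + 1}} (f : F ⟶ G) :
    Tot.obj ((cechNerve U).rightOp ⋙ F) ⟶ Tot.obj ((cechNerve U).rightOp ⋙ G) :=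
  Tot.map (Functor.whiskerLeft (cechNerve U).rightOp f)

/-- The values of `f` are polynomials in `u` of degree at most `d`. -/
def HasPolynomialValues {S : SSet.{u + 1}} {C : CochainComplex AddCommGrpCat.{u} ℕ}
    (f : S ⟶ DKu.obj (Q.obj C)) (d : ℕ) : Prop :=
  ∀ (n : SimplexCategory) (x : S.obj (op n)) (p : ℕ) (σ : ⦋p⦌ ⟶ n)
    (k : {k : ℕ × ℕ // k.2 + p = 2 * k.1}),
    let c : QX C p := DKval (C := Q.obj C) (f.app (op n) x).down σ
    d < k.1.1 → c.1 k = 0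

end ChernTot

end

/-!
The four parts of the theorem have independent reasons.

*The Chern character.* For a sequence `E 0 → ⋯ → E l` of isomorphisms of bundles, transport all
connections to `E 0`, and let `D j` be the difference of the `j`-th one and the connection of `E 0`
(`connDiffs`). The Leibniz rule turns `f⁻¹ ∇ f_l ∧ ⋯ ∧ ∇ f_1` into the product of the differences
`D (i + 1) - D i` of consecutive connections (`traceForm_eq`), and by conjugation invariance of the trace
this also holds for the faces of a longer sequence, with the differences of the long one
(`traceForm_map`). A repeated object gives a zero factor, so that the form vanishes on degenerate
faces, and by multilinearity the alternating sum of the forms of the faces telescopes to zero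
(`sum_differenceTrace`). As the differentials of the complexes of holomorphic forms vanish, these are the
conditions for a simplex of the Dold-Kan construction (`exists_DKval`). Uniqueness holds because such a
simplex is determined by its values (`DKval_ext`).

*Forms on the Čech nerve.* Each piece of the disjoint union is a retract of it, by a map that is constant
on all other pieces. Forms on the pieces are pulled back along these retractions and put together
(`bijective_pull_pieces`).

*The weak equivalence.* Fix a power of `u` and a form degree `q`, and let `A` be the cosimplicial group of
`q`-forms on the nerve. For a simplex `Δ^n`, the chains with coefficients in `A` form a bicosimplicial
group, given by the functions from the `j`-simplices of `Δ^n` to `A i`. An `n`-simplex of the totalization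
is a family of normalized cocycles in the diagonals of these groups (`totToCocycles`), and an `n`-simplex
of the Dold-Kan construction on the Čech complex is a family of cocycles in their total complexes, up to a
sign (`cocyclesToCech`). In these terms `w` is the shuffle map, and it has a homotopy inverse:
the Alexander-Whitney map after normalization in the direction of `A`. One composite is the
normalization, the other a natural endomorphism of diagonals that is the identity in degree zero.
The homotopies to the identity come from one construction (`DiagEndo.htpy`), by recursion through
the decalage, whose extra codegeneracy makes it contractible. The shuffle map is also defined by
this recursion. It agrees with the sum over all shuffles (`shuffle_eq_sum`), and is a map of complexes
(`shuffle_d`).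

A chain homotopy `h` between these natural maps becomes a simplicial homotopy as follows. Over a simplex
`τ : Δ^n → Δ^1` of the interval, replace a cocycle `z` by `z + d (c_τ (h z))`, where the cut `c_τ` keeps
the values on those simplices of `Δ^n` whose first vertex lies over a given end of the interval
(`chainsCut`). This is a normalized cocycle for every `τ`, it is natural in `Δ^n`, and at the two ends of
the interval it is `z` or `z + d (h z)`, which is the image of `z` under the composite. A map with a
homotopy inverse is a weak equivalence, as mapping spaces to Kan complexes are Kan complexes
(`isWeakEquivalence_of_homotopyInverse`).

*Polynomials in `u`.* The Chern character has only `l`-forms, multiplied by `u ^ l`, as values on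
faces of dimension `l`. A nonzero coefficient of `u ^ k` is therefore a `k`-form, so that `k` is at most
the dimension.
-/

open CategoryTheory Opposite Simplicial MonoidalCategory TopologicalSpace Topology
open scoped Manifold ContDiff

noncomputable section

namespace ChernTot

/-! ### Homotopies of simplicial maps and weak equivalences -/

section Kan

open SSet CartesianMonoidalCategory

variable {X Y K : SSet.{w}}

theorem fst_comp_ι₀ : fst Y Δ[0] ≫ ι₀ = Y ◁ stdSimplex.{w}.δ (1 : Fin 2) := by
  ext n ⟨y, t⟩
  · rfl
  · obtain rfl : t = stdSimplex.const 0 0 n := by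
      apply SSet.stdSimplex.objEquiv.injective
      ext i
      exact congrArg Fin.val (Subsingleton.elim (α := Fin 1) _ _)
    apply SSet.stdSimplex.objEquiv.injective
    ext i
    rfl

theorem fst_comp_ι₁ : fst Y Δ[0] ≫ ι₁ = Y ◁ stdSimplex.{w}.δ (0 : Fin 2) := by
  ext n ⟨y, t⟩
  · rfl
  · obtain rfl : t = stdSimplex.const 0 0 n := by
      apply SSet.stdSimplex.objEquiv.injective
      ext i
      exact congrArg Fin.val (Subsingleton.elim (α := Fin 1) _ _)
    apply SSet.stdSimplex.objEquiv.injective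
    ext i
    rfl

/-- Two composable homotopies between maps to a Kan complex can be composed: the corresponding edges
of the function complex, which is a Kan complex, form an inner horn. -/
theorem exists_homotopy_trans [SSet.KanComplex K] {f g h : Y ⟶ K} (H : SSet.Homotopy f g)
    (H' : SSet.Homotopy g h) : Nonempty (SSet.Homotopy f h) := by
  have e : stdSimplex.{w}.δ (0 : Fin 2) ≫ MonoidalClosed.curry H.h =
      stdSimplex.{w}.δ (1 : Fin 2) ≫ MonoidalClosed.curry H'.h := by
    rw [← MonoidalClosed.curry_natural_left, ← MonoidalClosed.curry_natural_left,
      ← fst_comp_ι₀, ← fst_comp_ι₁, Category.assoc, Category.assoc, H.h₁, H'.h₀]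
  obtain ⟨σ, hσ⟩ := SSet.KanComplex.hornFilling (SSet.horn₂₁.isPushout.desc _ _ e)
  have h1 : stdSimplex.{w}.δ (2 : Fin 3) ≫ σ = MonoidalClosed.curry H.h := by
    rw [← SSet.horn₂₁.isPushout.inl_desc _ _ e, hσ]
    simp [horn₂₁.ι₀₁]
  have h2 : stdSimplex.{w}.δ (0 : Fin 3) ≫ σ = MonoidalClosed.curry H'.h := by
    rw [← SSet.horn₂₁.isPushout.inr_desc _ _ e, hσ]
    simp [horn₂₁.ι₁₂]
  let G : Y ⊗ Δ[1] ⟶ K := MonoidalClosed.uncurry (stdSimplex.{w}.δ (1 : Fin 3) ≫ σ)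
  have y₀ : (Δ[0] : SSet.{w}) _⦋0⦌ := SSet.stdSimplex.obj₀Equiv.symm 0
  have d1 : stdSimplex.{w}.δ (1 : Fin 2) ≫ stdSimplex.{w}.δ (1 : Fin 3) =
      stdSimplex.{w}.δ (1 : Fin 2) ≫ stdSimplex.{w}.δ (2 : Fin 3) := by
    have := CosimplicialObject.δ_comp_δ_self stdSimplex.{w} (i := (1 : Fin 2))
    exact this
  have d2 : stdSimplex.{w}.δ (0 : Fin 2) ≫ stdSimplex.{w}.δ (1 : Fin 3) =
      stdSimplex.{w}.δ (0 : Fin 2) ≫ stdSimplex.{w}.δ (0 : Fin 3) := by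
    have := CosimplicialObject.δ_comp_δ_self stdSimplex.{w} (i := (0 : Fin 2))
    exact this.symm
  have g0 : fst Y Δ[0] ≫ ι₀ ≫ G = fst Y Δ[0] ≫ f := by
    rw [← Category.assoc, fst_comp_ι₀, ← MonoidalClosed.uncurry_natural_left, ← Category.assoc, d1,
      Category.assoc, h1, ← MonoidalClosed.curry_natural_left, MonoidalClosed.uncurry_curry,
      ← fst_comp_ι₀, Category.assoc, H.h₀]
  have g1 : fst Y Δ[0] ≫ ι₁ ≫ G = fst Y Δ[0] ≫ h := by
    rw [← Category.assoc, fst_comp_ι₁, ← MonoidalClosed.uncurry_natural_left, ← Category.assoc, d2,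
      Category.assoc, h2, ← MonoidalClosed.curry_natural_left, MonoidalClosed.uncurry_curry,
      ← fst_comp_ι₁, Category.assoc, H'.h₁]
  have hs : ∀ k : Y ⟶ K, k = lift (𝟙 Y) (SSet.const y₀) ≫ fst Y Δ[0] ≫ k := fun k => by
    rw [← Category.assoc, lift_fst, Category.id_comp]
  exact ⟨{ h := G, h₀ := by rw [hs (ι₀ ≫ G), g0, ← hs]; rfl
           h₁ := by rw [hs (ι₁ ≫ G), g1, ← hs]; rfl
           rel := by ext n ⟨⟨y, hy⟩, t⟩; exact hy.elim }⟩

/-- A homotopy from its total map. -/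
def homotopyMk {f g : X ⟶ Y} (h : X ⊗ Δ[1] ⟶ Y) (h₀ : ι₀ ≫ h = f) (h₁ : ι₁ ≫ h = g) :
    SSet.Homotopy f g where
  h := h
  h₀ := h₀
  h₁ := h₁
  rel := by ext n ⟨⟨y, hy⟩, t⟩; exact hy.elim

/-- The homotopy between the composites with a map into the source. -/
def homotopyPrecomp {f g : Y ⟶ K} (k : X ⟶ Y) (H : SSet.Homotopy f g) :
    SSet.Homotopy (k ≫ f) (k ≫ g) :=
  homotopyMk ((k ▷ Δ[1]) ≫ H.h) (by rw [ι₀_comp_assoc, H.h₀]) (by rw [ι₁_comp_assoc, H.h₁])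

/-- The homotopy between the composites with a map out of the target. -/
def homotopyPostcomp {f g : X ⟶ Y} (k : Y ⟶ K) (H : SSet.Homotopy f g) :
    SSet.Homotopy (f ≫ k) (g ≫ k) :=
  homotopyMk (H.h ≫ k) (by rw [← Category.assoc, H.h₀]) (by rw [← Category.assoc, H.h₁])

/-- A map with a homotopy inverse is a weak equivalence. The homotopies are asked for in the
directions that make symmetry of the homotopy relation unnecessary. -/
theorem isWeakEquivalence_of_homotopyInverse (f : X ⟶ Y) (s : Y ⟶ X)
    (H : SSet.Homotopy (f ≫ s) (𝟙 X)) (H₁ : SSet.Homotopy (𝟙 Y) (s ≫ f))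
    (H₂ : SSet.Homotopy (s ≫ f) (𝟙 Y)) : IsWeakEquivalence f := by
  intro K hK
  refine ⟨fun h => ⟨s ≫ h, ⟨?_⟩⟩, fun g g' ⟨G⟩ => ?_⟩
  · simpa using homotopyPostcomp h H
  · have a : SSet.Homotopy g (s ≫ f ≫ g) := by simpa using homotopyPostcomp g H₁
    have b : SSet.Homotopy (s ≫ f ≫ g') g' := by simpa using homotopyPostcomp g' H₂
    obtain ⟨c⟩ := exists_homotopy_trans a (homotopyPrecomp s G)
    exact exists_homotopy_trans c b

theorem IsWeakEquivalence.iso_comp_iso {X' Y' : SSet.{w}} {f : X ⟶ Y} (hf : IsWeakEquivalence f)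
    (e : X' ≅ X) (e' : Y ≅ Y') : IsWeakEquivalence (e.hom ≫ f ≫ e'.hom) := by
  intro K hK
  obtain ⟨h1, h2⟩ := hf K hK
  refine ⟨fun h => ?_, fun g g' ⟨G⟩ => ?_⟩
  · obtain ⟨g, ⟨G⟩⟩ := h1 (e.inv ≫ h)
    exact ⟨e'.inv ≫ g, ⟨by simpa using homotopyPrecomp e.hom G⟩⟩
  · obtain ⟨G'⟩ := h2 (e'.hom ≫ g) (e'.hom ≫ g')
      ⟨by simpa using homotopyPrecomp e.inv G⟩
    exact ⟨by simpa using homotopyPrecomp e'.inv G'⟩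

end Kan

/-! ### Simplices of the Dold-Kan construction in terms of their values -/

section DoldKan

variable {C : ChainComplex AddCommGrpCat.{u} ℕ} {n : SimplexCategory}

theorem uliftInt_hom_ext {A : AddCommGrpCat.{u}} {f g : AddCommGrpCat.of (ULift.{u} ℤ) ⟶ A}
    (h : f.hom (ULift.up 1) = g.hom (ULift.up 1)) : f = g := by
  ext ⟨k⟩
  have e : (ULift.up k : ULift.{u} ℤ) = k • (ULift.up 1 : ULift.{u} ℤ) := by
    ext; simp
  change f.hom (ULift.up k) = g.hom (ULift.up k)
  rw [e, map_zsmul, map_zsmul, h]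

theorem hom_sum_zsmul_apply {A B : AddCommGrpCat.{u}} {ι : Type*} (s : Finset ι) (c : ι → ℤ)
    (f : ι → (A ⟶ B)) (a : A) : (∑ i ∈ s, c i • f i).hom a = ∑ i ∈ s, c i • (f i).hom a := by
  classical
  induction s using Finset.induction_on with
  | empty => rfl
  | insert i s hi ih =>
    rw [Finset.sum_insert hi, Finset.sum_insert hi, ← ih]
    rfl

/-- The homomorphism from the integers that sends `1` to `a`. -/
def ofElement {A : AddCommGrpCat.{u}} (a : A) : AddCommGrpCat.of (ULift.{u} ℤ) ⟶ A :=
  AddCommGrpCat.ofHom ((zmultiplesHom A a).comp (AddEquiv.ulift (α := ℤ)).toAddMonoidHom)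

theorem ofElement_apply {A : AddCommGrpCat.{u}} (a : A) :
    (ofElement a).hom (ULift.up 1) = a := by
  change (zmultiplesHom A a) 1 = a
  simp

/-- The normalized chains are generated by the simplices, so a chain map out of them is determined by
its values. -/
theorem DKval_ext {x x' : (DK.obj C).obj (op n)}
    (h : ∀ (p : ℕ) (σ : ⦋p⦌ ⟶ n), DKval x σ = DKval x' σ) : x = x' := by
  refine HomologicalComplex.Hom.ext (funext fun p => ?_)
  refine SSet.normalizedChainComplex_hom_ext (X := SSet.stdSimplex.{u}.obj n)
    (R := AddCommGrpCat.of (ULift.{u} ℤ)) fun y _ => uliftInt_hom_ext ?_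
  have := h p (SSet.stdSimplex.objEquiv y)
  rw [DKval, DKval, Equiv.symm_apply_apply] at this
  exact this

theorem DKval_degenerate (x : (DK.obj C).obj (op n)) {p : ℕ} (i : Fin (p + 1))
    (σ : ⦋p⦌ ⟶ n) : DKval x (SimplexCategory.σ i ≫ σ) = 0 := by
  have : SSet.ιNormalizedChainComplex (SSet.stdSimplex.{u}.obj n)
      (R := AddCommGrpCat.of (ULift.{u} ℤ))
      (SSet.stdSimplex.objEquiv.symm (SimplexCategory.σ i ≫ σ)) = 0 := by
    apply SSet.ιNormalizedChainComplex_eq_zero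
    exact SSet.σ_mem_degenerate (X := SSet.stdSimplex.{u}.obj n) i
      (SSet.stdSimplex.objEquiv.symm σ)
  unfold DKval
  rw [this]
  exact map_zero _

theorem DKval_d (x : (DK.obj C).obj (op n)) {p : ℕ} (σ : ⦋p + 1⦌ ⟶ n) :
    (C.d (p + 1) p).hom (DKval x σ) =
      ∑ i : Fin (p + 2), (-1 : ℤ) ^ (i : ℕ) • DKval x (SimplexCategory.δ i ≫ σ) := by
  let f : (SSet.stdSimplex.{u}.obj n).normalizedChainComplex
    (AddCommGrpCat.of (ULift.{u} ℤ)) ⟶ C := x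
  have h1 := f.comm (p + 1) p
  have h2 := SSet.ιNormalizedChainComplex_d (SSet.stdSimplex.{u}.obj n)
    (R := AddCommGrpCat.of (ULift.{u} ℤ)) (SSet.stdSimplex.objEquiv.symm σ)
  have h3 := congrArg (fun g => g ≫ f.f p) h2
  simp only [Category.assoc, Preadditive.sum_comp, Preadditive.zsmul_comp] at h3
  rw [← h1, ← Category.assoc] at h3
  have h4 := congrArg (fun g => g.hom (ULift.up 1)) h3
  exact h4.trans (hom_sum_zsmul_apply _ _ _ _)

/-- A simplex of `DK C` from its values on all simplices of the standard simplex. -/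
theorem exists_DKval (f : ∀ p : ℕ, (⦋p⦌ ⟶ n) → C.X p)
    (hdeg : ∀ (p : ℕ) (i : Fin (p + 1)) (σ : ⦋p⦌ ⟶ n), f (p + 1) (SimplexCategory.σ i ≫ σ) = 0)
    (hd : ∀ (p : ℕ) (σ : ⦋p + 1⦌ ⟶ n), (C.d (p + 1) p).hom (f (p + 1) σ) =
      ∑ i : Fin (p + 2), (-1 : ℤ) ^ (i : ℕ) • f p (SimplexCategory.δ i ≫ σ)) :
    ∃ x : (DK.obj C).obj (op n), ∀ p σ, DKval x (p := p) σ = f p σ := by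
  let S := SSet.stdSimplex.{u}.obj n
  let R := AddCommGrpCat.of (ULift.{u} ℤ)
  let g (p : ℕ) : (S.normalizedChainComplex R).X p ⟶ C.X p :=
    Limits.Cofan.IsColimit.desc (S.isColimitCofanNormalizedChainComplex R p)
      fun y => ofElement (f p (SSet.stdSimplex.objEquiv y.1))
  have hg : ∀ (p : ℕ) (y : S _⦋p⦌), S.ιNormalizedChainComplex (R := R) y ≫ g p =
      ofElement (f p (SSet.stdSimplex.objEquiv y)) := by
    intro p y
    by_cases hy : y ∈ S.nonDegenerate p
    · exact Limits.Cofan.IsColimit.fac (S.isColimitCofanNormalizedChainComplex R p)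
        (fun y => ofElement (f p (SSet.stdSimplex.objEquiv y.1))) ⟨y, hy⟩
    · rw [SSet.mem_nonDegenerate_iff_notMem_degenerate, not_not] at hy
      rw [SSet.ιNormalizedChainComplex_eq_zero _ _ hy, Limits.zero_comp]
      cases p with
      | zero => simp at hy
      | succ p =>
        simp only [SSet.degenerate_eq_iUnion_range_σ, Set.mem_iUnion, Set.mem_range] at hy
        obtain ⟨i, z, rfl⟩ := hy
        refine uliftInt_hom_ext ?_
        rw [ofElement_apply]
        exact (hdeg p i (SSet.stdSimplex.objEquiv z)).symm
  let F : S.normalizedChainComplex R ⟶ C :=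
    { f := g
      comm' := by
        rintro i j (rfl : j + 1 = i)
        refine SSet.normalizedChainComplex_hom_ext (X := S) (R := R) fun y _ => ?_
        rw [← Category.assoc, ← Category.assoc, hg, SSet.ιNormalizedChainComplex_d,
          Preadditive.sum_comp]
        simp only [Preadditive.zsmul_comp, hg]
        refine uliftInt_hom_ext ?_
        refine (congrArg (C.d (j + 1) j).hom (ofElement_apply _)).trans ?_
        refine (hd j (SSet.stdSimplex.objEquiv y)).trans ((hom_sum_zsmul_apply _ _ _ _).trans ?_).symm
        refine Finset.sum_congr rfl fun i _ => congrArg (fun a => (-1 : ℤ) ^ (i : ℕ) • a) ?_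
        exact ofElement_apply _ }
  refine ⟨F, fun p σ => ?_⟩
  have := congrArg (fun k => k.hom (ULift.up 1)) (hg p (SSet.stdSimplex.objEquiv.symm σ))
  refine this.trans ?_
  rw [ofElement_apply, Equiv.apply_symm_apply]

theorem DKval_map {n' : SimplexCategory} (x : (DK.obj C).obj (op n)) (θ : n' ⟶ n) {p : ℕ}
    (σ : ⦋p⦌ ⟶ n') : DKval ((DK.obj C).map θ.op x) σ = DKval x (σ ≫ θ) := by
  let f : (SSet.stdSimplex.{u}.obj n).normalizedChainComplex
    (AddCommGrpCat.of (ULift.{u} ℤ)) ⟶ C := x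
  have := congrArg (fun g => (g ≫ f.f p).hom (ULift.up 1))
    (SSet.ι_normalizedChainComplexMap_f (R := AddCommGrpCat.of (ULift.{u} ℤ))
      (SSet.stdSimplex.{u}.map θ) (SSet.stdSimplex.objEquiv.symm σ))
  exact this

theorem DKval_comp {D : ChainComplex AddCommGrpCat.{u} ℕ} (φ : C ⟶ D)
    (x : (DK.obj C).obj (op n)) {p : ℕ} (σ : ⦋p⦌ ⟶ n) :
    DKval ((DK.map φ).app (op n) x) σ = (φ.f p).hom (DKval x σ) := rfl

end DoldKan

/-! ### Cosimplicial abelian groups and their decalage -/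

section SimplexMaps

/-- The map `[0] ∗ [i] ⟶ [0] ∗ [i']` given by a map `[i] ⟶ [i']`. -/
def joinMap {i i' : ℕ} (a : ⦋i⦌ ⟶ ⦋i'⦌) : ⦋i + 1⦌ ⟶ ⦋i' + 1⦌ :=
  SimplexCategory.mkHom
    { toFun := Fin.cases 0 fun t => (a.toOrderHom t).succ
      monotone' := by
        intro s t hst
        induction s using Fin.cases with
        | zero => exact Fin.zero_le _
        | succ s =>
          induction t using Fin.cases with
          | zero => exact absurd hst (by simp)
          | succ t => exact Fin.succ_le_succ_iff.2 (a.toOrderHom.monotone (Fin.succ_le_succ_iff.1 hst)) }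

theorem simplexHom_ext {i j : ℕ} {a b : ⦋i⦌ ⟶ ⦋j⦌}
    (h : ∀ t : Fin (i + 1), (a.toOrderHom t : ℕ) = b.toOrderHom t) : a = b :=
  SimplexCategory.Hom.ext _ _ (OrderHom.ext _ _ (funext fun t => Fin.ext (h t)))

theorem joinMap_zero {i i' : ℕ} (a : ⦋i⦌ ⟶ ⦋i'⦌) : (joinMap a).toOrderHom (0 : Fin (i + 2)) = 0 :=
  rfl

theorem joinMap_succ {i i' : ℕ} (a : ⦋i⦌ ⟶ ⦋i'⦌) (t : Fin (i + 1)) :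
    (joinMap a).toOrderHom t.succ = (a.toOrderHom t).succ := rfl

theorem joinMap_ext {i j : ℕ} {a b : ⦋i + 1⦌ ⟶ ⦋j⦌}
    (h0 : (a.toOrderHom (0 : Fin (i + 2)) : ℕ) = b.toOrderHom (0 : Fin (i + 2)))
    (h : ∀ t : Fin (i + 1), (a.toOrderHom t.succ : ℕ) = b.toOrderHom t.succ) : a = b :=
  simplexHom_ext fun t => Fin.cases h0 h t

theorem comp_toOrderHom_apply {i j k : ℕ} (a : ⦋i⦌ ⟶ ⦋j⦌) (b : ⦋j⦌ ⟶ ⦋k⦌) (t : Fin (i + 1)) :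
    (a ≫ b).toOrderHom t = b.toOrderHom (a.toOrderHom t) := rfl

theorem joinMap_id (i : ℕ) : joinMap (𝟙 ⦋i⦌) = 𝟙 _ := joinMap_ext rfl fun _ => rfl

theorem joinMap_comp {i j k : ℕ} (a : ⦋i⦌ ⟶ ⦋j⦌) (b : ⦋j⦌ ⟶ ⦋k⦌) :
    joinMap (a ≫ b) = joinMap a ≫ joinMap b := joinMap_ext rfl fun _ => rfl

theorem δ_apply {n : ℕ} (i : Fin (n + 2)) (t : Fin (n + 1)) :
    (SimplexCategory.δ i).toOrderHom t = i.succAbove t := rfl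

theorem σ_apply {n : ℕ} (i : Fin (n + 1)) (t : Fin (n + 2)) :
    (SimplexCategory.σ i).toOrderHom t = i.predAbove t := rfl

theorem joinMap_δ {n : ℕ} (i : Fin (n + 2)) :
    joinMap (SimplexCategory.δ i) = SimplexCategory.δ i.succ := by
  refine joinMap_ext ?_ fun t => ?_
  · rw [δ_apply, Fin.succ_succAbove_zero]
    rfl
  · rw [joinMap_succ, δ_apply, δ_apply, Fin.succ_succAbove_succ]

theorem joinMap_σ {n : ℕ} (i : Fin (n + 1)) :
    joinMap (SimplexCategory.σ i) = SimplexCategory.σ i.succ := by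
  refine joinMap_ext ?_ fun t => ?_
  · rw [σ_apply, Fin.predAbove_right_zero]
    rfl
  · rw [joinMap_succ, σ_apply, σ_apply, Fin.succ_predAbove_succ]

theorem comp_δ_zero {i j : ℕ} (a : ⦋i⦌ ⟶ ⦋j⦌) :
    a ≫ SimplexCategory.δ 0 = SimplexCategory.δ 0 ≫ joinMap a :=
  simplexHom_ext fun t => by
    rw [comp_toOrderHom_apply, comp_toOrderHom_apply, δ_apply, δ_apply, Fin.zero_succAbove,
      Fin.zero_succAbove]
    rfl

/-- The map `joinMap a ≫ σ 0` is `a` with the value at zero repeated, if `a` preserves zero. -/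
theorem joinMap_comp_σ_zero {i j : ℕ} (a : ⦋i⦌ ⟶ ⦋j⦌)
    (ha : a.toOrderHom (0 : Fin (i + 1)) = (0 : Fin (j + 1))) :
    joinMap a ≫ SimplexCategory.σ 0 = SimplexCategory.σ 0 ≫ a := by
  refine joinMap_ext ?_ fun t => ?_
  · rw [comp_toOrderHom_apply, comp_toOrderHom_apply, joinMap_zero, σ_apply, σ_apply]
    simp only [Fin.predAbove_right_zero]
    exact congrArg Fin.val ha.symm
  · rw [comp_toOrderHom_apply, comp_toOrderHom_apply, joinMap_succ, σ_apply, σ_apply]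
    simp

theorem joinMap_comp_σ_zero_δ {n : ℕ} (i : Fin (n + 1)) :
    joinMap (SimplexCategory.δ i.succ) ≫ SimplexCategory.σ 0 =
      SimplexCategory.σ 0 ≫ SimplexCategory.δ i.succ :=
  joinMap_comp_σ_zero _ (by rw [δ_apply, Fin.succ_succAbove_zero])

theorem joinMap_δ_zero_comp_σ_zero {n : ℕ} :
    joinMap (SimplexCategory.δ (0 : Fin (n + 2))) ≫ SimplexCategory.σ 0 = 𝟙 _ := by
  rw [joinMap_δ, SimplexCategory.δ_comp_σ_succ]

theorem joinMap_σ_comp_σ_zero {n : ℕ} (i : Fin (n + 1)) :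
    joinMap (SimplexCategory.σ i) ≫ SimplexCategory.σ 0 =
      SimplexCategory.σ 0 ≫ SimplexCategory.σ i :=
  joinMap_comp_σ_zero _ (by rw [σ_apply, Fin.predAbove_right_zero])

/-- A monotone map that is not injective takes the same value at two consecutive points. -/
theorem exists_eq_of_not_injective {i j : ℕ} {a : ⦋i⦌ ⟶ ⦋j⦌}
    (h : ¬ Function.Injective a.toOrderHom) :
    ∃ t : Fin i, a.toOrderHom t.castSucc = a.toOrderHom t.succ := by
  by_contra! hne
  refine h (StrictMono.injective (Fin.strictMono_iff_lt_succ.2 fun t => ?_))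
  exact lt_of_le_of_ne (a.toOrderHom.monotone (Fin.castSucc_le_succ t)) (hne t)

theorem exists_σ_comp {i j : ℕ} {a : ⦋i + 1⦌ ⟶ ⦋j⦌} {t : Fin (i + 1)}
    (h : a.toOrderHom t.castSucc = a.toOrderHom t.succ) :
    ∃ a' : ⦋i⦌ ⟶ ⦋j⦌, a = SimplexCategory.σ t ≫ a' :=
  SimplexCategory.eq_σ_comp_of_not_injective' a t h

theorem δ_comp_σ_eq_of_ne {n : ℕ} {j : Fin (n + 3)} {i : Fin (n + 2)} (h1 : j ≠ i.castSucc)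
    (h2 : j ≠ i.succ) : ∃ t : Fin (n + 1), ∃ b, SimplexCategory.δ j ≫ SimplexCategory.σ i =
      SimplexCategory.σ t ≫ b := by
  have : ∃ t : Fin (n + 1), (SimplexCategory.δ j ≫ SimplexCategory.σ i).toOrderHom t.castSucc =
      (SimplexCategory.δ j ≫ SimplexCategory.σ i).toOrderHom t.succ := by
    apply exists_eq_of_not_injective
    intro hinj
    -- The two points of the fibre of `σ i` over `i` both lie in the image of `δ j`.
    obtain ⟨s, hs⟩ := Fin.exists_succAbove_eq h1.symm
    obtain ⟨s', hs'⟩ := Fin.exists_succAbove_eq h2.symm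
    have : s = s' := hinj (by
      rw [comp_toOrderHom_apply, comp_toOrderHom_apply, δ_apply, δ_apply, hs, hs', σ_apply, σ_apply]
      simp)
    subst this
    rw [hs] at hs'
    exact absurd (congrArg Fin.val hs') (by simp)
  obtain ⟨t, ht⟩ := this
  obtain ⟨b, hb⟩ := exists_σ_comp ht
  exact ⟨t, b, hb⟩

end SimplexMaps

/-- A cosimplicial abelian group, with its operators in a form suited to computations with
elements. -/
structure Cos : Type (u + 1) where
  G : ℕ → Type u
  [grp : ∀ i, AddCommGroup (G i)]
  map {i i' : ℕ} : (⦋i⦌ ⟶ ⦋i'⦌) → G i →+ G i'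
  map_id : ∀ (i : ℕ) (z : G i), map (𝟙 _) z = z
  map_map : ∀ {i i' i'' : ℕ} (a : ⦋i⦌ ⟶ ⦋i'⦌) (a' : ⦋i'⦌ ⟶ ⦋i''⦌) (z : G i),
    map a' (map a z) = map (a ≫ a') z

attribute [instance] Cos.grp

namespace Cos

variable (X : Cos.{u})

/-- The alternating sum of the cofaces. -/
def d (n : ℕ) : X.G n →+ X.G (n + 1) :=
  ∑ i : Fin (n + 2), (-1 : ℤ) ^ (i : ℕ) • X.map (SimplexCategory.δ i)

theorem d_apply (n : ℕ) (z : X.G n) :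
    X.d n z = ∑ i : Fin (n + 2), (-1 : ℤ) ^ (i : ℕ) • X.map (SimplexCategory.δ i) z := by
  simp [d]

/-- The decalage of a cosimplicial group. -/
abbrev shift : Cos.{u} where
  G i := X.G (i + 1)
  map a := X.map (joinMap a)
  map_id i z := by rw [joinMap_id, X.map_id]
  map_map a a' z := by rw [X.map_map, joinMap_comp]

/-- The recursion on which the inductions through the decalage rest. -/
theorem d_eq_sub_shift (n : ℕ) (z : X.G (n + 1)) :
    X.d (n + 1) z = X.map (SimplexCategory.δ 0) z - X.shift.d n z := by
  rw [d_apply, d_apply, Fin.sum_univ_succ, sub_eq_add_neg, ← Finset.sum_neg_distrib]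
  congr 1
  · simp
  · refine Finset.sum_congr rfl fun i _ => ?_
    rw [Fin.val_succ, pow_succ, mul_neg_one, neg_smul]
    change _ = -((-1 : ℤ) ^ (i : ℕ) • X.map (joinMap (SimplexCategory.δ i)) z)
    rw [joinMap_δ]

theorem map_d {Y : Cos.{u}} (φ : ∀ i, X.G i →+ Y.G i)
    (hφ : ∀ {i j : ℕ} (a : ⦋i⦌ ⟶ ⦋j⦌) (z : X.G i), φ j (X.map a z) = Y.map a (φ i z))
    (n : ℕ) (z : X.G n) : φ (n + 1) (X.d n z) = Y.d n (φ n z) := by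
  rw [d_apply, d_apply, map_sum]
  exact Finset.sum_congr rfl fun i _ => by rw [map_zsmul, hφ]

theorem shift_d_map_δ_zero (n : ℕ) (z : X.G n) :
    X.shift.d n (X.map (SimplexCategory.δ 0) z) = X.map (SimplexCategory.δ 0) (X.d n z) := by
  symm
  refine (map_d X (Y := X.shift) (fun i => X.map (SimplexCategory.δ (0 : Fin (i + 2))))
    (fun {i j} a z => ?_) n z)
  exact (X.map_map _ _ _).trans ((congrArg (fun b => X.map b z) (comp_δ_zero a)).trans
    (X.map_map _ _ _).symm)

/-- By induction through the decalage. -/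
theorem d_d (n : ℕ) (z : X.G n) : X.d (n + 1) (X.d n z) = 0 := by
  induction n generalizing X with
  | zero =>
    simp only [d_apply, Fin.sum_univ_succ, map_add, map_zsmul, X.map_map]
    have e1 : SimplexCategory.δ (0 : Fin 2) ≫ SimplexCategory.δ (1 : Fin 3) =
      SimplexCategory.δ (0 : Fin 2) ≫ SimplexCategory.δ (0 : Fin 3) := by decide
    have e2 : SimplexCategory.δ (1 : Fin 2) ≫ SimplexCategory.δ (1 : Fin 3) =
      SimplexCategory.δ (1 : Fin 2) ≫ SimplexCategory.δ (2 : Fin 3) := by decide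
    have e3 : SimplexCategory.δ (0 : Fin 2) ≫ SimplexCategory.δ (2 : Fin 3) =
      SimplexCategory.δ (1 : Fin 2) ≫ SimplexCategory.δ (0 : Fin 3) := by decide
    simp [e1, e2, e3]
  | succ n ih =>
    rw [d_eq_sub_shift X (n + 1)]
    have e : X.shift.d (n + 1) (X.d (n + 1) z) = X.map (SimplexCategory.δ 0) (X.d (n + 1) z) :=
      (congrArg (X.shift.d (n + 1)) (d_eq_sub_shift X n z)).trans
        ((map_sub (X.shift.d (n + 1)) _ _).trans (by
          rw [ih X.shift z, sub_zero, shift_d_map_δ_zero X (n + 1) z]))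
    exact sub_eq_zero.2 e.symm

/-- The elements on which all codegeneracies vanish. -/
def Normal {n : ℕ} (z : X.G n) : Prop :=
  match n, z with
  | 0, _ => True
  | n + 1, z => ∀ i : Fin (n + 1), X.map (SimplexCategory.σ i) z = 0

variable {X}

theorem Normal.map_eq_zero {n m : ℕ} {z : X.G n} (hz : X.Normal z) {a : ⦋n⦌ ⟶ ⦋m⦌}
    {t : Fin n} (ht : a.toOrderHom t.castSucc = a.toOrderHom t.succ) : X.map a z = 0 := by
  cases n with
  | zero => exact t.elim0
  | succ n =>
    obtain ⟨b, rfl⟩ := exists_σ_comp ht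
    rw [← X.map_map, hz t, map_zero]

theorem Normal.zero {n : ℕ} : X.Normal (0 : X.G n) := by
  cases n with
  | zero => trivial
  | succ n => exact fun i => map_zero _

theorem Normal.add {n : ℕ} {y z : X.G n} (hy : X.Normal y) (hz : X.Normal z) :
    X.Normal (y + z) := by
  cases n with
  | zero => trivial
  | succ n => exact fun i => by rw [map_add, hy i, hz i, add_zero]

theorem Normal.zsmul {n : ℕ} {z : X.G n} (hz : X.Normal z) (c : ℤ) : X.Normal (c • z) := by
  cases n with
  | zero => trivial
  | succ n => exact fun i => by rw [map_zsmul, hz i, smul_zero]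

theorem Normal.sub {n : ℕ} {y z : X.G n} (hy : X.Normal y) (hz : X.Normal z) :
    X.Normal (y - z) := by
  have := hy.add (hz.zsmul (-1))
  simpa [sub_eq_add_neg] using this

theorem Normal.sum {n : ℕ} {ι : Type*} {s : Finset ι} {z : ι → X.G n}
    (hz : ∀ i ∈ s, X.Normal (z i)) : X.Normal (∑ i ∈ s, z i) := by
  cases n with
  | zero => trivial
  | succ n => exact fun i => by rw [map_sum, Finset.sum_eq_zero fun j hj => hz j hj i]

theorem Normal.d {n : ℕ} {z : X.G n} (hz : X.Normal z) : X.Normal (X.d n z) := by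
  intro i
  rw [d_apply, map_sum]
  cases n with
  | zero =>
    obtain rfl : i = 0 := Subsingleton.elim (α := Fin 1) _ _
    have e1 : SimplexCategory.δ (0 : Fin 2) ≫ SimplexCategory.σ (0 : Fin 1) = 𝟙 _ := by decide
    have e2 : SimplexCategory.δ (1 : Fin 2) ≫ SimplexCategory.σ (0 : Fin 1) = 𝟙 _ := by decide
    simp [Fin.sum_univ_succ, X.map_map, e1, e2]
  | succ n =>
    rw [Finset.sum_eq_add i.castSucc i.succ (Fin.castSucc_lt_succ).ne, map_zsmul, map_zsmul, X.map_map,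
      X.map_map, SimplexCategory.δ_comp_σ_self, SimplexCategory.δ_comp_σ_succ, X.map_id]
    · simp [pow_succ]
    · rintro j - ⟨h1, h2⟩
      obtain ⟨t, b, hb⟩ := δ_comp_σ_eq_of_ne h1 h2
      rw [map_zsmul, X.map_map, hb, ← X.map_map, hz t, map_zero, smul_zero]
    · simp
    · simp

theorem Normal.shift {n : ℕ} {z : X.G (n + 1)} (hz : X.Normal z) :
    X.shift.Normal (n := n) z := by
  cases n with
  | zero => trivial
  | succ n =>
    intro i
    change X.map (joinMap _) z = 0
    rw [joinMap_σ]
    exact hz i.succ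

end Cos

/-! ### Bicosimplicial groups and natural endomorphisms of their diagonals -/

/-- A bicosimplicial abelian group. -/
structure BiCos : Type (u + 1) where
  G : ℕ → ℕ → Type u
  [grp : ∀ i j, AddCommGroup (G i j)]
  map {i i' j j' : ℕ} : (⦋i⦌ ⟶ ⦋i'⦌) → (⦋j⦌ ⟶ ⦋j'⦌) → G i j →+ G i' j'
  map_id : ∀ (i j : ℕ) (z : G i j), map (𝟙 _) (𝟙 _) z = z
  map_map : ∀ {i i' i'' j j' j'' : ℕ} (a : ⦋i⦌ ⟶ ⦋i'⦌) (a' : ⦋i'⦌ ⟶ ⦋i''⦌)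
    (b : ⦋j⦌ ⟶ ⦋j'⦌) (b' : ⦋j'⦌ ⟶ ⦋j''⦌) (z : G i j),
    map a' b' (map a b z) = map (a ≫ a') (b ≫ b') z

attribute [instance] BiCos.grp

namespace BiCos

/-- Maps of bicosimplicial groups. -/
structure Hom (F F' : BiCos.{u}) where
  app (i j : ℕ) : F.G i j →+ F'.G i j
  natural : ∀ {i i' j j' : ℕ} (a : ⦋i⦌ ⟶ ⦋i'⦌) (b : ⦋j⦌ ⟶ ⦋j'⦌) (z : F.G i j),
    app i' j' (F.map a b z) = F'.map a b (app i j z)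

variable (F : BiCos.{u})

/-- The diagonal. -/
abbrev diag : Cos.{u} where
  G i := F.G i i
  map a := F.map a a
  map_id i z := F.map_id i i z
  map_map a a' z := F.map_map a a' a a' z

/-- The cosimplicial group in the second direction. -/
abbrev vert (l : ℕ) : Cos.{u} where
  G p := F.G l p
  map b := F.map (𝟙 _) b
  map_id p z := F.map_id l p z
  map_map b b' z := F.map_map (𝟙 _) (𝟙 _) b b' z

/-- The cosimplicial group in the first direction. -/
abbrev hor (p : ℕ) : Cos.{u} where
  G l := F.G l p
  map a := F.map a (𝟙 _)
  map_id l z := F.map_id l p z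
  map_map a a' z := F.map_map a a' (𝟙 _) (𝟙 _) z

/-- The decalage in both directions. -/
abbrev shift : BiCos.{u} where
  G i j := F.G (i + 1) (j + 1)
  map a b := F.map (joinMap a) (joinMap b)
  map_id i j z := by rw [joinMap_id, joinMap_id, F.map_id]
  map_map a a' b b' z := by rw [F.map_map, joinMap_comp, joinMap_comp]

/-- The map to the decalage given by the first cofaces. -/
def toShift : Hom F F.shift where
  app i j := F.map (SimplexCategory.δ 0) (SimplexCategory.δ 0)
  natural a b z := by
    refine (F.map_map _ _ _ _ _).trans (Eq.trans ?_ (F.map_map _ _ _ _ _).symm)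
    rw [comp_δ_zero, comp_δ_zero]

variable {F} in
/-- The decalage of a map. -/
def Hom.shift {F' : BiCos.{u}} (φ : Hom F F') : Hom F.shift F'.shift where
  app i j := φ.app (i + 1) (j + 1)
  natural _ _ z := φ.natural _ _ z

variable {F} in
theorem Hom.diag_d {F' : BiCos.{u}} (φ : Hom F F') (m : ℕ) (z : F.G m m) :
    φ.app (m + 1) (m + 1) (F.diag.d m z) = F'.diag.d m (φ.app m m z) :=
  Cos.map_d F.diag (Y := F'.diag) (fun i => φ.app i i) (fun a z => φ.natural a a z) m z

variable {F} in
theorem Hom.vert_d {F' : BiCos.{u}} (φ : Hom F F') (l p : ℕ) (z : F.G l p) :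
    φ.app l (p + 1) ((F.vert l).d p z) = (F'.vert l).d p (φ.app l p z) :=
  Cos.map_d (F.vert l) (Y := F'.vert l) (fun i => φ.app l i) (fun a z => φ.natural _ a z) p z

variable {F} in
theorem Hom.hor_d {F' : BiCos.{u}} (φ : Hom F F') (l p : ℕ) (z : F.G l p) :
    φ.app (l + 1) p ((F.hor p).d l z) = (F'.hor p).d l (φ.app l p z) :=
  Cos.map_d (F.hor p) (Y := F'.hor p) (fun i => φ.app i p) (fun a z => φ.natural a _ z) l z

/-- The first codegeneracies, which are not part of the structure of the decalage, split the map to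
it. -/
theorem σ_toShift {i j : ℕ} (z : F.G i j) :
    F.map (SimplexCategory.σ 0) (SimplexCategory.σ 0) (F.toShift.app i j z) = z := by
  refine (F.map_map _ _ _ _ _).trans ?_
  have := fun n => SimplexCategory.δ_comp_σ_self (n := n) (i := 0)
  simp only [Fin.castSucc_zero] at this
  rw [this, this, F.map_id]

theorem diag_d_eq (m : ℕ) (z : F.G (m + 1) (m + 1)) :
    F.diag.d (m + 1) z = F.toShift.app (m + 1) (m + 1) z - F.shift.diag.d m z :=
  F.diag.d_eq_sub_shift m z

end BiCos

/-- A natural endomorphism of the cochain complex of the diagonal of a bicosimplicial group, which is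
the identity in degree zero and preserves normalized cochains. -/
structure DiagEndo where
  app (F : BiCos.{u}) (m : ℕ) : F.G m m →+ F.G m m
  natural : ∀ {F F' : BiCos.{u}} (φ : BiCos.Hom F F') (m : ℕ) (z : F.G m m),
    φ.app m m (app F m z) = app F' m (φ.app m m z)
  comm : ∀ (F : BiCos.{u}) (m : ℕ) (z : F.G m m),
    app F (m + 1) (F.diag.d m z) = F.diag.d m (app F m z)
  zero : ∀ (F : BiCos.{u}) (z : F.G 0 0), app F 0 z = z
  normal : ∀ (F : BiCos.{u}) (m : ℕ) (z : F.G m m), F.diag.Normal z → F.diag.Normal (app F m z)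

namespace DiagEndo

variable (E : DiagEndo.{u})

/-- The contracting homotopy of a natural endomorphism. The decalage has an extra codegeneracy,
which removes the part of the diagonal that is not controlled by lower degrees. -/
def htpy (m : ℕ) (F : BiCos.{u}) : F.G (m + 1) (m + 1) →+ F.G m m :=
  match m with
  | 0 => 0
  | m + 1 => (F.map (SimplexCategory.σ 0) (SimplexCategory.σ 0)).comp
      (E.app F.shift (m + 1) - AddMonoidHom.id _ - (F.shift.diag.d m).comp (htpy m F.shift))

theorem htpy_succ (m : ℕ) (F : BiCos.{u}) (z : F.G (m + 2) (m + 2)) :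
    E.htpy (m + 1) F z = F.map (SimplexCategory.σ 0) (SimplexCategory.σ 0)
      ((E.app F.shift (m + 1) z : F.G (m + 2) (m + 2)) - z -
        F.shift.diag.d m (E.htpy m F.shift z)) := rfl

theorem htpy_natural (m : ℕ) {F F' : BiCos.{u}} (φ : BiCos.Hom F F') (z : F.G (m + 1) (m + 1)) :
    φ.app m m (E.htpy m F z) = E.htpy m F' (φ.app (m + 1) (m + 1) z) := by
  induction m generalizing F F' with
  | zero => exact map_zero _
  | succ m ih =>
    have h1 := E.natural φ.shift (m + 1) z
    have h2 := φ.shift.diag_d m (E.htpy m F.shift z)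
    have h3 := ih φ.shift z
    rw [htpy_succ, htpy_succ, φ.natural]
    refine congrArg _ ((map_sub (φ.app (m + 2) (m + 2)) _ _).trans (congrArg₂ _
      ((map_sub (φ.app (m + 2) (m + 2)) _ _).trans (congrArg₂ _ h1 rfl)) ?_))
    exact h2.trans (congrArg _ h3)

/-- The inductive step of `app_sub_self`. The hypothesis is the homotopy formula for the decalage at a
coboundary. -/
theorem htpy_succ_d (m : ℕ) (F : BiCos.{u}) (z : F.G (m + 1) (m + 1))
    (hz : (E.app F.shift (m + 1) (F.shift.diag.d m z) : F.G (m + 2) (m + 2)) -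
      F.shift.diag.d m z =
        F.shift.diag.d m (E.htpy m F.shift (F.shift.diag.d m z))) :
    E.htpy (m + 1) F (F.diag.d (m + 1) z) =
      E.app F (m + 1) z - z - F.diag.d m (E.htpy m F z) := by
  let w : F.G (m + 2) (m + 2) := F.shift.diag.d m z
  let t (u : F.G (m + 1) (m + 1)) : F.G (m + 2) (m + 2) := F.toShift.app (m + 1) (m + 1) u
  have hd : F.diag.d (m + 1) z = t z - w := F.diag_d_eq m z
  have hE : (E.app F.shift (m + 1) (F.diag.d (m + 1) z) : F.G (m + 2) (m + 2)) =
      t (E.app F (m + 1) z) - E.app F.shift (m + 1) w := by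
    rw [hd]
    exact (map_sub (E.app F.shift (m + 1)) _ _).trans
      (congrArg₂ _ (E.natural F.toShift (m + 1) z).symm rfl)
  have hH : F.shift.diag.d m (E.htpy m F.shift (F.diag.d (m + 1) z)) =
      t (F.diag.d m (E.htpy m F z)) - F.shift.diag.d m (E.htpy m F.shift w) := by
    rw [hd]
    refine (congrArg _ (map_sub (E.htpy m F.shift) _ _)).trans ((map_sub _ _ _).trans
      (congrArg₂ _ ?_ rfl))
    refine (congrArg _ (E.htpy_natural m F.toShift z).symm).trans ?_
    exact (F.toShift.diag_d m _).symm
  rw [htpy_succ, hE, hH, hd]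
  have e : t (E.app F (m + 1) z) - E.app F.shift (m + 1) w - (t z - w) -
      (t (F.diag.d m (E.htpy m F z)) - F.shift.diag.d m (E.htpy m F.shift w)) =
      t (E.app F (m + 1) z) - t z - t (F.diag.d m (E.htpy m F z)) -
        (E.app F.shift (m + 1) w - w - F.shift.diag.d m (E.htpy m F.shift w)) := by abel
  rw [e, sub_eq_zero.2 hz, sub_zero]
  simp only [t, map_sub, F.σ_toShift]

/-- The homotopy formula at a coboundary, where one of its two terms vanishes. -/
theorem app_d_sub (m : ℕ) (F : BiCos.{u}) (z : F.G m m) :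
    E.app F (m + 1) (F.diag.d m z) - F.diag.d m z =
      F.diag.d m (E.htpy m F (F.diag.d m z)) := by
  induction m generalizing F with
  | zero =>
    rw [E.comm, E.zero, sub_self]
    exact (map_zero _).symm
  | succ m ih =>
    rw [E.htpy_succ_d m F z (ih F.shift z), map_sub, map_sub, E.comm, F.diag.d_d, sub_zero]

/-- A natural endomorphism that is the identity in degree zero is homotopic to the identity. -/
theorem app_sub_self (m : ℕ) (F : BiCos.{u}) (z : F.G (m + 1) (m + 1)) :
    E.app F (m + 1) z - z =
      F.diag.d m (E.htpy m F z) + E.htpy (m + 1) F (F.diag.d (m + 1) z) := by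
  rw [E.htpy_succ_d m F z (E.app_d_sub m F.shift z)]
  abel

theorem htpy_normal (m : ℕ) (F : BiCos.{u}) (z : F.G (m + 1) (m + 1)) (hz : F.diag.Normal z) :
    F.diag.Normal (E.htpy m F z) := by
  induction m generalizing F with
  | zero => trivial
  | succ m ih =>
    intro i
    rw [htpy_succ]
    refine (F.map_map _ _ _ _ _).trans ?_
    rw [← joinMap_σ_comp_σ_zero, ← F.map_map]
    have hz' : F.shift.diag.Normal (n := m + 1) z := Cos.Normal.shift (X := F.diag) hz
    have h : F.shift.diag.Normal (n := m + 1) ((E.app F.shift (m + 1) z : F.G (m + 2) (m + 2)) - z -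
        F.shift.diag.d m (E.htpy m F.shift z)) :=
      ((E.normal F.shift _ z hz').sub hz').sub (ih F.shift z hz').d
    exact (congrArg _ (h i)).trans (map_zero _)

end DiagEndo

/-! ### The Alexander-Whitney map -/

section Faces

/-- The front face of dimension `p`, for `p ≤ N`. -/
def front (p N : ℕ) : ⦋p⦌ ⟶ ⦋N⦌ :=
  SimplexCategory.mkHom
    { toFun := fun t => ⟨min t N, by omega⟩
      monotone' := fun s t h => by
        have : (s : ℕ) ≤ t := h
        change min (s : ℕ) N ≤ min (t : ℕ) N
        omega }

/-- The back face of dimension `l` that begins at the vertex `p`, for `p + l ≤ N`. -/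
def back (p l N : ℕ) : ⦋l⦌ ⟶ ⦋N⦌ :=
  SimplexCategory.mkHom
    { toFun := fun t => ⟨min (t + p) N, by omega⟩
      monotone' := fun s t h => by
        have : (s : ℕ) ≤ t := h
        change min (s + p : ℕ) N ≤ min (t + p : ℕ) N
        omega }

/-- The coface map that omits `i`, for all natural numbers `i`. -/
def face (n i : ℕ) : ⦋n⦌ ⟶ ⦋n + 1⦌ :=
  SimplexCategory.mkHom
    { toFun := fun t => ⟨if (t : ℕ) < i then t else t + 1, by have := t.2; split <;> omega⟩
      monotone' := fun s t h => by
        have : (s : ℕ) ≤ t := h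
        change (if (s : ℕ) < i then (s : ℕ) else s + 1) ≤ (if (t : ℕ) < i then (t : ℕ) else t + 1)
        split <;> split <;> omega }

theorem front_apply (p N : ℕ) (t : Fin (p + 1)) : ((front p N).toOrderHom t : ℕ) = min (t : ℕ) N :=
  rfl

theorem back_apply (p l N : ℕ) (t : Fin (l + 1)) :
    ((back p l N).toOrderHom t : ℕ) = min (t + p : ℕ) N := rfl

theorem face_apply (n i : ℕ) (t : Fin (n + 1)) :
    ((face n i).toOrderHom t : ℕ) = if (t : ℕ) < i then (t : ℕ) else t + 1 := rfl

theorem face_eq_δ {n : ℕ} (i : Fin (n + 2)) : face n i = SimplexCategory.δ i :=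
  simplexHom_ext fun t => by
    rw [face_apply, δ_apply, Fin.succAbove]
    simp only [Fin.lt_def, Fin.val_castSucc]
    split <;> rfl

theorem back_face_of_le {p l N i : ℕ} (h : p + l = N) (hi : i ≤ p) :
    back p l N ≫ face N i = back (p + 1) l (N + 1) :=
  simplexHom_ext fun t => by
    have := t.2
    rw [comp_toOrderHom_apply, face_apply, back_apply, back_apply, if_neg (by omega)]
    omega

theorem front_face_of_le {p l N i : ℕ} (h : p + l = N) (hi : i ≤ p + 1) :
    front p N ≫ face N i = face p i ≫ front (p + 1) (N + 1) :=
  simplexHom_ext fun t => by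
    have := t.2
    rw [comp_toOrderHom_apply, comp_toOrderHom_apply, face_apply, front_apply, front_apply,
      face_apply]
    split_ifs <;> omega

theorem front_face_of_lt {p l N i : ℕ} (h : p + l = N) (hi : p < i) :
    front p N ≫ face N i = front p (N + 1) :=
  simplexHom_ext fun t => by
    have := t.2
    rw [comp_toOrderHom_apply, face_apply, front_apply, front_apply, if_pos (by omega)]
    omega

theorem back_face_of_lt {p l N j : ℕ} (h : p + l = N) :
    back p l N ≫ face N (p + j) = face l j ≫ back p (l + 1) (N + 1) :=
  simplexHom_ext fun t => by
    have := t.2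
    rw [comp_toOrderHom_apply, comp_toOrderHom_apply, face_apply, back_apply, back_apply,
      face_apply]
    split_ifs <;> omega

end Faces

theorem Cos.d_eq_range (X : Cos.{u}) (n : ℕ) (z : X.G n) :
    X.d n z = ∑ i ∈ Finset.range (n + 2), (-1 : ℤ) ^ i • X.map (face n i) z := by
  rw [X.d_apply, Finset.sum_range]
  exact Finset.sum_congr rfl fun i _ => by rw [face_eq_δ]

namespace BiCos

variable (F : BiCos.{u})

/-- The part of the total differential that raises the second degree. -/
def vertD (y : ∀ p l, F.G l p) (p l : ℕ) : F.G l p :=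
  match p with
  | 0 => 0
  | p + 1 => (F.vert l).d p (y p l)

/-- The part of the total differential that raises the first degree, without its sign. -/
def horD (y : ∀ p l, F.G l p) (p l : ℕ) : F.G l p :=
  match l with
  | 0 => 0
  | l + 1 => (F.hor p).d l (y p l)

/-- The differential of the total complex. -/
def totD (y : ∀ p l, F.G l p) (p l : ℕ) : F.G l p :=
  F.vertD y p l + (-1 : ℤ) ^ p • F.horD y p l

/-- The Alexander-Whitney map, from the total complex to the diagonal. -/
def aw (N : ℕ) (y : ∀ p l, F.G l p) : F.G N N :=
  ∑ x ∈ Finset.HasAntidiagonal.antidiagonal N, F.map (back x.1 x.2 N) (front x.1 N) (y x.1 x.2)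

/-- The cofaces that omit a vertex of the front face give the differential in the second direction, those
that omit a vertex of the back face the one in the first direction. -/
theorem aw_totD_aux {p l N : ℕ} (h : p + l = N) (y : F.G l p) :
    F.diag.d N (F.map (back p l N) (front p N) y) =
      F.map (back (p + 1) l (N + 1)) (front (p + 1) (N + 1)) ((F.vert l).d p y) +
      (-1 : ℤ) ^ p • F.map (back p (l + 1) (N + 1)) (front p (N + 1)) ((F.hor p).d l y) := by
  rw [Cos.d_eq_range, Cos.d_eq_range, Cos.d_eq_range, map_sum, map_sum]
  have hN : N + 2 = (p + 1) + (l + 1) := by omega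
  rw [hN, Finset.sum_range_add, Finset.sum_range_succ _ (p + 1), Finset.sum_range_succ' _ (l + 1)]
  have e1 : ∑ i ∈ Finset.range (p + 1), (-1 : ℤ) ^ i •
      F.diag.map (face N i) (F.map (back p l N) (front p N) y) =
      ∑ i ∈ Finset.range (p + 1), F.map (back (p + 1) l (N + 1)) (front (p + 1) (N + 1))
        ((-1 : ℤ) ^ i • (F.vert l).map (face p i) y) := by
    refine Finset.sum_congr rfl fun i hi => ?_
    have hi' := Finset.mem_range.1 hi
    rw [map_zsmul, F.map_map, F.map_map, back_face_of_le h (by omega),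
      front_face_of_le h (by omega), Category.id_comp]
  have e2 : ∑ j ∈ Finset.range (l + 1), (-1 : ℤ) ^ (p + 1 + j) •
      F.diag.map (face N (p + 1 + j)) (F.map (back p l N) (front p N) y) =
      (-1 : ℤ) ^ p • ∑ j ∈ Finset.range (l + 1), F.map (back p (l + 1) (N + 1)) (front p (N + 1))
        ((-1 : ℤ) ^ (j + 1) • (F.hor p).map (face l (j + 1)) y) := by
    rw [Finset.smul_sum]
    refine Finset.sum_congr rfl fun j hj => ?_
    rw [map_zsmul, F.map_map, F.map_map, front_face_of_lt h (by omega), Category.id_comp,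
      show p + 1 + j = p + (j + 1) by omega, back_face_of_lt h, smul_smul, pow_add]
  -- The two remaining terms are the same element with opposite signs.
  have e3 : F.map (back (p + 1) l (N + 1)) (front (p + 1) (N + 1))
        ((-1 : ℤ) ^ (p + 1) • (F.vert l).map (face p (p + 1)) y) +
      (-1 : ℤ) ^ p • F.map (back p (l + 1) (N + 1)) (front p (N + 1))
        ((-1 : ℤ) ^ 0 • (F.hor p).map (face l 0) y) = 0 := by
    rw [map_zsmul, map_zsmul, F.map_map, F.map_map, Category.id_comp, Category.id_comp,
      ← front_face_of_le h le_rfl, front_face_of_lt h (by omega), ← back_face_of_lt h,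
      back_face_of_le h (by omega), pow_succ]
    simp
  rw [e1, e2, smul_add]
  have e4 := congrArg Neg.neg e3
  rw [neg_zero] at e4
  rw [← sub_eq_zero, ← e4]
  abel

/-- The Alexander-Whitney map is a map of complexes. -/
theorem aw_totD (N : ℕ) (y : ∀ p l, F.G l p) :
    F.aw (N + 1) (F.totD y) = F.diag.d N (F.aw N y) := by
  have h : F.aw (N + 1) (F.totD y) =
      (∑ x ∈ Finset.HasAntidiagonal.antidiagonal (N + 1),
        F.map (back x.1 x.2 (N + 1)) (front x.1 (N + 1)) (F.vertD y x.1 x.2)) +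
      ∑ x ∈ Finset.HasAntidiagonal.antidiagonal (N + 1), F.map (back x.1 x.2 (N + 1)) (front x.1 (N + 1))
        ((-1 : ℤ) ^ x.1 • F.horD y x.1 x.2) := by
    rw [← Finset.sum_add_distrib]
    exact Finset.sum_congr rfl fun x _ => map_add _ _ _
  rw [h, Finset.Nat.sum_antidiagonal_succ, Finset.Nat.sum_antidiagonal_succ', aw, map_sum]
  simp only [vertD, horD, map_zero, smul_zero, zero_add, map_zsmul]
  rw [← Finset.sum_add_distrib]
  exact Finset.sum_congr rfl fun x hx => (F.aw_totD_aux (Finset.HasAntidiagonal.mem_antidiagonal.1 hx) _).symm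

/-- The Eilenberg-Zilber shuffle map from the diagonal to the component of bidegree `(l, p)` of the
total complex. A shuffle begins with a step in one of the two directions, which leaves a shuffle
for the decalage. The map is zero unless `p + l = N`. -/
def shuffle (N p l : ℕ) (F : BiCos.{u}) : F.G N N →+ F.G l p :=
  match N, p, l with
  | 0, 0, 0 => AddMonoidHom.id _
  | 0, _ + 1, _ => 0
  | 0, 0, _ + 1 => 0
  | N + 1, 0, 0 => 0
  | N + 1, p + 1, 0 => (F.map (SimplexCategory.σ 0) (𝟙 _)).comp (shuffle N p 0 F.shift)
  | N + 1, 0, l + 1 => (F.map (𝟙 _) (SimplexCategory.σ 0)).comp (shuffle N 0 l F.shift)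
  | N + 1, p + 1, l + 1 => (F.map (SimplexCategory.σ 0) (𝟙 _)).comp (shuffle N p (l + 1) F.shift) +
      (-1 : ℤ) ^ (p + 1) •
        (F.map (𝟙 _) (SimplexCategory.σ 0)).comp (shuffle N (p + 1) l F.shift)

end BiCos

/-! ### Compatibility of the shuffle map with the differentials -/

namespace BiCos

variable (F : BiCos.{u})

/-- The bicosimplicial group with its two directions exchanged. -/
abbrev swap : BiCos.{u} where
  G i j := F.G j i
  map a b := F.map b a
  map_id i j z := F.map_id j i z
  map_map a a' b b' z := F.map_map b b' a a' z

theorem shuffle_natural (N : ℕ) {F F' : BiCos.{u}} (φ : Hom F F') (p l : ℕ) (z : F.G N N) :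
    φ.app l p (F.shuffle N p l z) = F'.shuffle N p l (φ.app N N z) := by
  induction N generalizing F F' p l with
  | zero =>
    rcases p with _ | p
    · rcases l with _ | l
      · rfl
      · exact map_zero _
    · exact map_zero _
  | succ N ih =>
    have h := fun p l => ih φ.shift p l z
    rcases p with _ | p <;> rcases l with _ | l
    · exact map_zero _
    · exact (φ.natural _ _ _).trans (congrArg _ (h 0 l))
    · exact (φ.natural _ _ _).trans (congrArg _ (h p 0))
    · refine (map_add _ _ _).trans (congrArg₂ _ ?_ ((map_zsmul _ _ _).trans (congrArg _ ?_)))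
      · exact (φ.natural _ _ _).trans (congrArg _ (h p (l + 1)))
      · exact (φ.natural _ _ _).trans (congrArg _ (h (p + 1) l))

/-- The extra codegeneracy of the decalage in the first direction only commutes with the differential in
the second direction up to the first coface. -/
theorem vert_d_σ (l p : ℕ) (y : F.G (l + 1) (p + 1)) :
    (F.vert l).d (p + 1) (F.map (SimplexCategory.σ 0) (𝟙 _) y) =
      F.map (SimplexCategory.σ 0) (SimplexCategory.δ 0) y -
        F.map (SimplexCategory.σ 0) (𝟙 _) ((F.shift.vert l).d p y) := by
  rw [Cos.d_eq_sub_shift]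
  refine congrArg₂ _ ?_ ?_
  · rw [F.map_map, Category.id_comp, Category.comp_id]
  · refine (Cos.map_d (F.shift.vert l) (Y := (F.vert l).shift)
      (fun i => F.map (SimplexCategory.σ 0) (𝟙 _)) (fun a z => ?_) p y).symm
    refine (F.map_map _ _ _ _ _).trans (Eq.trans ?_ (F.map_map _ _ _ _ _).symm)
    rw [joinMap_id, Category.id_comp, Category.id_comp, Category.comp_id, Category.comp_id]

/-- The extra codegeneracy of the decalage in the second direction contracts the differential in the same
direction, up to a correction by its first coface. -/
theorem map_σ_vert_d (l p : ℕ) (y : F.G (l + 1) (p + 1)) :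
    F.map (𝟙 _) (SimplexCategory.σ 0) ((F.shift.vert l).d p y) =
      y + (F.vert (l + 1)).d p (F.map (𝟙 _) (SimplexCategory.σ 0) y) -
        F.map (𝟙 _) (SimplexCategory.σ 0 ≫ SimplexCategory.δ 0) y := by
  rw [Cos.d_apply, Cos.d_apply]
  conv_lhs => rw [Fin.sum_univ_succ]
  conv_rhs => rw [Fin.sum_univ_succ]
  have e0 : F.map (𝟙 ⦋l + 1⦌) (SimplexCategory.σ 0)
      ((F.shift.vert l).map (SimplexCategory.δ 0) y) = y := by
    refine (F.map_map _ _ _ _ _).trans ?_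
    rw [joinMap_id, joinMap_δ_zero_comp_σ_zero, Category.id_comp, F.map_id]
  have e1 (i : Fin (p + 1)) : F.map (𝟙 ⦋l + 1⦌) (SimplexCategory.σ 0)
      ((F.shift.vert l).map (SimplexCategory.δ i.succ) y) =
      (F.vert (l + 1)).map (SimplexCategory.δ i.succ) (F.map (𝟙 _) (SimplexCategory.σ 0) y) := by
    refine (F.map_map _ _ _ _ _).trans (Eq.trans ?_ (F.map_map _ _ _ _ _).symm)
    rw [joinMap_id, joinMap_comp_σ_zero_δ]
  have e2 : (F.vert (l + 1)).map (SimplexCategory.δ 0) (F.map (𝟙 _) (SimplexCategory.σ 0) y) =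
      F.map (𝟙 _) (SimplexCategory.σ 0 ≫ SimplexCategory.δ 0) y := by
    rw [F.map_map, Category.id_comp]
  refine (map_add (F.map (𝟙 ⦋l + 1⦌) (SimplexCategory.σ 0)) _ _).trans ?_
  rw [map_sum, map_zsmul, e0, e2]
  simp only [map_zsmul, e1, Fin.val_zero, pow_zero, one_smul]
  abel

theorem hor_d_σ (l p : ℕ) (y : F.G (l + 1) (p + 1)) :
    (F.hor p).d (l + 1) (F.map (𝟙 _) (SimplexCategory.σ 0) y) =
      F.map (SimplexCategory.δ 0) (SimplexCategory.σ 0) y -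
        F.map (𝟙 _) (SimplexCategory.σ 0) ((F.shift.hor p).d l y) :=
  F.swap.vert_d_σ p l y

theorem map_σ_hor_d (l p : ℕ) (y : F.G (l + 1) (p + 1)) :
    F.map (SimplexCategory.σ 0) (𝟙 _) ((F.shift.hor p).d l y) =
      y + (F.hor (p + 1)).d l (F.map (SimplexCategory.σ 0) (𝟙 _) y) -
        F.map (SimplexCategory.σ 0 ≫ SimplexCategory.δ 0) (𝟙 _) y :=
  F.swap.map_σ_vert_d p l y

theorem map_σ_id_toShift {i j : ℕ} (y : F.G i j) :
    F.map (SimplexCategory.σ 0) (𝟙 _) (F.toShift.app i j y) =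
      F.map (𝟙 _) (SimplexCategory.δ 0) y := by
  refine (F.map_map _ _ _ _ _).trans ?_
  have := SimplexCategory.δ_comp_σ_self (n := i) (i := 0)
  simp only [Fin.castSucc_zero] at this
  rw [this, Category.comp_id]

theorem map_id_σ_toShift {i j : ℕ} (y : F.G i j) :
    F.map (𝟙 _) (SimplexCategory.σ 0) (F.toShift.app i j y) =
      F.map (SimplexCategory.δ 0) (𝟙 _) y :=
  F.swap.map_σ_id_toShift y

theorem shuffle_d_zero (F : BiCos.{u}) (p l : ℕ) (z : F.G 0 0) :
    F.shuffle 1 p l (F.diag.d 0 z) = F.totD (fun p l => F.shuffle 0 p l z) p l := by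
  have h1 : ∀ i : Fin 2, SimplexCategory.δ i ≫ SimplexCategory.σ (0 : Fin 1) = 𝟙 _ := by decide
  rcases p with _ | _ | p <;> rcases l with _ | _ | l <;>
    simp only [totD, vertD, horD, shuffle, map_zero, smul_zero, add_zero, zero_add,
      AddMonoidHom.zero_apply, AddMonoidHom.id_apply, AddMonoidHom.comp_zero, AddMonoidHom.comp_id, pow_zero, one_smul]
  · rw [Cos.d_apply, Cos.d_apply, map_sum]
    refine Finset.sum_congr rfl fun i _ => ?_
    rw [map_zsmul, F.map_map, h1, Category.comp_id]
  · rw [Cos.d_apply, Cos.d_apply, map_sum]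
    refine Finset.sum_congr rfl fun i _ => ?_
    rw [map_zsmul, F.map_map, h1, Category.comp_id]

/-- The shuffles that begin with a step in the second direction. -/
def stepVert (y : ∀ p l, F.shift.G l p) (p l : ℕ) : F.G l p :=
  match p with
  | 0 => 0
  | p + 1 => F.map (SimplexCategory.σ 0) (𝟙 _) (y p l)

/-- The shuffles that begin with a step in the first direction. -/
def stepHor (y : ∀ p l, F.shift.G l p) (p l : ℕ) : F.G l p :=
  match l with
  | 0 => 0
  | l + 1 => F.map (𝟙 _) (SimplexCategory.σ 0) (y p l)

theorem shuffle_succ (N p l : ℕ) (z : F.G (N + 1) (N + 1)) :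
    F.shuffle (N + 1) p l z = F.stepVert (fun p l => F.shift.shuffle N p l z) p l +
      (-1 : ℤ) ^ p • F.stepHor (fun p l => F.shift.shuffle N p l z) p l := by
  rcases p with _ | p <;> rcases l with _ | l
  · simp [shuffle, stepVert, stepHor]
  · simp [shuffle, stepVert, stepHor]
  · simp [shuffle, stepVert, stepHor]
  · rfl

/-- The defect of compatibility with the differentials of `stepHor`. The right hand side is the same as in
`map_sub_stepVert`, so that the two defects cancel in the shuffle map. -/
theorem map_sub_stepHor (y : ∀ p l, F.shift.G l p) (p l : ℕ) :
    F.map (𝟙 _) (SimplexCategory.δ 0) (F.stepHor y p l) -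
      F.map (SimplexCategory.σ 0) (𝟙 _) (F.shift.horD y p l) -
      (F.vert l).d p (F.stepHor y p l) =
    match l with
    | 0 => 0
    | l + 1 => F.map (𝟙 _) (SimplexCategory.σ 0 ≫ SimplexCategory.δ 0) (y p l) - y p l -
      (F.hor (p + 1)).d l (F.map (SimplexCategory.σ 0) (𝟙 _) (y p l)) +
      F.map (SimplexCategory.σ 0 ≫ SimplexCategory.δ 0) (𝟙 _) (y p l) -
      (F.vert (l + 1)).d p (F.map (𝟙 _) (SimplexCategory.σ 0) (y p l)) := by
  rcases l with _ | l
  · simp only [stepHor, horD, map_zero, sub_zero]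
  · simp only [stepHor, horD]
    rw [F.map_σ_hor_d, F.map_map, Category.comp_id]
    abel

/-- The defect of compatibility with the differentials of `stepVert`. -/
theorem map_sub_stepVert (y : ∀ p l, F.shift.G l p) (p l : ℕ) :
    F.map (SimplexCategory.δ 0) (𝟙 _) (F.stepVert y p l) -
      F.map (𝟙 _) (SimplexCategory.σ 0) (F.shift.vertD y p l) -
      (F.hor p).d l (F.stepVert y p l) =
    match p with
    | 0 => 0
    | p + 1 => F.map (𝟙 _) (SimplexCategory.σ 0 ≫ SimplexCategory.δ 0) (y p l) - y p l -
      (F.hor (p + 1)).d l (F.map (SimplexCategory.σ 0) (𝟙 _) (y p l)) +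
      F.map (SimplexCategory.σ 0 ≫ SimplexCategory.δ 0) (𝟙 _) (y p l) -
      (F.vert (l + 1)).d p (F.map (𝟙 _) (SimplexCategory.σ 0) (y p l)) := by
  rcases p with _ | p
  · simp only [stepVert, vertD, map_zero, sub_zero]
  · simp only [stepVert, vertD]
    rw [F.map_σ_vert_d, F.map_map, Category.comp_id]
    abel

theorem vert_d_stepVert (y : ∀ p l, F.shift.G l p) (p l : ℕ) :
    (F.vert l).d p (F.stepVert y p l) = F.map (𝟙 _) (SimplexCategory.δ 0) (F.stepVert y p l) -
      F.map (SimplexCategory.σ 0) (𝟙 _) (F.shift.vertD y p l) := by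
  rcases p with _ | p
  · simp only [stepVert, vertD, map_zero, sub_zero]
  · simp only [stepVert, vertD]
    rw [F.vert_d_σ, F.map_map, Category.id_comp, Category.comp_id]

theorem hor_d_stepHor (y : ∀ p l, F.shift.G l p) (p l : ℕ) :
    (F.hor p).d l (F.stepHor y p l) = F.map (SimplexCategory.δ 0) (𝟙 _) (F.stepHor y p l) -
      F.map (𝟙 _) (SimplexCategory.σ 0) (F.shift.horD y p l) := by
  rcases l with _ | l
  · simp only [stepHor, horD, map_zero, sub_zero]
  · simp only [stepHor, horD]
    rw [F.hor_d_σ, F.map_map, Category.id_comp, Category.comp_id]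

/-- The shuffle map is a map of complexes, by induction through the decalage. -/
theorem shuffle_d (N : ℕ) (F : BiCos.{u}) (p l : ℕ) (z : F.G N N) :
    F.shuffle (N + 1) p l (F.diag.d N z) = F.totD (fun p l => F.shuffle N p l z) p l := by
  induction N generalizing F p l with
  | zero => exact shuffle_d_zero F p l z
  | succ N ih =>
    let u (p l : ℕ) : F.G l p := F.shuffle (N + 1) p l z
    let v (p l : ℕ) : F.shift.G l p := F.shift.shuffle N p l z
    let K (p l : ℕ) : F.shift.G l p := F.shift.shuffle (N + 1) p l (F.diag.d (N + 1) z)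
    have hu (p l : ℕ) : u p l = F.stepVert v p l + (-1 : ℤ) ^ p • F.stepHor v p l :=
      F.shuffle_succ N p l z
    have key (p l : ℕ) : K p l = F.toShift.app l p (u p l) -
        (F.shift.vertD v p l + (-1 : ℤ) ^ p • F.shift.horD v p l) := by
      have := (map_sub (F.shift.shuffle (N + 1) p l) _ _).trans
        (congrArg₂ _ (shuffle_natural (N + 1) F.toShift p l z).symm (ih F.shift p l z))
      exact (congrArg _ (F.diag_d_eq N z)).trans this
    have hV (p l : ℕ) : F.map (SimplexCategory.σ 0) (𝟙 _) (K p l) - (F.vert l).d p (u p l) =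
        (-1 : ℤ) ^ p • (F.map (𝟙 _) (SimplexCategory.δ 0) (F.stepHor v p l) -
          F.map (SimplexCategory.σ 0) (𝟙 _) (F.shift.horD v p l) -
          (F.vert l).d p (F.stepHor v p l)) := by
      have h1 : F.map (SimplexCategory.σ 0) (𝟙 _) (K p l) =
          F.map (𝟙 _) (SimplexCategory.δ 0) (u p l) -
            (F.map (SimplexCategory.σ 0) (𝟙 _) (F.shift.vertD v p l) +
              (-1 : ℤ) ^ p • F.map (SimplexCategory.σ 0) (𝟙 _) (F.shift.horD v p l)) := by
        rw [key, ← map_zsmul]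
        refine (map_sub (F.map (SimplexCategory.σ 0) (𝟙 _)) _ _).trans (congrArg₂ _ ?_ ?_)
        · exact F.map_σ_id_toShift _
        · exact map_add (F.map (SimplexCategory.σ 0) (𝟙 _)) _ _
      rw [h1, hu, map_add, map_add, map_zsmul, map_zsmul, F.vert_d_stepVert]
      module
    have hH (p l : ℕ) : F.map (𝟙 _) (SimplexCategory.σ 0) (K p l) - (F.hor p).d l (u p l) =
        F.map (SimplexCategory.δ 0) (𝟙 _) (F.stepVert v p l) -
          F.map (𝟙 _) (SimplexCategory.σ 0) (F.shift.vertD v p l) -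
          (F.hor p).d l (F.stepVert v p l) := by
      have h1 : F.map (𝟙 _) (SimplexCategory.σ 0) (K p l) =
          F.map (SimplexCategory.δ 0) (𝟙 _) (u p l) -
            (F.map (𝟙 _) (SimplexCategory.σ 0) (F.shift.vertD v p l) +
              (-1 : ℤ) ^ p • F.map (𝟙 _) (SimplexCategory.σ 0) (F.shift.horD v p l)) := by
        rw [key, ← map_zsmul]
        refine (map_sub (F.map (𝟙 _) (SimplexCategory.σ 0)) _ _).trans (congrArg₂ _ ?_ ?_)
        · exact F.map_id_σ_toShift _
        · exact map_add (F.map (𝟙 _) (SimplexCategory.σ 0)) _ _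
      rw [h1, hu, map_add, map_add, map_zsmul, map_zsmul, F.hor_d_stepHor]
      module
    rw [shuffle_succ]
    change F.stepVert K p l + (-1 : ℤ) ^ p • F.stepHor K p l =
      F.vertD u p l + (-1 : ℤ) ^ p • F.horD u p l
    rw [← sub_eq_zero]
    have hV' := fun p l => (hV p l).trans (congrArg _ (F.map_sub_stepHor v p l))
    have hH' := fun p l => (hH p l).trans (F.map_sub_stepVert v p l)
    rcases p with _ | p <;> rcases l with _ | l
    · simp [stepVert, stepHor, vertD, horD]
    · simp only [stepVert, stepHor, vertD, horD, zero_add, ← smul_sub]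
      rw [hH', smul_zero]
    · simp only [stepVert, stepHor, vertD, horD, smul_zero, add_zero]
      rw [hV', smul_zero]
    · simp only [stepVert, stepHor, vertD, horD]
      rw [add_sub_add_comm, ← smul_sub, hH', hV', pow_succ]
      module

end BiCos

/-! ### Shuffles as sets of steps -/

section Steps

variable {N : ℕ}

/-- The number of elements of `S` below `t`. -/
def countBelow (S : Finset (Fin N)) (t : ℕ) : ℕ := (S.filter fun j : Fin N => (j : ℕ) < t).card

theorem countBelow_mono (S : Finset (Fin N)) : Monotone (countBelow S) := fun s t h =>
  Finset.card_le_card fun j hj => by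
    simp only [Finset.mem_filter] at hj ⊢
    exact ⟨hj.1, hj.2.trans_le h⟩

theorem countBelow_le (S : Finset (Fin N)) (t : ℕ) : countBelow S t ≤ S.card :=
  Finset.card_filter_le _ _

theorem countBelow_zero (S : Finset (Fin N)) : countBelow S 0 = 0 := by simp [countBelow]

theorem countBelow_succ (S : Finset (Fin N)) (t : Fin N) :
    countBelow S (t + 1) = countBelow S t + if t ∈ S then 1 else 0 := by
  have e : (S.filter fun j : Fin N => (j : ℕ) < t + 1) =
      (S.filter fun j : Fin N => (j : ℕ) < t) ∪ (S.filter fun j : Fin N => j = t) := by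
    ext j
    simp only [Finset.mem_filter, Finset.mem_union, Fin.ext_iff]
    have : (j : ℕ) < t + 1 ↔ (j : ℕ) < t ∨ (j : ℕ) = t := by omega
    rw [this]
    tauto
  rw [countBelow, e, Finset.card_union_of_disjoint, Finset.filter_eq']
  · split <;> rfl
  · rw [Finset.disjoint_filter]
    rintro j - h rfl
    exact lt_irrefl _ h

theorem exists_mem_countBelow_eq (S : Finset (Fin N)) {i : ℕ} (h : i < S.card) :
    ∃ t ∈ S, countBelow S t = i := by
  have key : ∀ m ≤ N, i < countBelow S m → ∃ t ∈ S, countBelow S t = i := by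
    intro m hm h
    induction m with
    | zero => rw [countBelow_zero] at h; omega
    | succ m ih =>
      by_cases h' : i < countBelow S m
      · exact ih (by omega) h'
      · have e := countBelow_succ S ⟨m, hm⟩
        by_cases ht : (⟨m, hm⟩ : Fin N) ∈ S
        · rw [if_pos ht] at e
          refine ⟨_, ht, ?_⟩
          simp only at e ⊢
          omega
        · rw [if_neg ht] at e
          simp only at e
          omega
  refine key N le_rfl ?_
  rwa [countBelow, Finset.filter_true_of_mem fun (j : Fin N) _ => j.2]

/-- The subset of the steps `1, …, N` that corresponds to a subset of the steps `0, …, N - 1`. -/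
def lateSteps (S : Finset (Fin N)) : Finset (Fin (N + 1)) := S.map (Fin.succEmb N)

/-- The step `0` together with `lateSteps S`. -/
def earlySteps (S : Finset (Fin N)) : Finset (Fin (N + 1)) :=
  Finset.cons 0 (lateSteps S) (by simp [lateSteps])

theorem succ_mem_lateSteps {S : Finset (Fin N)} {t : Fin N} : t.succ ∈ lateSteps S ↔ t ∈ S := by
  simp [lateSteps]

theorem zero_notMem_lateSteps {S : Finset (Fin N)} : (0 : Fin (N + 1)) ∉ lateSteps S := by
  simp [lateSteps]

theorem zero_mem_earlySteps {S : Finset (Fin N)} : (0 : Fin (N + 1)) ∈ earlySteps S := by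
  simp [earlySteps]

theorem succ_mem_earlySteps {S : Finset (Fin N)} {t : Fin N} : t.succ ∈ earlySteps S ↔ t ∈ S := by
  simp [earlySteps, succ_mem_lateSteps]

theorem compl_lateSteps (S : Finset (Fin N)) : (lateSteps S)ᶜ = earlySteps Sᶜ := by
  ext t
  induction t using Fin.cases <;>
    simp [zero_notMem_lateSteps, zero_mem_earlySteps, succ_mem_lateSteps, succ_mem_earlySteps]

theorem compl_earlySteps (S : Finset (Fin N)) : (earlySteps S)ᶜ = lateSteps Sᶜ := by
  rw [← compl_compl (lateSteps Sᶜ), compl_lateSteps, compl_compl]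

theorem card_lateSteps (S : Finset (Fin N)) : (lateSteps S).card = S.card := Finset.card_map _

theorem card_earlySteps (S : Finset (Fin N)) : (earlySteps S).card = S.card + 1 := by
  rw [earlySteps, Finset.card_cons, card_lateSteps]

theorem countBelow_lateSteps (S : Finset (Fin N)) (t : ℕ) :
    countBelow (lateSteps S) (t + 1) = countBelow S t := by
  rw [countBelow, lateSteps, Finset.filter_map, Finset.card_map]
  simp [countBelow]

theorem countBelow_earlySteps (S : Finset (Fin N)) (t : ℕ) :
    countBelow (earlySteps S) (t + 1) = countBelow S t + 1 := by
  rw [countBelow, earlySteps, Finset.filter_cons_of_pos _ _ _ _ (by simp), Finset.card_cons,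
    ← countBelow, countBelow_lateSteps]

/-- A sum over sets of steps, according to whether the first step belongs to the set. -/
theorem sum_steps {G : Type*} [AddCommMonoid G] (f : Finset (Fin (N + 1)) → G) :
    ∑ T, f T = ∑ S, f (earlySteps S) + ∑ S, f (lateSteps S) := by
  rw [← Finset.sum_filter_add_sum_filter_not Finset.univ (fun T => (0 : Fin (N + 1)) ∈ T)]
  have hp : ∀ T : Finset (Fin (N + 1)), ∀ t : Fin N,
      t ∈ T.preimage Fin.succ (Fin.succ_injective N).injOn ↔ t.succ ∈ T := fun T t =>
    Finset.mem_preimage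
  congr 1
  · refine Finset.sum_nbij' (fun T => T.preimage Fin.succ (Fin.succ_injective N).injOn) earlySteps
      (by simp) (by simp [zero_mem_earlySteps]) (fun T hT => ?_) (fun S _ => ?_) (fun T hT => ?_)
    · ext t
      induction t using Fin.cases with
      | zero => simpa [zero_mem_earlySteps] using hT
      | succ t => rw [succ_mem_earlySteps, hp]
    · ext t
      rw [hp, succ_mem_earlySteps]
    · congr 1
      ext t
      induction t using Fin.cases with
      | zero => simpa [zero_mem_earlySteps] using hT
      | succ t => rw [succ_mem_earlySteps, hp]
  · refine Finset.sum_nbij' (fun T => T.preimage Fin.succ (Fin.succ_injective N).injOn) lateSteps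
      (by simp) (by simp [zero_notMem_lateSteps]) (fun T hT => ?_) (fun S _ => ?_) (fun T hT => ?_)
    · ext t
      induction t using Fin.cases with
      | zero => simpa [zero_notMem_lateSteps] using hT
      | succ t => rw [succ_mem_lateSteps, hp]
    · ext t
      rw [hp, succ_mem_lateSteps]
    · congr 1
      ext t
      induction t using Fin.cases with
      | zero => simpa [zero_notMem_lateSteps] using hT
      | succ t => rw [succ_mem_lateSteps, hp]

theorem shuffleSign_eq (S : Finset (Fin N)) :
    shuffleSign S = (-1) ^ (∑ a ∈ S, ∑ b ∈ Sᶜ, if b < a then 1 else 0) := by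
  rw [shuffleSign, Finset.card_filter, Finset.sum_product]

theorem shuffleSign_earlySteps (S : Finset (Fin N)) :
    shuffleSign (earlySteps S) = shuffleSign S := by
  rw [shuffleSign_eq, shuffleSign_eq, compl_earlySteps, earlySteps, Finset.sum_cons]
  simp only [lateSteps, Finset.sum_map, Fin.coe_succEmb, Fin.not_lt_zero, if_false,
    Fin.succ_lt_succ_iff, Finset.sum_const_zero, zero_add]

theorem shuffleSign_lateSteps (S : Finset (Fin N)) :
    shuffleSign (lateSteps S) = (-1) ^ S.card * shuffleSign S := by
  rw [shuffleSign_eq, shuffleSign_eq, compl_lateSteps, earlySteps, ← pow_add]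
  simp only [lateSteps, Finset.sum_map, Finset.sum_cons, Fin.coe_succEmb, Fin.succ_pos, if_true,
    Fin.succ_lt_succ_iff, Finset.sum_add_distrib, Finset.sum_const, smul_eq_mul, mul_one]

/-- The map `stepMap S`, composed with the retraction to the first `r` steps. For `S` of cardinality
`r` it is `stepMap S`. -/
def stepClamp (S : Finset (Fin N)) (r : ℕ) : ⦋N⦌ ⟶ ⦋r⦌ :=
  SimplexCategory.mkHom
    { toFun := fun t => ⟨min (countBelow S t) r, by omega⟩
      monotone' := fun s t h => min_le_min_right _ (countBelow_mono S h) }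

theorem stepClamp_apply (S : Finset (Fin N)) (r : ℕ) (t : Fin (N + 1)) :
    ((stepClamp S r).toOrderHom t : ℕ) = min (countBelow S t) r := rfl

theorem stepClamp_eq_stepMap {S : Finset (Fin N)} {r : ℕ} (h : S.card = r) :
    stepClamp S r = stepMap S h :=
  simplexHom_ext fun t => by
    exact min_eq_left (h ▸ countBelow_le S t)

theorem stepClamp_earlySteps (S : Finset (Fin N)) (r : ℕ) :
    stepClamp (earlySteps S) (r + 1) = joinMap (stepClamp S r) := by
  refine joinMap_ext ?_ fun t => ?_
  · rw [stepClamp_apply, joinMap_zero]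
    simp [countBelow_zero]
  · rw [stepClamp_apply, joinMap_succ, Fin.val_succ, Fin.val_succ, stepClamp_apply,
      countBelow_earlySteps]
    omega

theorem stepClamp_lateSteps (S : Finset (Fin N)) (r : ℕ) :
    stepClamp (lateSteps S) r = joinMap (stepClamp S r) ≫ SimplexCategory.σ 0 := by
  refine joinMap_ext ?_ fun t => ?_
  · rw [comp_toOrderHom_apply, stepClamp_apply, joinMap_zero, σ_apply]
    simp [countBelow_zero]
  · rw [comp_toOrderHom_apply, stepClamp_apply, joinMap_succ, σ_apply, Fin.val_succ,
      countBelow_lateSteps]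
    simp [stepClamp_apply]

theorem stepClamp_castSucc_eq_succ {S : Finset (Fin N)} (r : ℕ) {t : Fin N} (h : t ∉ S) :
    (stepClamp S r).toOrderHom t.castSucc = (stepClamp S r).toOrderHom t.succ :=
  Fin.ext <| by
    rw [stepClamp_apply, stepClamp_apply, Fin.val_succ, countBelow_succ, if_neg h]
    rfl

end Steps

namespace BiCos

variable {F : BiCos.{u}}

/-- A normalized element of the diagonal is sent to zero by maps that repeat a value at the same step in
both directions. -/
theorem map_eq_zero_of_diag {N i j : ℕ} {z : F.G N N} (hz : F.diag.Normal z) {a : ⦋N⦌ ⟶ ⦋i⦌}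
    {b : ⦋N⦌ ⟶ ⦋j⦌} {t : Fin N} (ha : a.toOrderHom t.castSucc = a.toOrderHom t.succ)
    (hb : b.toOrderHom t.castSucc = b.toOrderHom t.succ) : F.map a b z = 0 := by
  cases N with
  | zero => exact t.elim0
  | succ N =>
    obtain ⟨a', rfl⟩ := exists_σ_comp ha
    obtain ⟨b', rfl⟩ := exists_σ_comp hb
    rw [← F.map_map, hz t, map_zero]

/-- The recursive shuffle map is the signed sum over all shuffles. -/
theorem shuffle_eq_sum (N : ℕ) (F : BiCos.{u}) {p l : ℕ} (h : p + l = N) (z : F.G N N) :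
    F.shuffle N p l z = ∑ S : Finset (Fin N), if S.card = p then
      shuffleSign S • F.map (stepClamp Sᶜ l) (stepClamp S p) z else 0 := by
  induction N generalizing F p l with
  | zero =>
    obtain ⟨rfl, rfl⟩ : p = 0 ∧ l = 0 := by omega
    rw [Fintype.sum_eq_single ∅ fun S hS => absurd (Finset.eq_empty_of_isEmpty S) hS]
    have e : ∀ a : ⦋0⦌ ⟶ ⦋0⦌, a = 𝟙 _ := by decide
    rw [if_pos Finset.card_empty, e (stepClamp _ 0), e (stepClamp _ 0), F.map_id]
    simp [shuffle, shuffleSign]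
  | succ N ih =>
    rw [shuffle_succ, sum_steps]
    congr 1
    · cases p with
      | zero =>
        simp [stepVert, card_earlySteps]
      | succ p =>
        simp only [stepVert]
        rw [ih F.shift (by omega) z, map_sum]
        refine Finset.sum_congr rfl fun S _ => ?_
        simp only [card_earlySteps, add_left_inj]
        split
        · rw [map_zsmul, F.map_map, shuffleSign_earlySteps, compl_earlySteps,
            stepClamp_earlySteps, stepClamp_lateSteps, Category.comp_id]
        · exact map_zero _
    · cases l with
      | zero =>
        simp only [stepHor, smul_zero]
        refine (Finset.sum_eq_zero fun S _ => ?_).symm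
        rw [if_neg]
        rw [card_lateSteps]
        have := Finset.card_le_univ S
        rw [Fintype.card_fin] at this
        omega
      | succ l =>
        simp only [stepHor]
        rw [ih F.shift (by omega) z, map_sum, Finset.smul_sum]
        refine Finset.sum_congr rfl fun S _ => ?_
        simp only [card_lateSteps]
        split
        case isTrue hS =>
          rw [map_zsmul, F.map_map, shuffleSign_lateSteps, compl_lateSteps, hS,
            stepClamp_earlySteps, stepClamp_lateSteps, Category.comp_id, mul_smul]
        case isFalse => rw [map_zero, smul_zero]

/-- Shuffles of a normalized element are normalized in the second direction: a shuffle that is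
followed by a codegeneracy is constant at one step in both directions. -/
theorem shuffle_vert_normal {N p l : ℕ} (h : p + l = N) {z : F.G N N} (hz : F.diag.Normal z) :
    (F.vert l).Normal (F.shuffle N p l z) := by
  cases p with
  | zero => trivial
  | succ p =>
    intro i
    rw [shuffle_eq_sum N F h, map_sum]
    refine Finset.sum_eq_zero fun S _ => ?_
    split
    case isTrue hS =>
      rw [map_zsmul, F.map_map, Category.comp_id]
      obtain ⟨t, ht, hi⟩ := exists_mem_countBelow_eq S (i := i) (by omega)
      rw [map_eq_zero_of_diag hz (t := t) (stepClamp_castSucc_eq_succ _ (by simpa using ht)),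
        smul_zero]
      have h1 : (stepClamp S (p + 1)).toOrderHom t.castSucc = i.castSucc := Fin.ext <| by
        rw [stepClamp_apply, Fin.val_castSucc, hi]
        simp only [Fin.val_castSucc]
        omega
      have h2 : (stepClamp S (p + 1)).toOrderHom t.succ = i.succ := Fin.ext <| by
        rw [stepClamp_apply, Fin.val_succ, countBelow_succ, hi, if_pos ht]
        simp only [Fin.val_succ]
        omega
      rw [comp_toOrderHom_apply, comp_toOrderHom_apply, h1, h2, σ_apply, σ_apply]
      simp
    case isFalse => exact map_zero _

theorem map_eq_zero_of_vert {i j i' j' : ℕ} {y : F.G i j} (hy : (F.vert i).Normal y)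
    {a : ⦋i⦌ ⟶ ⦋i'⦌} {b : ⦋j⦌ ⟶ ⦋j'⦌} {t : Fin j}
    (hb : b.toOrderHom t.castSucc = b.toOrderHom t.succ) : F.map a b y = 0 := by
  have e := F.map_map (𝟙 _) a b (𝟙 _) y
  rw [Category.id_comp, Category.comp_id] at e
  rw [← e, show F.map (𝟙 _) b y = 0 from hy.map_eq_zero hb, map_zero]

theorem map_eq_zero_of_hor {i j i' j' : ℕ} {y : F.G i j} (hy : (F.hor j).Normal y)
    {a : ⦋i⦌ ⟶ ⦋i'⦌} {b : ⦋j⦌ ⟶ ⦋j'⦌} {t : Fin i}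
    (ha : a.toOrderHom t.castSucc = a.toOrderHom t.succ) : F.map a b y = 0 := by
  have e := F.map_map a (𝟙 _) (𝟙 _) b y
  rw [Category.id_comp, Category.comp_id] at e
  rw [← e, show F.map a (𝟙 _) y = 0 from hy.map_eq_zero ha, map_zero]

/-- The Alexander-Whitney map preserves normalized elements: a codegeneracy of the diagonal repeats a value
of the front face or one of the back face. -/
theorem aw_normal {N : ℕ} {y : ∀ p l, F.G l p}
    (hv : ∀ p l, (F.vert l).Normal (y p l)) (hh : ∀ p l, (F.hor p).Normal (y p l)) :
    F.diag.Normal (F.aw N y) := by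
  refine Cos.Normal.sum fun x hx => ?_
  obtain ⟨p, l⟩ := x
  have hN : p + l = N := Finset.HasAntidiagonal.mem_antidiagonal.1 hx
  cases N with
  | zero => trivial
  | succ N =>
    intro t
    change F.map _ _ (F.map _ _ _) = 0
    rw [F.map_map]
    by_cases ht : (t : ℕ) < p
    · refine map_eq_zero_of_vert (hv p l) (t := ⟨t, ht⟩) ?_
      have e1 : (front p (N + 1)).toOrderHom (Fin.castSucc ⟨t, ht⟩) = t.castSucc := Fin.ext <| by
        rw [front_apply]
        simp only [Fin.val_castSucc]
        omega
      have e2 : (front p (N + 1)).toOrderHom (Fin.succ ⟨t, ht⟩) = t.succ := Fin.ext <| by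
        rw [front_apply]
        simp only [Fin.val_succ]
        omega
      rw [comp_toOrderHom_apply, comp_toOrderHom_apply, e1, e2, σ_apply, σ_apply]
      simp
    · have hl : (t : ℕ) - p < l := by omega
      refine map_eq_zero_of_hor (hh p l) (t := ⟨t - p, hl⟩) ?_
      have e1 : (back p l (N + 1)).toOrderHom (Fin.castSucc ⟨t - p, hl⟩) = t.castSucc :=
        Fin.ext <| by
        rw [back_apply]
        simp only [Fin.val_castSucc]
        omega
      have e2 : (back p l (N + 1)).toOrderHom (Fin.succ ⟨t - p, hl⟩) = t.succ :=
        Fin.ext <| by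
        rw [back_apply]
        simp only [Fin.val_succ]
        omega
      rw [comp_toOrderHom_apply, comp_toOrderHom_apply, e1, e2, σ_apply, σ_apply]
      simp

theorem countBelow_initial {N p : ℕ} {t : ℕ} (ht : t ≤ N) :
    countBelow (Finset.univ.filter fun j : Fin N => (j : ℕ) < p) t = min t p := by
  induction t with
  | zero => simp [countBelow_zero]
  | succ t ih =>
    have e := countBelow_succ (Finset.univ.filter fun j : Fin N => (j : ℕ) < p) ⟨t, ht⟩
    simp only [Finset.mem_filter, Finset.mem_univ, true_and] at e
    rw [e, ih (by omega)]
    split <;> omega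

theorem countBelow_initial_compl {N p : ℕ} {t : ℕ} (ht : t ≤ N) :
    countBelow (Finset.univ.filter fun j : Fin N => (j : ℕ) < p)ᶜ t = t - p := by
  induction t with
  | zero => simp [countBelow_zero]
  | succ t ih =>
    have e := countBelow_succ (Finset.univ.filter fun j : Fin N => (j : ℕ) < p)ᶜ ⟨t, ht⟩
    simp only [Finset.mem_compl, Finset.mem_filter, Finset.mem_univ, true_and] at e
    rw [e, ih (by omega)]
    split <;> omega

/-- The shuffle map is a left inverse of the Alexander-Whitney map on normalized elements: all the
terms but one factor through a codegeneracy. -/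
theorem shuffle_aw {N p l : ℕ} (h : p + l = N) {y : ∀ p l, F.G l p}
    (hv : ∀ p l, (F.vert l).Normal (y p l)) (hh : ∀ p l, (F.hor p).Normal (y p l)) :
    F.shuffle N p l (F.aw N y) = y p l := by
  have hterm : ∀ (S : Finset (Fin N)) (p' l' : ℕ), p' + l' = N →
      S ≠ Finset.univ.filter (fun j : Fin N => (j : ℕ) < p') →
      F.map (stepClamp Sᶜ l) (stepClamp S p)
        (F.map (back p' l' N) (front p' N) (y p' l')) = 0 := by
    intro S p' l' h' hS
    rw [F.map_map]
    by_contra hne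
    refine hS (Finset.ext fun j => ?_)
    simp only [Finset.mem_filter, Finset.mem_univ, true_and]
    have := j.2
    constructor
    · intro hj
      by_contra hlt
      have hl : (j : ℕ) - p' < l' := by omega
      refine hne (map_eq_zero_of_hor (hh p' l') (t := ⟨j - p', hl⟩) ?_)
      have e1 : (back p' l' N).toOrderHom (Fin.castSucc ⟨j - p', hl⟩) = j.castSucc :=
        Fin.ext <| by
        rw [back_apply]
        simp only [Fin.val_castSucc]
        omega
      have e2 : (back p' l' N).toOrderHom (Fin.succ ⟨j - p', hl⟩) = j.succ :=
        Fin.ext <| by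
        rw [back_apply]
        simp only [Fin.val_succ]
        omega
      rw [comp_toOrderHom_apply, comp_toOrderHom_apply, e1, e2]
      exact stepClamp_castSucc_eq_succ _ (by simpa using hj)
    · intro hlt
      by_contra hj
      refine hne (map_eq_zero_of_vert (hv p' l') (t := ⟨j, hlt⟩) ?_)
      have e1 : (front p' N).toOrderHom (Fin.castSucc ⟨j, hlt⟩) = j.castSucc := Fin.ext <| by
        rw [front_apply]
        simp only [Fin.val_castSucc]
        omega
      have e2 : (front p' N).toOrderHom (Fin.succ ⟨j, hlt⟩) = j.succ := Fin.ext <| by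
        rw [front_apply]
        simp only [Fin.val_succ]
        omega
      rw [comp_toOrderHom_apply, comp_toOrderHom_apply, e1, e2]
      exact stepClamp_castSucc_eq_succ _ hj
  have hcard : ∀ p' ≤ N, (Finset.univ.filter fun j : Fin N => (j : ℕ) < p').card = p' := by
    intro p' h'
    have := countBelow_initial (N := N) (p := p') (t := N) le_rfl
    rw [countBelow, Finset.filter_true_of_mem fun (j : Fin N) _ => j.2] at this
    omega
  rw [shuffle_eq_sum N F h, Fintype.sum_eq_single (Finset.univ.filter fun j : Fin N => (j : ℕ) < p)]
  · rw [if_pos (hcard p (by omega)), aw, map_sum, Finset.sum_eq_single (p, l)]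
    · have hs : shuffleSign (Finset.univ.filter fun j : Fin N => (j : ℕ) < p) = 1 := by
        rw [shuffleSign, Finset.card_eq_zero.2, pow_zero]
        refine Finset.filter_eq_empty_iff.2 fun ab hab => ?_
        simp only [Finset.mem_product, Finset.mem_filter, Finset.mem_univ, true_and,
          Finset.mem_compl, Fin.lt_def] at hab ⊢
        omega
      have e1 : back p l N ≫ stepClamp (Finset.univ.filter fun j : Fin N => (j : ℕ) < p)ᶜ l =
          𝟙 _ := simplexHom_ext fun t => by
        have := t.2
        rw [comp_toOrderHom_apply, stepClamp_apply, back_apply,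
          countBelow_initial_compl (by omega)]
        change _ = (t : ℕ)
        omega
      have e2 : front p N ≫ stepClamp (Finset.univ.filter fun j : Fin N => (j : ℕ) < p) p =
          𝟙 _ := simplexHom_ext fun t => by
        have := t.2
        rw [comp_toOrderHom_apply, stepClamp_apply, front_apply,
          countBelow_initial (by omega)]
        change _ = (t : ℕ)
        omega
      rw [hs, one_smul, F.map_map, e1, e2, F.map_id]
    · rintro ⟨p', l'⟩ hx hne
      have h' : p' + l' = N := Finset.HasAntidiagonal.mem_antidiagonal.1 hx
      refine hterm _ p' l' h' fun e => hne ?_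
      have := congrArg Finset.card e
      rw [hcard p (by omega), hcard p' (by omega)] at this
      ext <;> simp <;> omega
    · exact fun hx => absurd (Finset.HasAntidiagonal.mem_antidiagonal.2 h) hx
  · intro S hS
    split
    case isTrue hc =>
      rw [aw, map_sum, Finset.sum_eq_zero, smul_zero]
      rintro ⟨p', l'⟩ hx
      have h' : p' + l' = N := Finset.HasAntidiagonal.mem_antidiagonal.1 hx
      refine hterm _ p' l' h' fun e => hS ?_
      have := congrArg Finset.card e
      rw [hcard p' (by omega)] at this
      rw [e, ← hc, this]
    case isFalse => rfl

end BiCos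

/-! ### Normalization of cosimplicial groups -/

namespace Cos

/-- The projector to the normalized subgroup along the sums of images of cofaces other than the last
one. -/
def normalize (n : ℕ) (X : Cos.{u}) : X.G n →+ X.G n :=
  match n with
  | 0 => AddMonoidHom.id _
  | n + 1 => (AddMonoidHom.id _ - (X.map (SimplexCategory.δ 0)).comp
      (X.map (SimplexCategory.σ 0))).comp (normalize n X.shift)

theorem normalize_succ (n : ℕ) (X : Cos.{u}) (z : X.G (n + 1)) :
    X.normalize (n + 1) z = (X.shift.normalize n z : X.G (n + 1)) -
      X.map (SimplexCategory.δ 0) (X.map (SimplexCategory.σ 0) (X.shift.normalize n z)) := rfl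

theorem normalize_natural (n : ℕ) {X Y : Cos.{u}} (φ : ∀ i, X.G i →+ Y.G i)
    (hφ : ∀ {i j : ℕ} (a : ⦋i⦌ ⟶ ⦋j⦌) (z : X.G i), φ j (X.map a z) = Y.map a (φ i z))
    (z : X.G n) : φ n (X.normalize n z) = Y.normalize n (φ n z) := by
  induction n generalizing X Y with
  | zero => rfl
  | succ n ih =>
    have h : φ (n + 1) (X.shift.normalize n z) = Y.shift.normalize n (φ (n + 1) z) :=
      ih (X := X.shift) (Y := Y.shift) (fun i => φ (i + 1)) (fun a z => hφ (joinMap a) z) z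
    rw [normalize_succ, normalize_succ, map_sub, hφ, hφ, h]

theorem shift_normalize_map_δ_zero (n : ℕ) (X : Cos.{u}) (z : X.G n) :
    X.shift.normalize n (X.map (SimplexCategory.δ 0) z) =
      X.map (SimplexCategory.δ 0) (X.normalize n z) :=
  (normalize_natural n (X := X) (Y := X.shift)
    (fun i => X.map (SimplexCategory.δ (0 : Fin (i + 2)))) (fun a z =>
      (X.map_map _ _ _).trans ((congrArg (fun b => X.map b z) (comp_δ_zero a)).trans
        (X.map_map _ _ _).symm)) z).symm

theorem normal_normalize (n : ℕ) (X : Cos.{u}) (z : X.G n) : X.Normal (X.normalize n z) := by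
  induction n generalizing X with
  | zero => trivial
  | succ n ih =>
    have hs : ∀ y : X.G (n + 1), X.map (SimplexCategory.σ 0) (X.map (SimplexCategory.δ 0)
        (X.map (SimplexCategory.σ 0) y)) = X.map (SimplexCategory.σ 0) y := fun y => by
      have := SimplexCategory.δ_comp_σ_self (n := n) (i := 0)
      simp only [Fin.castSucc_zero] at this
      rw [X.map_map _ (SimplexCategory.σ 0), this, X.map_id]
    intro i
    rw [normalize_succ, map_sub]
    induction i using Fin.cases with
    | zero => rw [hs, sub_self]
    | succ i =>
      cases n with
      | zero => exact i.elim0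
      | succ n =>
        have h : X.map (SimplexCategory.σ i.succ) (X.shift.normalize (n + 1) z) = 0 := by
          rw [← joinMap_σ]
          exact ih X.shift z i
        have e : SimplexCategory.σ 0 ≫ SimplexCategory.δ 0 ≫ SimplexCategory.σ i.succ =
            SimplexCategory.σ i.succ ≫ SimplexCategory.σ 0 ≫ SimplexCategory.δ 0 := by
          rw [← joinMap_σ, ← comp_δ_zero, ← Category.assoc, ← joinMap_σ_comp_σ_zero,
            Category.assoc]
        rw [h, X.map_map, X.map_map, e, ← X.map_map, h, map_zero, sub_zero]

/-- The codegeneracy at zero is a contraction of the decalage, up to the coboundary. -/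
theorem map_σ_shift_d (n : ℕ) (X : Cos.{u}) (z : X.G (n + 1)) :
    X.map (SimplexCategory.σ 0) (X.shift.d n z) =
      z + X.d n (X.map (SimplexCategory.σ 0) z) -
        X.map (SimplexCategory.δ 0) (X.map (SimplexCategory.σ 0) z) := by
  rw [d_apply, d_apply]
  conv_lhs => rw [Fin.sum_univ_succ]
  conv_rhs => rw [Fin.sum_univ_succ]
  have e0 : X.map (SimplexCategory.σ 0) (X.shift.map (SimplexCategory.δ 0) z) = z := by
    refine (X.map_map _ _ _).trans ?_
    rw [joinMap_δ_zero_comp_σ_zero, X.map_id]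
  have e1 (i : Fin (n + 1)) : X.map (SimplexCategory.σ 0)
      (X.shift.map (SimplexCategory.δ i.succ) z) =
      X.map (SimplexCategory.δ i.succ) (X.map (SimplexCategory.σ 0) z) := by
    refine (X.map_map _ _ _).trans (Eq.trans ?_ (X.map_map _ _ _).symm)
    rw [joinMap_comp_σ_zero_δ]
  refine (map_add (X.map (SimplexCategory.σ 0)) _ _).trans ?_
  rw [map_sum, map_zsmul, e0]
  simp only [map_zsmul, e1, Fin.val_zero, pow_zero, one_smul]
  abel

theorem normalize_d (n : ℕ) (X : Cos.{u}) (z : X.G n) :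
    X.normalize (n + 1) (X.d n z) = X.d n (X.normalize n z) := by
  induction n generalizing X with
  | zero =>
    have h : X.map (SimplexCategory.σ 0) (X.d 0 z) = 0 :=
      Normal.d (X := X) (z := z) trivial 0
    change X.d 0 z - X.map (SimplexCategory.δ 0) (X.map (SimplexCategory.σ 0) (X.d 0 z)) = _
    rw [h, map_zero, sub_zero]
    rfl
  | succ n ih =>
    have h : (X.shift.normalize (n + 1) (X.d (n + 1) z) : X.G (n + 2)) =
        X.map (SimplexCategory.δ 0) (X.normalize (n + 1) z) -
          X.shift.d n (X.shift.normalize n z) := by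
      rw [d_eq_sub_shift]
      exact (map_sub (X.shift.normalize (n + 1)) _ _).trans (congrArg₂ _
        (shift_normalize_map_δ_zero (n + 1) X z) (ih X.shift z))
    have hs : ∀ y : X.G (n + 1), X.map (SimplexCategory.σ 0)
        (X.map (SimplexCategory.δ (0 : Fin (n + 3))) y) = y := fun y => by
      have := SimplexCategory.δ_comp_σ_self (n := n + 1) (i := 0)
      simp only [Fin.castSucc_zero] at this
      rw [X.map_map, this, X.map_id]
    have hd : X.shift.d n (X.map (SimplexCategory.δ 0) (X.map (SimplexCategory.σ 0)
        (X.shift.normalize n z))) = X.map (SimplexCategory.δ 0) (X.d n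
          (X.map (SimplexCategory.σ 0) (X.shift.normalize n z))) :=
      X.shift_d_map_δ_zero n _
    have hd' : X.shift.d n (X.normalize (n + 1) z) = X.shift.d n (X.shift.normalize n z) -
        X.map (SimplexCategory.δ 0) (X.d n
          (X.map (SimplexCategory.σ 0) (X.shift.normalize n z))) := by
      rw [normalize_succ]
      exact (map_sub (X.shift.d n) _ _).trans (congrArg _ hd)
    rw [normalize_succ, h, d_eq_sub_shift, hd', map_sub (X.map (SimplexCategory.σ 0)), hs,
      map_σ_shift_d, map_sub (X.map (SimplexCategory.δ 0)), map_sub (X.map (SimplexCategory.δ 0)),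
      map_add (X.map (SimplexCategory.δ 0)), normalize_succ]
    rw [map_sub (X.map (SimplexCategory.δ 0))]
    abel

/-- A cosimplicial group as a bicosimplicial group with the given diagonal, constant in the second
direction. By way of it, natural endomorphisms of diagonals apply to single cosimplicial groups. -/
abbrev const (X : Cos.{u}) : BiCos.{u} where
  G i _ := X.G i
  map a _ := X.map a
  map_id i _ z := X.map_id i z
  map_map a a' _ _ z := X.map_map a a' z

end Cos

/-- The normalization projector, as an endomorphism of diagonals. -/
def normalizeEndo : DiagEndo.{u} where
  app F m := F.diag.normalize m
  natural {F F'} φ m z := Cos.normalize_natural m (X := F.diag) (Y := F'.diag)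
    (fun i => φ.app i i) (fun a z => φ.natural a a z) z
  comm F m z := F.diag.normalize_d m z
  zero _ _ := rfl
  normal F m z _ := F.diag.normal_normalize m z

namespace BiCos

variable {F : BiCos.{u}}

/-- Normalization in the first direction. -/
def normTot (F : BiCos.{u}) (y : ∀ p l, F.G l p) (p l : ℕ) : F.G l p :=
  (F.hor p).normalize l (y p l)

/-- The homotopy in the total complex between the identity and the normalization. -/
def htpyTot (F : BiCos.{u}) (y : ∀ p l, F.G l p) (p l : ℕ) : F.G l p :=
  (-1 : ℤ) ^ p • normalizeEndo.htpy l (F.hor p).const (y p (l + 1))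

/-- Naturality of the homotopy in the row, which may change: it applies to all maps between rows that are
compatible with the operators in the first direction. -/
theorem htpy_hor_natural {F' : BiCos.{u}} {p p' l : ℕ} (φ : ∀ i, F.G i p →+ F'.G i p')
    (hφ : ∀ {i j : ℕ} (a : ⦋i⦌ ⟶ ⦋j⦌) (z : F.G i p), φ j (F.map a (𝟙 _) z) = F'.map a (𝟙 _) (φ i z))
    (z : F.G (l + 1) p) : φ l (normalizeEndo.htpy l (F.hor p).const z) =
      normalizeEndo.htpy l (F'.hor p').const (φ (l + 1) z) :=
  normalizeEndo.htpy_natural l (F := (F.hor p).const) (F' := (F'.hor p').const)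
    ⟨fun i _ => φ i, fun a _ z => hφ a z⟩ z

theorem map_comm {i i' j j' : ℕ} (a : ⦋i⦌ ⟶ ⦋i'⦌) (b : ⦋j⦌ ⟶ ⦋j'⦌) (z : F.G i j) :
    F.map (𝟙 _) b (F.map a (𝟙 _) z) = F.map a (𝟙 _) (F.map (𝟙 _) b z) := by
  rw [F.map_map, F.map_map, Category.comp_id, Category.comp_id, Category.id_comp, Category.id_comp]

theorem vert_d_natural {i i' p : ℕ} (φ : ∀ j, F.G i j →+ F.G i' j)
    (hφ : ∀ {j j' : ℕ} (b : ⦋j⦌ ⟶ ⦋j'⦌) (z : F.G i j), φ j' (F.map (𝟙 _) b z) = F.map (𝟙 _) b (φ j z))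
    (z : F.G i p) : φ (p + 1) ((F.vert i).d p z) = (F.vert i').d p (φ p z) :=
  Cos.map_d (F.vert i) (Y := F.vert i') φ hφ p z

theorem d_hor_d_vert (p l : ℕ) (z : F.G l p) :
    (F.hor (p + 1)).d l ((F.vert l).d p z) = (F.vert (l + 1)).d p ((F.hor p).d l z) := by
  refine vert_d_natural (fun j => (F.hor j).d l) (fun b z => ?_) z
  exact (Cos.map_d (F.hor _) (Y := F.hor _) (fun i => F.map (𝟙 _) b)
    (fun a z => map_comm a b z) l z).symm

theorem totD_totD (y : ∀ p l, F.G l p) : F.totD (F.totD y) = 0 := by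
  funext p l
  change F.totD (F.totD y) p l = 0
  have hv : F.vertD (F.vertD y) p l = 0 := by
    rcases p with _ | _ | p
    · rfl
    · exact map_zero _
    · exact (F.vert l).d_d p _
  have hh : F.horD (F.horD y) p l = 0 := by
    rcases l with _ | _ | l
    · rfl
    · exact map_zero _
    · exact (F.hor p).d_d l _
  have e : F.totD (F.totD y) p l = F.vertD (F.vertD y) p l +
      F.vertD (fun p l => (-1 : ℤ) ^ p • F.horD y p l) p l +
      ((-1 : ℤ) ^ p • F.horD (F.vertD y) p l + F.horD (F.horD y) p l) := by
    simp only [totD]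
    congr 1
    · rcases p with _ | p
      · simp [vertD]
      · exact map_add _ _ _
    · rcases l with _ | l
      · simp [horD]
      · have : F.horD (F.totD y) p (l + 1) = (F.hor p).d l (F.vertD y p l) +
            (-1 : ℤ) ^ p • (F.hor p).d l (F.horD y p l) := by
          rw [← map_zsmul, ← map_add]
          rfl
        rw [this, smul_add, smul_smul, ← mul_pow]
        simp [horD]
  rw [e, hv, hh, zero_add, add_zero]
  rcases p with _ | p
  · rcases l with _ | l
    · simp [vertD, horD]
    · simp [vertD, horD]
  · rcases l with _ | l
    · simp [vertD, horD]
    · simp only [vertD, horD]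
      rw [d_hor_d_vert, map_zsmul, pow_succ]
      simp

theorem totD_add (y y' : ∀ p l, F.G l p) :
    F.totD (fun p l => y p l + y' p l) = fun p l => F.totD y p l + F.totD y' p l := by
  funext p l
  simp only [totD]
  rcases p with _ | p <;> rcases l with _ | l <;> simp only [vertD, horD, map_add, smul_add] <;> abel_nf

theorem totD_zero : F.totD (fun _ _ => 0) = fun _ _ => 0 := by
  funext p l
  simp only [totD]
  rcases p with _ | p <;> rcases l with _ | l <;> simp [vertD, horD]

theorem normTot_totD (y : ∀ p l, F.G l p) :
    F.totD (F.normTot y) = F.normTot (F.totD y) := by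
  funext p l
  simp only [normTot, totD, map_add, map_zsmul]
  congr 1
  · rcases p with _ | p
    · simp [vertD]
    · refine (vert_d_natural (fun j => (F.hor j).normalize l) (fun b z => ?_) _).symm
      exact (Cos.normalize_natural l (X := F.hor _) (Y := F.hor _) (fun i => F.map (𝟙 _) b)
        (fun a z => map_comm a b z) z).symm
  · congr 1
    rcases l with _ | l
    · simp [horD]
    · exact (Cos.normalize_d l (F.hor p) _).symm

/-- The normalization in the first direction is homotopic to the identity of the total complex. The
homotopy commutes with the differential in the second direction by naturality, so that this one cancels
by the sign. -/
theorem htpyTot_totD (y : ∀ p l, F.G l p) (p l : ℕ) :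
    F.totD (F.htpyTot y) p l + F.htpyTot (F.totD y) p l = F.normTot y p l - y p l := by
  have hv : F.vertD (F.htpyTot y) p l + (-1 : ℤ) ^ p • normalizeEndo.htpy l (F.hor p).const
      (F.vertD y p (l + 1)) = 0 := by
    rcases p with _ | p
    · simp only [vertD, map_zero, smul_zero, add_zero]
    · simp only [vertD, htpyTot, map_zsmul]
      have : normalizeEndo.htpy l (F.hor (p + 1)).const ((F.vert (l + 1)).d p (y p (l + 1))) =
          (F.vert l).d p (normalizeEndo.htpy l (F.hor p).const (y p (l + 1))) := by
        rw [Cos.d_apply, Cos.d_apply]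
        refine (map_sum (normalizeEndo.htpy l (F.hor (p + 1)).const) _ _).trans ?_
        refine Finset.sum_congr rfl fun i _ => ?_
        refine (map_zsmul (normalizeEndo.htpy l (F.hor (p + 1)).const) _ _).trans
          (congrArg _ ?_)
        exact (htpy_hor_natural (fun i' => F.map (𝟙 _) (SimplexCategory.δ i))
          (fun a z => map_comm a _ z) _).symm
      rw [this, pow_succ]
      simp
  have hh : (-1 : ℤ) ^ p • F.horD (F.htpyTot y) p l + normalizeEndo.htpy l (F.hor p).const
      (F.horD y p (l + 1)) = F.normTot y p l - y p l := by
    rcases l with _ | l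
    · simp only [horD, smul_zero, zero_add, normTot]
      refine Eq.trans ?_ (sub_self _).symm
      rfl
    · simp only [horD, htpyTot, map_zsmul, normTot]
      rw [smul_smul, ← mul_pow]
      simp only [mul_neg, mul_one, neg_neg, one_pow, one_smul]
      exact (normalizeEndo.app_sub_self l (F.hor p).const (y p (l + 1))).symm
  have e : F.htpyTot (F.totD y) p l =
      (-1 : ℤ) ^ p • normalizeEndo.htpy l (F.hor p).const (F.vertD y p (l + 1)) +
      normalizeEndo.htpy l (F.hor p).const (F.horD y p (l + 1)) := by
    refine (congrArg ((-1 : ℤ) ^ p • ·) ((map_add (normalizeEndo.htpy l (F.hor p).const) _ _).trans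
      (congrArg _ (map_zsmul (normalizeEndo.htpy l (F.hor p).const) _ _)))).trans ?_
    simp only [smul_add, smul_smul, ← mul_pow]
    simp
  rw [e, ← hh, totD]
  rw [← sub_eq_zero] at hv ⊢
  rw [← hv]
  abel

end BiCos

/-! ### Cocycles of the diagonal and of the total complex -/

namespace BiCos

variable {F F' : BiCos.{u}}

theorem shuffle_eq_zero (N : ℕ) (F : BiCos.{u}) {p l : ℕ} (h : p + l ≠ N) (z : F.G N N) :
    F.shuffle N p l z = 0 := by
  induction N generalizing F p l with
  | zero =>
    rcases p with _ | p
    · rcases l with _ | l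
      · exact absurd rfl h
      · rfl
    · rfl
  | succ N ih =>
    rw [shuffle_succ]
    have h1 : F.stepVert (fun p l => F.shift.shuffle N p l z) p l = 0 := by
      rcases p with _ | p
      · rfl
      · exact (congrArg (F.map _ _) (ih F.shift (by omega) z)).trans (map_zero _)
    have h2 : F.stepHor (fun p l => F.shift.shuffle N p l z) p l = 0 := by
      rcases l with _ | l
      · rfl
      · exact (congrArg (F.map _ _) (ih F.shift (by omega) z)).trans (map_zero _)
    rw [h1, h2, smul_zero, add_zero]

/-- The normalized cocycles of degree `N` of the diagonal. -/
structure IsDiagCocycle (F : BiCos.{u}) (N : ℕ) (z : F.G N N) : Prop where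
  normal : F.diag.Normal z
  cocycle : F.diag.d N z = 0

/-- The cocycles of degree `N` of the total complex that are normalized in the second direction. -/
structure IsTotCocycle (F : BiCos.{u}) (N : ℕ) (y : ∀ p l, F.G l p) : Prop where
  support : ∀ p l, p + l ≠ N → y p l = 0
  normal : ∀ p l, (F.vert l).Normal (y p l)
  cocycle : ∀ p l, F.totD y p l = 0

theorem Hom.normal_diag (φ : Hom F F') {N : ℕ} {z : F.G N N} (hz : F.diag.Normal z) :
    F'.diag.Normal (φ.app N N z) := by
  cases N with
  | zero => trivial
  | succ N => exact fun i => (φ.natural _ _ z).symm.trans ((congrArg _ (hz i)).trans (map_zero _))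

theorem Hom.normal_vert (φ : Hom F F') {p l : ℕ} {z : F.G l p} (hz : (F.vert l).Normal z) :
    (F'.vert l).Normal (φ.app l p z) := by
  cases p with
  | zero => trivial
  | succ N => exact fun i => (φ.natural _ _ z).symm.trans ((congrArg _ (hz i)).trans (map_zero _))

theorem Hom.totD (φ : Hom F F') (y : ∀ p l, F.G l p) (p l : ℕ) :
    φ.app l p (F.totD y p l) = F'.totD (fun p l => φ.app l p (y p l)) p l := by
  refine (map_add (φ.app l p) _ _).trans (congrArg₂ _ ?_ ((map_zsmul (φ.app l p) _ _).trans
    (congrArg _ ?_)))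
  · rcases p with _ | p
    · exact map_zero _
    · exact φ.vert_d l p _
  · rcases l with _ | l
    · exact map_zero _
    · exact φ.hor_d l p _

theorem IsDiagCocycle.map (φ : Hom F F') {N : ℕ} {z : F.G N N} (h : IsDiagCocycle F N z) :
    IsDiagCocycle F' N (φ.app N N z) where
  normal := φ.normal_diag h.normal
  cocycle := by rw [← φ.diag_d, h.cocycle, map_zero]

theorem IsTotCocycle.map (φ : Hom F F') {N : ℕ} {y : ∀ p l, F.G l p} (h : IsTotCocycle F N y) :
    IsTotCocycle F' N (fun p l => φ.app l p (y p l)) where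
  support p l hpl := by rw [h.support p l hpl, map_zero]
  normal p l := φ.normal_vert (h.normal p l)
  cocycle p l := by rw [← φ.totD, h.cocycle, map_zero]

theorem normal_vert_of_hom {p l l' : ℕ} (φ : ∀ p, F.G l p →+ F.G l' p)
    (hφ : ∀ {p p' : ℕ} (b : ⦋p⦌ ⟶ ⦋p'⦌) (z : F.G l p), φ p' (F.map (𝟙 _) b z) = F.map (𝟙 _) b (φ p z))
    {z : F.G l p} (hz : (F.vert l).Normal z) : (F.vert l').Normal (φ p z) := by
  cases p with
  | zero => trivial
  | succ p => exact fun i => (hφ _ z).symm.trans ((congrArg _ (hz i)).trans (map_zero _))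

theorem normal_normTot {p l : ℕ} {y : ∀ p l, F.G l p} (hy : (F.vert l).Normal (y p l)) :
    (F.vert l).Normal (F.normTot y p l) :=
  normal_vert_of_hom (fun p => (F.hor p).normalize l) (fun b z =>
    (Cos.normalize_natural l (X := F.hor _) (Y := F.hor _) (fun i => F.map (𝟙 _) b)
      (fun a z => map_comm a b z) z).symm) hy

theorem normal_htpyTot {p l : ℕ} {y : ∀ p l, F.G l p} (hy : (F.vert (l + 1)).Normal (y p (l + 1))) :
    (F.vert l).Normal (F.htpyTot y p l) :=
  Cos.Normal.zsmul (normal_vert_of_hom (fun p => normalizeEndo.htpy l (F.hor p).const)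
    (fun b z => (htpy_hor_natural (fun i' => F.map (𝟙 _) b) (fun a z => map_comm a _ z) z).symm)
    hy) _

theorem normal_totD {p l : ℕ} {y : ∀ p l, F.G l p} (hy : ∀ p l, (F.vert l).Normal (y p l)) :
    (F.vert l).Normal (F.totD y p l) := by
  refine Cos.Normal.add ?_ (Cos.Normal.zsmul ?_ _)
  · rcases p with _ | p
    · exact Cos.Normal.zero
    · exact (hy p l).d
  · rcases l with _ | l
    · exact Cos.Normal.zero
    · exact normal_vert_of_hom (fun p => (F.hor p).d l) (fun b z =>
        (Cos.map_d (F.hor _) (Y := F.hor _) (fun i => F.map (𝟙 _) b)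
          (fun a z => map_comm a b z) l z).symm) (hy p l)

theorem IsDiagCocycle.shuffle {N : ℕ} {z : F.G N N} (h : IsDiagCocycle F N z) :
    IsTotCocycle F N (fun p l => F.shuffle N p l z) where
  support p l hpl := shuffle_eq_zero N F hpl z
  normal p l := by
    by_cases hpl : p + l = N
    · exact shuffle_vert_normal hpl h.normal
    · rw [shuffle_eq_zero N F hpl]
      exact Cos.Normal.zero
  cocycle p l := by rw [← shuffle_d, h.cocycle, map_zero]

theorem normTot_zero : F.normTot (fun _ _ => 0) = fun _ _ => 0 :=
  funext fun p => funext fun l => map_zero _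

theorem aw_zero (N : ℕ) : F.aw N (fun _ _ => 0) = 0 :=
  Finset.sum_eq_zero fun _ _ => map_zero _

theorem aw_normTot_normal {N : ℕ} {y : ∀ p l, F.G l p} (h : ∀ p l, (F.vert l).Normal (y p l)) :
    F.diag.Normal (F.aw N (F.normTot y)) :=
  aw_normal (fun p l => normal_normTot (h p l)) fun p l => Cos.normal_normalize l (F.hor p) _

theorem IsTotCocycle.aw {N : ℕ} {y : ∀ p l, F.G l p} (h : IsTotCocycle F N y) :
    IsDiagCocycle F N (F.aw N (F.normTot y)) where
  normal := aw_normTot_normal h.normal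
  cocycle := by
    rw [← aw_totD, normTot_totD, show F.totD y = fun _ _ => 0 from
      funext fun p => funext fun l => h.cocycle p l, normTot_zero, aw_zero]

theorem shuffle_aw_normTot {N : ℕ} {y : ∀ p l, F.G l p} (h : IsTotCocycle F N y) (p l : ℕ) :
    F.shuffle N p l (F.aw N (F.normTot y)) = F.normTot y p l := by
  by_cases hpl : p + l = N
  · exact shuffle_aw hpl (fun p l => normal_normTot (h.normal p l))
      fun p l => Cos.normal_normalize l (F.hor p) _
  · rw [shuffle_eq_zero N F hpl, normTot, h.support p l hpl]
    exact (map_zero _).symm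

theorem normTot_natural (φ : Hom F F') (y : ∀ p l, F.G l p) (p l : ℕ) :
    φ.app l p (F.normTot y p l) = F'.normTot (fun p l => φ.app l p (y p l)) p l :=
  Cos.normalize_natural l (X := F.hor p) (Y := F'.hor p) (fun l => φ.app l p)
    (fun a z => φ.natural a _ z) _

theorem htpyTot_natural (φ : Hom F F') (y : ∀ p l, F.G l p) (p l : ℕ) :
    φ.app l p (F.htpyTot y p l) = F'.htpyTot (fun p l => φ.app l p (y p l)) p l :=
  (map_zsmul (φ.app l p) _ _).trans (congrArg _
    (htpy_hor_natural (fun l => φ.app l p) (fun a z => φ.natural a _ z) _))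

theorem aw_natural (φ : Hom F F') (N : ℕ) (y : ∀ p l, F.G l p) :
    φ.app N N (F.aw N y) = F'.aw N (fun p l => φ.app l p (y p l)) :=
  (map_sum (φ.app N N) _ _).trans (Finset.sum_congr rfl fun _ _ => φ.natural _ _ _)

theorem normTot_add (y y' : ∀ p l, F.G l p) :
    F.normTot (fun p l => y p l + y' p l) = fun p l => F.normTot y p l + F.normTot y' p l :=
  funext fun p => funext fun l => map_add _ _ _

theorem aw_add (N : ℕ) (y y' : ∀ p l, F.G l p) :
    F.aw N (fun p l => y p l + y' p l) = F.aw N y + F.aw N y' := by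
  rw [aw, aw, aw, ← Finset.sum_add_distrib]
  exact Finset.sum_congr rfl fun _ _ => map_add _ _ _

/-- The composite of the shuffle map with the normalized Alexander-Whitney map. -/
def awShuffle : DiagEndo.{u} where
  app F N :=
    { toFun := fun z => F.aw N (F.normTot fun p l => F.shuffle N p l z)
      map_zero' := by simp only [map_zero, normTot_zero, aw_zero]
      map_add' := fun z z' => by simp only [map_add, normTot_add, aw_add] }
  natural φ N z := by
    refine (aw_natural φ N _).trans ?_
    refine congrArg _ (funext fun p => funext fun l => (normTot_natural φ _ p l).trans ?_)
    exact congrArg (fun y => BiCos.normTot _ y p l)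
      (funext fun p => funext fun l => shuffle_natural N φ p l z)
  comm F N z := by
    refine Eq.trans ?_ (aw_totD F N _)
    rw [normTot_totD]
    exact congrArg (fun y => F.aw _ (F.normTot y))
      (funext fun p => funext fun l => shuffle_d N F p l z)
  zero F z := by
    change ∑ x ∈ Finset.HasAntidiagonal.antidiagonal 0, _ = _
    have e : ∀ a : ⦋0⦌ ⟶ ⦋0⦌, a = 𝟙 _ := by decide
    rw [Finset.Nat.antidiagonal_zero, Finset.sum_singleton, e (back _ _ _), e (front _ _), F.map_id]
    rfl
  normal F N z hz := by
    refine aw_normTot_normal fun p l => ?_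
    by_cases hpl : p + l = N
    · exact shuffle_vert_normal hpl hz
    · rw [shuffle_eq_zero N F hpl]
      exact Cos.Normal.zero

/-- Families of endomorphisms under which the kernels of all operators are stable. They need not commute
with the operators, but they preserve normalized elements. -/
structure Cut (F : BiCos.{u}) where
  app (i j : ℕ) : F.G i j →+ F.G i j
  map_eq_zero : ∀ {i i' j j' : ℕ} (a : ⦋i⦌ ⟶ ⦋i'⦌) (b : ⦋j⦌ ⟶ ⦋j'⦌) (z : F.G i j),
    F.map a b z = 0 → F.map a b (app i j z) = 0

/-- The coboundary of the part of the contracting homotopy of `awShuffle` that is selected by `C`. Adding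
it to a cocycle gives the cocycle itself for the zero cut, and its image under `awShuffle` for the
identity. -/
def diagHtpy (C : F.Cut) (N : ℕ) (z : F.G N N) : F.G N N :=
  match N, z with
  | 0, _ => 0
  | m + 1, z => F.diag.d m (C.app m m (awShuffle.htpy m F z))

/-- The correction is a coboundary, whatever the cut. -/
theorem diagHtpy_isDiagCocycle (C : F.Cut) {N : ℕ} {z : F.G N N} (h : IsDiagCocycle F N z) :
    IsDiagCocycle F N (z + diagHtpy C N z) := by
  cases N with
  | zero =>
    change IsDiagCocycle F 0 (z + 0)
    rwa [add_zero]
  | succ m =>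
    refine ⟨h.normal.add (Cos.Normal.d ?_), ?_⟩
    · have := awShuffle.htpy_normal m F z h.normal
      revert this
      generalize awShuffle.htpy m F z = w
      intro hw
      cases m with
      | zero => trivial
      | succ m => exact fun i => C.map_eq_zero _ _ _ (hw i)
    · rw [map_add, h.cocycle, zero_add]
      exact F.diag.d_d m _

theorem diagHtpy_of_zero {C : F.Cut} (hC : ∀ i j z, C.app i j z = 0) (N : ℕ) (z : F.G N N) :
    diagHtpy C N z = 0 := by
  cases N with
  | zero => rfl
  | succ m =>
    change F.diag.d m (C.app m m _) = 0
    rw [hC, map_zero]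

theorem diagHtpy_of_id {C : F.Cut} (hC : ∀ i j z, C.app i j z = z) {N : ℕ} {z : F.G N N}
    (h : IsDiagCocycle F N z) : z + diagHtpy C N z = awShuffle.app F N z := by
  cases N with
  | zero => exact (add_zero z).trans (awShuffle.zero F z).symm
  | succ m =>
    have e := awShuffle.app_sub_self m F z
    rw [h.cocycle, map_zero, add_zero] at e
    change z + F.diag.d m (C.app m m _) = _
    rw [hC, ← e]
    abel

theorem diagHtpy_natural (φ : Hom F F') {C : F.Cut} {C' : F'.Cut}
    (hC : ∀ i j z, φ.app i j (C.app i j z) = C'.app i j (φ.app i j z)) (N : ℕ) (z : F.G N N) :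
    φ.app N N (diagHtpy C N z) = diagHtpy C' N (φ.app N N z) := by
  cases N with
  | zero => exact map_zero _
  | succ m =>
    refine (φ.diag_d m _).trans (congrArg _ ?_)
    rw [hC, awShuffle.htpy_natural]

theorem totHtpy_isTotCocycle (C : F.Cut) {N : ℕ} {y : ∀ p l, F.G l p} (h : IsTotCocycle F N y) :
    IsTotCocycle F N (fun p l => y p l +
      F.totD (fun p l => C.app l p (F.htpyTot y p l)) p l) where
  support p l hpl := by
    have hz : ∀ p l, p + l + 1 ≠ N → C.app l p (F.htpyTot y p l) = 0 := fun p l hpl => by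
      rw [htpyTot, h.support p (l + 1) (by omega)]
      refine (congrArg _ (congrArg ((-1 : ℤ) ^ p • ·) (map_zero _))).trans ?_
      exact (congrArg _ (smul_zero _)).trans (map_zero _)
    rw [h.support p l hpl, zero_add]
    simp only [totD]
    rcases p with _ | p <;> rcases l with _ | l <;> simp only [vertD, horD, smul_zero, add_zero]
    · rw [hz 0 l (by omega), map_zero, smul_zero, add_zero]
    · rw [hz p 0 (by omega), map_zero]
    · rw [hz p (l + 1) (by omega), hz (p + 1) l (by omega), map_zero, map_zero, smul_zero, add_zero]
  normal p l := by
    refine (h.normal p l).add (normal_totD fun p l => ?_)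
    have := normal_htpyTot (h.normal p (l + 1))
    revert this
    generalize F.htpyTot y p l = w
    intro hw
    cases p with
    | zero => trivial
    | succ m => exact fun i => C.map_eq_zero _ _ _ (hw i)
  cocycle p l := by
    rw [totD_add]
    change F.totD y p l + F.totD (F.totD _) p l = 0
    rw [h.cocycle, zero_add, totD_totD]
    rfl

theorem totHtpy_of_zero {C : F.Cut} (hC : ∀ i j z, C.app i j z = 0) (y : ∀ p l, F.G l p)
    (p l : ℕ) : F.totD (fun p l => C.app l p (F.htpyTot y p l)) p l = 0 := by
  simp only [hC]
  rw [totD_zero]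

theorem totHtpy_of_id {C : F.Cut} (hC : ∀ i j z, C.app i j z = z) {N : ℕ}
    {y : ∀ p l, F.G l p} (h : IsTotCocycle F N y) (p l : ℕ) :
    y p l + F.totD (fun p l => C.app l p (F.htpyTot y p l)) p l = F.normTot y p l := by
  have e := F.htpyTot_totD y p l
  have h0 : F.htpyTot (F.totD y) p l = 0 := by
    rw [htpyTot, h.cocycle]
    exact (congrArg ((-1 : ℤ) ^ p • ·) (map_zero _)).trans (smul_zero _)
  rw [h0, add_zero] at e
  simp only [hC]
  change y p l + F.totD (F.htpyTot y) p l = _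
  rw [e]
  abel

theorem totHtpy_natural (φ : Hom F F') {C : F.Cut} {C' : F'.Cut}
    (hC : ∀ i j z, φ.app i j (C.app i j z) = C'.app i j (φ.app i j z)) (y : ∀ p l, F.G l p)
    (p l : ℕ) : φ.app l p (F.totD (fun p l => C.app l p (F.htpyTot y p l)) p l) =
      F'.totD (fun p l => C'.app l p (F'.htpyTot (fun p l => φ.app l p (y p l)) p l)) p l := by
  rw [φ.totD]
  refine congrArg (fun y => F'.totD y p l) (funext fun p => funext fun l => ?_)
  rw [hC, htpyTot_natural]

end BiCos

/-! ### Simplicial homotopies between the Eilenberg-Zilber and Alexander-Whitney maps -/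

section Homotopies

open SSet CartesianMonoidalCategory

/-- A homotopy, given by maps on simplices that are indexed by the simplices `τ` of the interval. -/
theorem homotopy_of_family {X Y : SSet.{w}} {f g : X ⟶ Y}
    (h : ∀ n : SimplexCategory, (n ⟶ ⦋1⦌) → X.obj (op n) → Y.obj (op n))
    (nat : ∀ {m n : SimplexCategory} (θ : m ⟶ n) (τ : n ⟶ ⦋1⦌) (x : X.obj (op n)),
      h m (θ ≫ τ) (X.map θ.op x) = Y.map θ.op (h n τ x))
    (h₀ : ∀ (n : SimplexCategory) (τ : n ⟶ ⦋1⦌) (x : X.obj (op n)),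
      (∀ t, τ.toOrderHom t = 0) → h n τ x = f.app (op n) x)
    (h₁ : ∀ (n : SimplexCategory) (τ : n ⟶ ⦋1⦌) (x : X.obj (op n)),
      (∀ t, τ.toOrderHom t = 1) → h n τ x = g.app (op n) x) :
    Nonempty (SSet.Homotopy f g) := by
  let H : X ⊗ Δ[1] ⟶ Y :=
    { app := fun n => TypeCat.ofHom fun x => h n.unop (stdSimplex.objEquiv x.2) x.1
      naturality := fun n m θ => by
        refine ConcreteCategory.hom_ext _ _ fun x => ?_
        exact nat θ.unop (stdSimplex.objEquiv x.2) x.1 }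
  refine ⟨homotopyMk H ?_ ?_⟩
  · ext n x
    refine h₀ n.unop _ x fun t => rfl
  · ext n x
    refine h₁ n.unop _ x fun t => rfl

end Homotopies

/-- The bicosimplicial group of chains on the simplex `n` with coefficients in `A`. -/
abbrev chains (A : Cos.{u}) (n : SimplexCategory) : BiCos.{u} where
  G i j := (⦋j⦌ ⟶ n) → A.G i
  map a b :=
    { toFun := fun z β => A.map a (z (b ≫ β))
      map_zero' := funext fun _ => map_zero _
      map_add' := fun _ _ => funext fun _ => map_add _ _ _ }
  map_id i _ z := funext fun β => (A.map_id i _).trans (congrArg z (Category.id_comp β))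
  map_map a a' b b' z := funext fun β => (A.map_map a a' _).trans
    (congrArg (fun β => A.map (a ≫ a') (z β)) (Category.assoc b b' β).symm)

/-- Restriction of chains along a map of simplices. -/
def chainsMap (A : Cos.{u}) {m n : SimplexCategory} (θ : m ⟶ n) :
    BiCos.Hom (chains A n) (chains A m) where
  app _ _ :=
    { toFun := fun z β => z (β ≫ θ)
      map_zero' := rfl
      map_add' := fun _ _ => rfl }
  natural a b z := funext fun β => congrArg (fun β => A.map a (z β)) (Category.assoc b β θ).symm

/-- For a simplex `τ` of the interval, the projection to the chains on those simplices whose first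
vertex is sent to `ε`. -/
def chainsCut (A : Cos.{u}) {n : SimplexCategory} (τ : n ⟶ ⦋1⦌) (ε : Fin 2) :
    (chains A n).Cut where
  app i j :=
    { toFun := fun z β => if (β ≫ τ).toOrderHom (0 : Fin (j + 1)) = ε then z β else 0
      map_zero' := funext fun _ => ite_self (0 : A.G i)
      map_add' := fun z z' => funext fun β => by
        change (if (β ≫ τ).toOrderHom (0 : Fin (j + 1)) = ε then z β + z' β else 0) =
          (if _ then z β else 0) + (if _ then z' β else 0)
        split
        · rfl
        · rw [add_zero] }
  map_eq_zero a b z hz := funext fun β => by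
    change A.map a (if _ then z (b ≫ β) else 0) = 0
    split
    · exact congrFun hz β
    · exact map_zero _

theorem chainsCut_natural (A : Cos.{u}) {m n : SimplexCategory} (θ : m ⟶ n) (τ : n ⟶ ⦋1⦌)
    (ε : Fin 2) (i j : ℕ) (z : (chains A n).G i j) :
    (chainsMap A θ).app i j ((chainsCut A τ ε).app i j z) =
      (chainsCut A (θ ≫ τ) ε).app i j ((chainsMap A θ).app i j z) := rfl

theorem chainsCut_of_eq (A : Cos.{u}) {n : SimplexCategory} {τ : n ⟶ ⦋1⦌} {ε : Fin 2}
    (hτ : ∀ t, τ.toOrderHom t = ε) (i j : ℕ) (z : (chains A n).G i j) :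
    (chainsCut A τ ε).app i j z = z := funext fun _ => if_pos (hτ _)

theorem chainsCut_of_ne (A : Cos.{u}) {n : SimplexCategory} {τ : n ⟶ ⦋1⦌} {ε : Fin 2}
    (hτ : ∀ t, τ.toOrderHom t ≠ ε) (i j : ℕ) (z : (chains A n).G i j) :
    (chainsCut A τ ε).app i j z = 0 := funext fun _ => if_neg (hτ _)

section Cocycles

theorem ulift_subtype_ext {α : Type u} {P : α → Prop} {x y : ULift.{w} {a : α // P a}}
    (h : x.down.1 = y.down.1) : x = y := ULift.ext _ _ (Subtype.ext h)

variable {J : Type} (A : J → Cos.{u}) (N : J → ℕ)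

/-- The simplicial set of families of normalized cocycles in the diagonals of the groups of
chains. -/
def diagCocycles : SSet.{u + 1} where
  obj n := ULift.{u + 1} {z : ∀ j, (chains (A j) n.unop).G (N j) (N j) //
    ∀ j, (chains (A j) n.unop).IsDiagCocycle (N j) (z j)}
  map θ := TypeCat.ofHom fun z => ⟨⟨fun j => (chainsMap (A j) θ.unop).app _ _ (z.down.1 j),
    fun j => (z.down.2 j).map _⟩⟩
  map_id n := by
    refine ConcreteCategory.hom_ext _ _ fun z => ?_
    refine ulift_subtype_ext (funext fun j => ?_)
    exact funext fun β => congrArg (z.down.1 j) (Category.comp_id β)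
  map_comp θ θ' := by
    refine ConcreteCategory.hom_ext _ _ fun z => ?_
    refine ulift_subtype_ext (funext fun j => ?_)
    exact funext fun β => congrArg (z.down.1 j) (Category.assoc β _ _).symm

/-- The simplicial set of families of cocycles in the total complexes of the groups of chains. -/
def totCocycles : SSet.{u + 1} where
  obj n := ULift.{u + 1} {y : ∀ j p l, (chains (A j) n.unop).G l p //
    ∀ j, (chains (A j) n.unop).IsTotCocycle (N j) (y j)}
  map θ := TypeCat.ofHom fun y => ⟨⟨fun j p l => (chainsMap (A j) θ.unop).app _ _ (y.down.1 j p l),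
    fun j => (y.down.2 j).map _⟩⟩
  map_id n := by
    refine ConcreteCategory.hom_ext _ _ fun y => ?_
    refine ulift_subtype_ext (funext fun j => funext fun p => funext fun l => ?_)
    exact funext fun β => congrArg (y.down.1 j p l) (Category.comp_id β)
  map_comp θ θ' := by
    refine ConcreteCategory.hom_ext _ _ fun y => ?_
    refine ulift_subtype_ext (funext fun j => funext fun p => funext fun l => ?_)
    exact funext fun β => congrArg (y.down.1 j p l) (Category.assoc β _ _).symm

/-- The Eilenberg-Zilber map on cocycles. -/
def shuffleCocycles : diagCocycles A N ⟶ totCocycles A N where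
  app n := TypeCat.ofHom fun z => ⟨⟨fun j p l => (chains (A j) n.unop).shuffle (N j) p l (z.down.1 j),
    fun j => (z.down.2 j).shuffle⟩⟩
  naturality n m θ := by
    refine ConcreteCategory.hom_ext _ _ fun z => ?_
    refine ulift_subtype_ext (funext fun j => funext fun p => funext fun l => ?_)
    exact (BiCos.shuffle_natural (N j) (chainsMap (A j) θ.unop) p l _).symm

/-- The normalized Alexander-Whitney map on cocycles. -/
def awCocycles : totCocycles A N ⟶ diagCocycles A N where
  app n := TypeCat.ofHom fun y => ⟨⟨fun j => (chains (A j) n.unop).aw (N j)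
    ((chains (A j) n.unop).normTot (y.down.1 j)), fun j => (y.down.2 j).aw⟩⟩
  naturality n m θ := by
    refine ConcreteCategory.hom_ext _ _ fun y => ?_
    refine ulift_subtype_ext (funext fun j => ?_)
    refine Eq.symm ((BiCos.aw_natural (chainsMap (A j) θ.unop) (N j) _).trans (congrArg _ ?_))
    exact funext fun p => funext fun l => BiCos.normTot_natural _ _ p l

/-- On a simplex `τ` of the interval the homotopy adds to a cocycle the coboundary of that part of the
contracting homotopy of `awShuffle` which lives on the simplices that begin over the vertex `0`. -/
theorem shuffle_aw_homotopy :
    Nonempty (SSet.Homotopy (shuffleCocycles A N ≫ awCocycles A N) (𝟙 (diagCocycles A N))) := by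
  refine homotopy_of_family (fun n τ z => ⟨⟨fun j => z.down.1 j +
    BiCos.diagHtpy (chainsCut (A j) τ 0) (N j) (z.down.1 j),
    fun j => BiCos.diagHtpy_isDiagCocycle _ (z.down.2 j)⟩⟩) (fun θ τ z => ?_) ?_ ?_
  · refine ulift_subtype_ext (funext fun j => ?_)
    refine Eq.symm ((map_add ((chainsMap (A j) θ).app _ _) _ _).trans (congrArg _ ?_))
    exact BiCos.diagHtpy_natural (chainsMap (A j) θ) (chainsCut_natural (A j) θ τ 0) (N j) _
  · intro n τ z ht
    refine ulift_subtype_ext (funext fun j => ?_)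
    exact BiCos.diagHtpy_of_id (chainsCut_of_eq (A j) ht) (z.down.2 j)
  · intro n τ z ht
    refine ulift_subtype_ext (funext fun j => ?_)
    have h (t : Fin (n.len + 1)) : τ.toOrderHom t ≠ 0 := by
      rw [ht]
      exact one_ne_zero
    exact (congrArg _ (BiCos.diagHtpy_of_zero (chainsCut_of_ne (A j) h) _ _)).trans (add_zero _)

/-- The analogous homotopy on the total complex, with the homotopy from the identity to the
normalization in place of the one for `awShuffle`. As homotopy need not be symmetric, it is stated in
both directions: the cut is made at the vertex `ε` of the interval, which becomes the end of the
homotopy where the composite map is. -/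
theorem aw_shuffle_homotopy (ε : Fin 2) (f g : totCocycles A N ⟶ totCocycles A N)
    (hf : f = if ε = 1 then 𝟙 _ else awCocycles A N ≫ shuffleCocycles A N)
    (hg : g = if ε = 1 then awCocycles A N ≫ shuffleCocycles A N else 𝟙 _) :
    Nonempty (SSet.Homotopy f g) := by
  let c {n : SimplexCategory} (τ : n ⟶ ⦋1⦌) (y : (totCocycles A N).obj (op n)) (j : J) (p l : ℕ) :
      (chains (A j) n).G l p := y.down.1 j p l + (chains (A j) n).totD (fun p l =>
        (chainsCut (A j) τ ε).app l p ((chains (A j) n).htpyTot (y.down.1 j) p l)) p l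
  have hE : ∀ (n : SimplexCategory) (τ : n ⟶ ⦋1⦌) (y : (totCocycles A N).obj (op n)) (j : J)
      (p l : ℕ), (∀ t, τ.toOrderHom t = ε) →
        c τ y j p l = (((awCocycles A N ≫ shuffleCocycles A N).app (op n) y).down.1 j p l) :=
    fun n τ y j p l ht => (BiCos.totHtpy_of_id (chainsCut_of_eq (A j) ht) (y.down.2 j) p l).trans
      (BiCos.shuffle_aw_normTot (y.down.2 j) p l).symm
  have h0 : ∀ (n : SimplexCategory) (τ : n ⟶ ⦋1⦌) (y : (totCocycles A N).obj (op n)) (j : J)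
      (p l : ℕ), (∀ t, τ.toOrderHom t ≠ ε) → c τ y j p l = y.down.1 j p l :=
    fun n τ y j p l ht => (congrArg _ (BiCos.totHtpy_of_zero (chainsCut_of_ne (A j) ht) _ p l)).trans
      (add_zero _)
  refine homotopy_of_family (fun n τ y => ⟨⟨c τ y,
    fun j => BiCos.totHtpy_isTotCocycle _ (y.down.2 j)⟩⟩) (fun θ τ y => ?_) ?_ ?_
  · refine ulift_subtype_ext (funext fun j => funext fun p => funext fun l => ?_)
    refine Eq.symm ((map_add ((chainsMap (A j) θ).app _ _) _ _).trans (congrArg _ ?_))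
    exact BiCos.totHtpy_natural (chainsMap (A j) θ) (chainsCut_natural (A j) θ τ ε) _ p l
  · intro n τ y ht
    refine ulift_subtype_ext (funext fun j => funext fun p => funext fun l => ?_)
    by_cases h : ε = 1
    · rw [hf, if_pos h]
      exact h0 n τ y j p l fun t => by rw [ht, h]; exact zero_ne_one
    · rw [hf, if_neg h]
      exact hE n τ y j p l fun t => by rw [ht]; exact (by omega : (0 : Fin 2) = ε)
  · intro n τ y ht
    refine ulift_subtype_ext (funext fun j => funext fun p => funext fun l => ?_)
    by_cases h : ε = 1
    · rw [hg, if_pos h]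
      exact hE n τ y j p l fun t => by rw [ht, h]
    · rw [hg, if_neg h]
      exact h0 n τ y j p l fun t => by rw [ht]; exact Ne.symm h

/-- The Eilenberg-Zilber theorem: the normalized Alexander-Whitney map is a homotopy inverse. -/
theorem isWeakEquivalence_shuffleCocycles : IsWeakEquivalence (shuffleCocycles A N) := by
  obtain ⟨H⟩ := shuffle_aw_homotopy A N
  obtain ⟨H₁⟩ := aw_shuffle_homotopy A N 1 (𝟙 _) (awCocycles A N ≫ shuffleCocycles A N) rfl rfl
  obtain ⟨H₂⟩ := aw_shuffle_homotopy A N 0 (awCocycles A N ≫ shuffleCocycles A N) (𝟙 _) rfl rfl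
  exact isWeakEquivalence_of_homotopyInverse _ _ H H₁ H₂

end Cocycles

/-! ### Totalization and its points -/

section Totalization

variable {B : SimplexCategory ⥤ ChainComplex AddCommGrpCat.{u} ℕ} {n : SimplexCategory}

/-- The value of a point of the totalization on the generator `(𝟙, β)`. -/
def totVal (x : (Tot.obj (B ⋙ DKu)).obj (op n)) (p : ℕ) (β : ⦋p⦌ ⟶ n) : (B.obj ⦋p⦌).X p :=
  DKval (C := B.obj ⦋p⦌) ((x.1 ⦋p⦌).app (op ⦋p⦌) (SSet.stdSimplex.objEquiv.symm (𝟙 ⦋p⦌),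
    SSet.stdSimplex.objEquiv.symm β)).down (𝟙 ⦋p⦌)

/-- All the values of a point of the totalization are determined by those on the generators
`(𝟙, β)`. -/
theorem DKval_tot (x : (Tot.obj (B ⋙ DKu)).obj (op n)) {l m : SimplexCategory} (α : m ⟶ l)
    (β : m ⟶ n) {p : ℕ} (σ : ⦋p⦌ ⟶ m) :
    DKval (C := B.obj l) ((x.1 l).app (op m) (SSet.stdSimplex.objEquiv.symm α,
      SSet.stdSimplex.objEquiv.symm β)).down σ =
      ((B.map (σ ≫ α)).f p).hom (totVal x p (σ ≫ β)) := by
  have h1 := congrArg (fun y : ULift.{u + 1} ((DK.obj (B.obj l)).obj (op ⦋p⦌)) =>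
      DKval (C := B.obj l) y.down (𝟙 ⦋p⦌))
    (ConcreteCategory.congr_hom ((x.1 l).naturality σ.op)
      (show (SSet.stdSimplex.{u + 1}.obj l ⊗ SSet.stdSimplex.{u + 1}.obj n).obj (op m) from
        (SSet.stdSimplex.objEquiv.symm α, SSet.stdSimplex.objEquiv.symm β)))
  have h2 := DKval_map (C := B.obj l) ((x.1 l).app (op m) (SSet.stdSimplex.objEquiv.symm α,
      SSet.stdSimplex.objEquiv.symm β)).down σ (𝟙 ⦋p⦌)
  have h3 := congrArg (fun f => DKval (C := B.obj l) (ULift.down (f.app (op ⦋p⦌)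
    (SSet.stdSimplex.objEquiv.symm (𝟙 ⦋p⦌), SSet.stdSimplex.objEquiv.symm (σ ≫ β)))) (𝟙 ⦋p⦌))
    (x.2 (σ ≫ α))
  have h4 : (SSet.stdSimplex.{u + 1}.map (σ ≫ α) ▷ SSet.stdSimplex.obj n).app (op ⦋p⦌)
      (SSet.stdSimplex.objEquiv.symm (𝟙 ⦋p⦌), SSet.stdSimplex.objEquiv.symm (σ ≫ β)) =
      (SSet.stdSimplex.objEquiv.symm (σ ≫ α), SSet.stdSimplex.objEquiv.symm (σ ≫ β)) := by
    refine Prod.ext ?_ rfl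
    exact SSet.stdSimplex.objEquiv.injective (Category.id_comp (σ ≫ α))
  rw [Category.id_comp] at h2
  refine h2.symm.trans (h1.symm.trans (Eq.trans ?_ h3))
  exact (congrArg (fun y => DKval (C := B.obj l) (ULift.down ((x.1 l).app (op ⦋p⦌) y)) (𝟙 ⦋p⦌))
    h4).symm

theorem totVal_ext {x x' : (Tot.obj (B ⋙ DKu)).obj (op n)}
    (h : ∀ p β, totVal x p β = totVal x' p β) : x = x' := by
  refine Subtype.ext (funext fun l => ?_)
  ext m y
  refine ULift.ext _ _ (DKval_ext (C := B.obj l) fun p σ => ?_)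
  have h1 := DKval_tot x (SSet.stdSimplex.objEquiv y.1) (SSet.stdSimplex.objEquiv y.2) σ
  have h2 := DKval_tot x' (SSet.stdSimplex.objEquiv y.1) (SSet.stdSimplex.objEquiv y.2) σ
  rw [h] at h1
  exact h1.trans h2.symm

theorem totVal_degenerate (x : (Tot.obj (B ⋙ DKu)).obj (op n)) {p : ℕ} (i : Fin (p + 1))
    (β : ⦋p⦌ ⟶ n) : ((B.map (SimplexCategory.σ i)).f (p + 1)).hom
      (totVal x (p + 1) (SimplexCategory.σ i ≫ β)) = 0 := by
  have h := DKval_tot x (𝟙 ⦋p⦌) β (SimplexCategory.σ i)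
  rw [Category.comp_id] at h
  rw [← h]
  have := DKval_degenerate (C := B.obj ⦋p⦌) ((x.1 ⦋p⦌).app (op ⦋p⦌)
    (SSet.stdSimplex.objEquiv.symm (𝟙 ⦋p⦌), SSet.stdSimplex.objEquiv.symm β)).down i (𝟙 ⦋p⦌)
  rwa [Category.comp_id] at this

theorem totVal_d (x : (Tot.obj (B ⋙ DKu)).obj (op n)) {p : ℕ} (β : ⦋p + 1⦌ ⟶ n) :
    ((B.obj ⦋p + 1⦌).d (p + 1) p).hom (totVal x (p + 1) β) =
      ∑ i : Fin (p + 2), (-1 : ℤ) ^ (i : ℕ) • ((B.map (SimplexCategory.δ i)).f p).hom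
        (totVal x p (SimplexCategory.δ i ≫ β)) := by
  refine (DKval_d (C := B.obj ⦋p + 1⦌) _ _).trans (Finset.sum_congr rfl fun i _ => ?_)
  refine congrArg _ ?_
  rw [Category.comp_id]
  have h := DKval_tot x (𝟙 ⦋p + 1⦌) β (SimplexCategory.δ i)
  rw [Category.comp_id] at h
  exact h

/-- A point of the totalization from its values on the generators `(𝟙, β)`. -/
theorem exists_totVal (z : ∀ p : ℕ, (⦋p⦌ ⟶ n) → (B.obj ⦋p⦌).X p)
    (hdeg : ∀ (p : ℕ) (i : Fin (p + 1)) (β : ⦋p⦌ ⟶ n), ((B.map (SimplexCategory.σ i)).f (p + 1)).hom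
      (z (p + 1) (SimplexCategory.σ i ≫ β)) = 0)
    (hd : ∀ (p : ℕ) (β : ⦋p + 1⦌ ⟶ n), ((B.obj ⦋p + 1⦌).d (p + 1) p).hom (z (p + 1) β) =
      ∑ i : Fin (p + 2), (-1 : ℤ) ^ (i : ℕ) • ((B.map (SimplexCategory.δ i)).f p).hom
        (z p (SimplexCategory.δ i ≫ β))) :
    ∃ x : (Tot.obj (B ⋙ DKu)).obj (op n), ∀ p β, totVal x p β = z p β := by
  have hB : ∀ {l l' l'' : SimplexCategory} (a : l ⟶ l') (b : l' ⟶ l'') (p : ℕ)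
      (c : (B.obj l).X p), ((B.map (a ≫ b)).f p).hom c =
        ((B.map b).f p).hom (((B.map a).f p).hom c) := fun a b p c => by
    rw [B.map_comp]
    rfl
  have key : ∀ (l m : SimplexCategory) (α : m ⟶ l) (β : m ⟶ n),
      ∃ y : (DK.obj (B.obj l)).obj (op m), ∀ (p : ℕ) (σ : ⦋p⦌ ⟶ m),
        DKval y σ = ((B.map (σ ≫ α)).f p).hom (z p (σ ≫ β)) := by
    intro l m α β
    refine exists_DKval _ (fun p i σ => ?_) fun p σ => ?_
    · rw [Category.assoc, Category.assoc, hB, hdeg, map_zero]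
    · have h := ConcreteCategory.congr_hom ((B.map (σ ≫ α)).comm (p + 1) p) (z (p + 1) (σ ≫ β))
      refine h.trans ?_
      refine (congrArg ((B.map (σ ≫ α)).f p).hom (hd p (σ ≫ β))).trans ?_
      rw [map_sum]
      refine Finset.sum_congr rfl fun i _ => ?_
      rw [map_zsmul, Category.assoc, Category.assoc, hB (SimplexCategory.δ i) (σ ≫ α)]
  choose y hy using key
  let f (l : SimplexCategory) : SSet.stdSimplex.{u + 1}.obj l ⊗ SSet.stdSimplex.{u + 1}.obj n ⟶
      (B ⋙ DKu).obj l :=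
    { app := fun m => TypeCat.ofHom fun s => ULift.up (y l m.unop (SSet.stdSimplex.objEquiv s.1)
        (SSet.stdSimplex.objEquiv s.2))
      naturality := fun m m' θ => by
        refine ConcreteCategory.hom_ext _ _ fun s => ?_
        refine ULift.ext _ _ (DKval_ext (C := B.obj l) fun p σ => ?_)
        have h1 := hy l m'.unop (θ.unop ≫ SSet.stdSimplex.objEquiv s.1)
          (θ.unop ≫ SSet.stdSimplex.objEquiv s.2) p σ
        have h2 := hy l m.unop (SSet.stdSimplex.objEquiv s.1) (SSet.stdSimplex.objEquiv s.2) p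
          (σ ≫ θ.unop)
        rw [Category.assoc, Category.assoc] at h2
        exact h1.trans (h2.symm.trans (DKval_map (C := B.obj l) _ θ.unop σ).symm) }
  refine ⟨⟨f, fun l l' ρ => ?_⟩, fun p β => ?_⟩
  · ext m s
    refine ULift.ext _ _ (DKval_ext (C := B.obj l') fun p σ => ?_)
    have h1 := hy l' m.unop (SSet.stdSimplex.objEquiv s.1 ≫ ρ) (SSet.stdSimplex.objEquiv s.2) p σ
    have h2 := hy l m.unop (SSet.stdSimplex.objEquiv s.1) (SSet.stdSimplex.objEquiv s.2) p σ
    have h3 := DKval_comp (B.map ρ) (y l m.unop (SSet.stdSimplex.objEquiv s.1)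
      (SSet.stdSimplex.objEquiv s.2)) σ
    rw [h2, ← hB, Category.assoc] at h3
    exact h1.trans h3.symm
  · have h := hy ⦋p⦌ ⦋p⦌ (𝟙 _) β p (𝟙 _)
    rw [Category.id_comp, Category.id_comp, B.map_id] at h
    exact h

end Totalization

/-! ### Totalization of the holomorphic forms on the Čech nerve -/

theorem map_sum_zsmul {G H : Type*} [AddCommGroup G] [AddCommGroup H] (f : G →+ H) {ι : Type*}
    (s : Finset ι) (c : ι → ℤ) (g : ι → G) :
    f (∑ i ∈ s, c i • g i) = ∑ i ∈ s, c i • f (g i) := by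
  simp only [map_sum, map_zsmul]

section ChainsDifferential

variable (A : Cos.{u}) {n : SimplexCategory}

theorem chains_diag_d_apply (N : ℕ) (z : (chains A n).G N N) (β : ⦋N + 1⦌ ⟶ n) :
    (chains A n).diag.d N z β = ∑ i : Fin (N + 2), (-1 : ℤ) ^ (i : ℕ) •
      A.map (SimplexCategory.δ i) (z (SimplexCategory.δ i ≫ β)) := by
  rw [Cos.d_apply]
  exact Finset.sum_apply β _ _

theorem chains_vert_d_apply (l p : ℕ) (y : (chains A n).G l p) (σ : ⦋p + 1⦌ ⟶ n) :
    ((chains A n).vert l).d p y σ = ∑ i : Fin (p + 2), (-1 : ℤ) ^ (i : ℕ) •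
      y (SimplexCategory.δ i ≫ σ) := by
  rw [Cos.d_apply]
  refine (Finset.sum_apply σ _ _).trans (Finset.sum_congr rfl fun i _ => ?_)
  exact congrArg _ (A.map_id l _)

theorem chains_hor_d_apply (l p : ℕ) (y : (chains A n).G l p) (σ : ⦋p⦌ ⟶ n) :
    ((chains A n).hor p).d l y σ = A.d l (y σ) := by
  rw [Cos.d_apply, Cos.d_apply]
  refine (Finset.sum_apply σ _ _).trans (Finset.sum_congr rfl fun i _ => ?_)
  exact congrArg (fun τ => (-1 : ℤ) ^ (i : ℕ) • A.map (SimplexCategory.δ i) (y τ))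
    (Category.id_comp σ)

end ChainsDifferential

/-- The coefficient of a power of `u`. -/
def QXcoeff (C : CochainComplex AddCommGrpCat.{u} ℕ) (n : ℕ) (p : {p : ℕ × ℕ // p.2 + n = 2 * p.1}) :
    QX C n →+ C.X p.1.2 where
  toFun c := c.1 p
  map_zero' := rfl
  map_add' _ _ := rfl

section TotalizationOfForms

/-- A cosimplicial abelian group in the sense of category theory, as a `Cos`. -/
abbrev cosOf (X : SimplexCategory ⥤ AddCommGrpCat.{u}) : Cos.{u} where
  G i := X.obj ⦋i⦌
  map a := (X.map a).hom
  map_id i z := by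
    rw [X.map_id]
    rfl
  map_map a a' z := by
    rw [X.map_comp]
    rfl

variable {M : CMan.{u}} {I : Type u} (U : I → Opens M)

/-- The cosimplicial group of holomorphic forms on the Čech nerve. -/
abbrev formsCos (q : ℕ) : Cos.{u} := cosOf ((cechNerve U).rightOp ⋙ holForms q)

/-- The triples of an exponent `k` of `u`, a form degree `q` and a simplicial degree `N` that occur
in forms on the Čech nerve, so that `q + N = 2 * k`. -/
abbrev FormIndex : Type := {t : ℕ × ℕ × ℕ // t.2.1 + t.2.2 = 2 * t.1}

/-- The coefficients of a family of forms, for all exponents of `u` and all form degrees. -/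
abbrev formsCosFamily (j : FormIndex) : Cos.{u} := formsCos U j.1.2.1

/-- The simplicial degree. -/
abbrev FormIndex.deg (j : FormIndex) : ℕ := j.1.2.2

/-- The complexes of forms on the Čech nerve. -/
abbrev formsComplex : SimplexCategory ⥤ ChainComplex AddCommGrpCat.{u} ℕ :=
  (cechNerve U).rightOp ⋙ holComplex ⋙ Q

/-- The coefficient of a power of `u` in a form. -/
abbrev formsCoeff (l : SimplexCategory) (n : ℕ) (p : {p : ℕ × ℕ // p.2 + n = 2 * p.1}) :
    ((formsComplex U).obj l).X n →+ ((holForms p.1.2).obj (op ((cechNerve U).obj (op l)))) :=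
  QXcoeff (holComplex.obj (op ((cechNerve U).obj (op l)))) n p

variable {U}

theorem formsComplex_d (l : SimplexCategory) (p : ℕ) (c : ((formsComplex U).obj l).X (p + 1)) :
    (((formsComplex U).obj l).d (p + 1) p).hom c = 0 := by
  have e := QObj_d (holComplex.obj (op ((cechNerve U).obj (op l)))) p
  refine (congrArg (fun f => f.hom c) e).trans (Subtype.ext (funext ?_))
  rintro ⟨⟨k, m⟩, h⟩
  cases m <;> rfl

theorem totVal_isDiagCocycle {n : SimplexCategory} (x : (Tot.obj (formsComplex U ⋙ DKu)).obj (op n))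
    (j : FormIndex) : (chains (formsCosFamily U j) n).IsDiagCocycle j.deg
      fun β => (totVal x j.deg β : QX _ _).1 ⟨(j.1.1, j.1.2.1), j.2⟩ := by
  obtain ⟨⟨k, q, N⟩, h⟩ := j
  refine ⟨?_, ?_⟩
  · cases N with
    | zero => trivial
    | succ N =>
      intro i
      funext β
      exact congrArg (fun c : QX (holComplex.obj (op ((cechNerve U).obj (op ⦋N⦌)))) (N + 1) =>
        c.1 ⟨(k, q), h⟩) (totVal_degenerate x i β)
  · funext β
    have h1 := (totVal_d x β).symm.trans (formsComplex_d ⦋N + 1⦌ N _)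
    have h2 := congrArg (formsCoeff U ⦋N + 1⦌ N ⟨(k, q), h⟩) h1
    have h3 := map_sum_zsmul (formsCoeff U ⦋N + 1⦌ N ⟨(k, q), h⟩) Finset.univ
      (fun i : Fin (N + 2) => (-1 : ℤ) ^ (i : ℕ))
      (fun i => (((formsComplex U).map (SimplexCategory.δ i)).f N).hom
        (totVal x N (SimplexCategory.δ i ≫ β)))
    exact (chains_diag_d_apply (formsCos U q) N _ β).trans (h3.symm.trans h2)

theorem exists_totVal_forms {n : SimplexCategory}
    (z : ∀ j, (chains (formsCosFamily U j) n).G j.deg j.deg)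
    (hz : ∀ j, (chains (formsCosFamily U j) n).IsDiagCocycle j.deg (z j)) :
    ∃ x : (Tot.obj (formsComplex U ⋙ DKu)).obj (op n), ∀ (j : FormIndex) (β : ⦋j.deg⦌ ⟶ n),
      (totVal x j.deg β : QX _ _).1 ⟨(j.1.1, j.1.2.1), j.2⟩ = z j β := by
  obtain ⟨x, hx⟩ := exists_totVal (B := formsComplex U)
    (fun p β => (⟨fun t => z ⟨(t.1.1, t.1.2, p), t.2⟩ β, fun _ _ => rfl⟩ :
      QX (holComplex.obj (op ((cechNerve U).obj (op ⦋p⦌)))) p))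
    (fun p i β => Subtype.ext (funext fun t =>
      congrFun ((hz ⟨(t.1.1, t.1.2, p + 1), t.2⟩).normal i) β))
    (fun p β => by
      refine (formsComplex_d ⦋p + 1⦌ p _).trans (Subtype.ext (funext fun t => ?_))
      have h := (chains_diag_d_apply (formsCos U t.1.2) p _ β).symm.trans
        (congrFun (hz ⟨(t.1.1, t.1.2, p), t.2⟩).cocycle β)
      refine h.symm.trans (Eq.symm ((map_sum (QXcoeff _ p t) _ _).trans ?_))
      exact Finset.sum_congr rfl fun i _ => map_zsmul (QXcoeff _ p t) _ _)
  exact ⟨x, fun j β => congrArg (fun c : QX _ j.deg => c.1 ⟨(j.1.1, j.1.2.1), j.2⟩) (hx j.deg β)⟩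

/-- Points of the totalization of the forms on the Čech nerve are families of cocycles. -/
def totToCocycles : Tot.obj ((cechNerve U).rightOp ⋙ Omega.{u}) ⟶
    diagCocycles (formsCosFamily U) FormIndex.deg where
  app _ := TypeCat.ofHom fun x => ⟨⟨fun j β =>
      (totVal (B := formsComplex U) x j.deg β : QX _ _).1 ⟨(j.1.1, j.1.2.1), j.2⟩,
    totVal_isDiagCocycle x⟩⟩
  naturality _ _ _ := rfl

instance : IsIso (totToCocycles (U := U)) := by
  rw [NatTrans.isIso_iff_isIso_app]
  intro n
  rw [isIso_iff_bijective]
  refine ⟨fun x x' h => ?_, fun z => ?_⟩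
  · refine totVal_ext (B := formsComplex U) fun p β => Subtype.ext (funext ?_)
    rintro ⟨⟨k, q⟩, hp⟩
    exact congrArg (fun z : (diagCocycles (formsCosFamily U) FormIndex.deg).obj n =>
      z.down.1 ⟨(k, q, p), hp⟩ β) h
  · obtain ⟨x, hx⟩ := exists_totVal_forms z.down.1 z.down.2
    exact ⟨x, ulift_subtype_ext (funext fun j => funext fun β => hx j β)⟩

end TotalizationOfForms

/-! ### Čech cochains with values in holomorphic forms -/

section ChainCocycles

variable {A : Cos.{u}} {n : SimplexCategory}

/-- The conditions on a cocycle in the total complex, in terms of its values on simplices. -/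
theorem chains_isTotCocycle_iff {N : ℕ} {y : ∀ p l, (chains A n).G l p} :
    (chains A n).IsTotCocycle N y ↔ (∀ p l, p + l ≠ N → y p l = 0) ∧
      (∀ (p l : ℕ) (i : Fin (p + 1)) (σ : ⦋p⦌ ⟶ n), y (p + 1) l (SimplexCategory.σ i ≫ σ) = 0) ∧
      (∀ (l : ℕ) (σ : ⦋0⦌ ⟶ n), A.d l (y 0 l σ) = 0) ∧
      (∀ (p : ℕ) (σ : ⦋p + 1⦌ ⟶ n), ∑ i : Fin (p + 2), (-1 : ℤ) ^ (i : ℕ) •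
        y p 0 (SimplexCategory.δ i ≫ σ) = 0) ∧
      (∀ (p l : ℕ) (σ : ⦋p + 1⦌ ⟶ n), ∑ i : Fin (p + 2), (-1 : ℤ) ^ (i : ℕ) •
        y p (l + 1) (SimplexCategory.δ i ≫ σ) = (-1 : ℤ) ^ p • A.d l (y (p + 1) l σ)) := by
  have hn : (∀ p l, ((chains A n).vert l).Normal (y p l)) ↔
      ∀ (p l : ℕ) (i : Fin (p + 1)) (σ : ⦋p⦌ ⟶ n), y (p + 1) l (SimplexCategory.σ i ≫ σ) = 0 := by
    constructor
    · exact fun h p l i σ => (A.map_id l _).symm.trans (congrFun (h (p + 1) l i) σ)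
    · intro h p l
      cases p with
      | zero => trivial
      | succ p => exact fun i => funext fun σ => (A.map_id l _).trans (h p l i σ)
  have h00 : (chains A n).totD y 0 0 = 0 := by
    simp [BiCos.totD, BiCos.vertD, BiCos.horD]
  have h0 (l : ℕ) (σ : ⦋0⦌ ⟶ n) : (chains A n).totD y 0 (l + 1) σ = A.d l (y 0 l σ) := by
    rw [← chains_hor_d_apply]
    refine congrFun (?_ : (chains A n).totD y 0 (l + 1) = ((chains A n).hor 0).d l (y 0 l)) σ
    simp [BiCos.totD, BiCos.vertD, BiCos.horD]
  have h1 (p : ℕ) (σ : ⦋p + 1⦌ ⟶ n) : (chains A n).totD y (p + 1) 0 σ =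
      ∑ i : Fin (p + 2), (-1 : ℤ) ^ (i : ℕ) • y p 0 (SimplexCategory.δ i ≫ σ) := by
    rw [← chains_vert_d_apply]
    refine congrFun (?_ : (chains A n).totD y (p + 1) 0 = ((chains A n).vert 0).d p (y p 0)) σ
    simp [BiCos.totD, BiCos.vertD, BiCos.horD]
  have h2 (p l : ℕ) (σ : ⦋p + 1⦌ ⟶ n) : (chains A n).totD y (p + 1) (l + 1) σ =
      (∑ i : Fin (p + 2), (-1 : ℤ) ^ (i : ℕ) • y p (l + 1) (SimplexCategory.δ i ≫ σ)) -
        (-1 : ℤ) ^ p • A.d l (y (p + 1) l σ) := by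
    rw [← chains_vert_d_apply, ← chains_hor_d_apply, sub_eq_add_neg, ← neg_smul, ← mul_neg_one,
      ← pow_succ]
    rfl
  constructor
  · intro h
    refine ⟨h.support, hn.1 h.normal, fun l σ => ?_, fun p σ => ?_, fun p l σ => ?_⟩
    · rw [← h0, h.cocycle]
      rfl
    · rw [← h1, h.cocycle]
      rfl
    · rw [← sub_eq_zero, ← h2, h.cocycle]
      rfl
  · rintro ⟨hs, hv, ha, hb, hc⟩
    refine ⟨hs, hn.2 hv, fun p l => ?_⟩
    rcases p with _ | p <;> rcases l with _ | l
    · exact h00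
    · exact funext fun σ => (h0 l σ).trans (ha l σ)
    · exact funext fun σ => (h1 p σ).trans (hb p σ)
    · exact funext fun σ => (h2 p l σ).trans (sub_eq_zero.2 (hc p l σ))

end ChainCocycles

section CechCochains

variable {M : CMan.{u}} {I : Type u} (U : I → Opens M)

/-- The cosimplicial group of Čech cochains with values in holomorphic forms. -/
abbrev cechCos (q : ℕ) : Cos.{u} := cosOf (cechCosimplicial U (holForms q))

theorem cechForms_d (q l : ℕ) (c : (cechCos U q).G l) :
    ((cechForms U q).d l (l + 1)).hom c = (cechCos U q).d l c := by
  have e : (cechForms U q).d l (l + 1) =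
      AlgebraicTopology.AlternatingCofaceMapComplex.objD (cechCosimplicial U (holForms q)) l :=
    CochainComplex.of_d (fun l => (cechCosimplicial U (holForms q)).obj ⦋l⦌)
      (AlgebraicTopology.AlternatingCofaceMapComplex.objD (cechCosimplicial U (holForms q))) l
  rw [e, Cos.d_apply]
  exact hom_sum_zsmul_apply _ _ _ _

theorem cech_d (m : ℕ) (c : CechX U m) : ((cech U).d m (m + 1)).hom c = cechd U m c := by
  have e : (cech U).d m (m + 1) = AddCommGrpCat.ofHom (cechd U m) :=
    CochainComplex.of_d (fun m => AddCommGrpCat.of (CechX U m))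
      (fun m => AddCommGrpCat.ofHom (cechd U m)) m
  rw [e]
  rfl

/-- The component of an element of `C[[u]]`, for the Čech-Hodge complex `C`, in a power of `u`, a
Čech degree and a form degree. -/
def cechPart (p k l q : ℕ) (h : l + q + p = 2 * k) : QX (cech U) p →+ (cechCos U q).G l where
  toFun c := (c.1 ⟨(k, l + q), h⟩ : CechX U (l + q)) ⟨(l, q), rfl⟩
  map_zero' := rfl
  map_add' _ _ := rfl

variable {U}

theorem coeff_eq_cechPart {p k m l q : ℕ} (c : QX (cech U) p) (h : m + p = 2 * k) (hm : l + q = m) :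
    (c.1 ⟨(k, m), h⟩ : CechX U m) ⟨(l, q), hm⟩ = cechPart U p k l q (by rw [hm, h]) c := by
  subst hm
  rfl

theorem QX_cech_ext {p : ℕ} {c c' : QX (cech U) p}
    (h : ∀ k l q h, cechPart U p k l q h c = cechPart U p k l q h c') : c = c' := by
  refine Subtype.ext (funext ?_)
  rintro ⟨⟨k, m⟩, hp⟩
  refine (funext ?_ : (c.1 ⟨(k, m), hp⟩ : CechX U m) = c'.1 ⟨(k, m), hp⟩)
  rintro ⟨⟨l, q⟩, hm⟩
  exact (coeff_eq_cechPart c hp hm).trans ((h _ _ _ _).trans (coeff_eq_cechPart c' hp hm).symm)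

theorem cechd_zero_apply {m q : ℕ} (c : CechX U m) (h : 0 + q = m + 1) :
    cechd U m c ⟨(0, q), h⟩ = 0 := rfl

theorem cechd_succ_apply {m l q : ℕ} (c : CechX U m) (h : l + 1 + q = m + 1) :
    cechd U m c ⟨(l + 1, q), h⟩ =
      (cechCos U q).d l (c ⟨(l, q), by simp only at h ⊢; omega⟩) :=
  cechForms_d U q l _

theorem Qd_succ_apply {p k m : ℕ} (c : QX (cech U) (p + 1)) (h : m + 1 + p = 2 * k) :
    (Qd (cech U) p c).1 ⟨(k, m + 1), h⟩ =
      cechd U m (c.1 ⟨(k, m), by simp only at h ⊢; omega⟩) :=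
  cech_d U m _

theorem cechPart_d_zero {p k q : ℕ} (h : 0 + q + p = 2 * k) (c : QX (cech U) (p + 1)) :
    cechPart U p k 0 q h (((Q.obj (cech U)).d (p + 1) p).hom c) = 0 := by
  have e : ((Q.obj (cech U)).d (p + 1) p).hom c = Qd (cech U) p c :=
    congrArg (fun f => f.hom c) (QObj_d (cech U) p)
  refine (congrArg (cechPart U p k 0 q h) e).trans ?_
  cases q with
  | zero => rfl
  | succ q =>
    rw [← coeff_eq_cechPart _ (m := q + 1) (by omega) (by omega)]
    refine (congrFun (Qd_succ_apply c _) _).trans ?_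
    exact cechd_zero_apply _ _

/-- The differential of the chain complex `Q` of the Čech-Hodge complex is the Čech differential, without a
sign. -/
theorem cechPart_d_succ {p k l q : ℕ} (h : l + 1 + q + p = 2 * k) (c : QX (cech U) (p + 1)) :
    cechPart U p k (l + 1) q h (((Q.obj (cech U)).d (p + 1) p).hom c) =
      (cechCos U q).d l (cechPart U (p + 1) k l q (by omega) c) := by
  have e : ((Q.obj (cech U)).d (p + 1) p).hom c = Qd (cech U) p c :=
    congrArg (fun f => f.hom c) (QObj_d (cech U) p)
  refine (congrArg (cechPart U p k (l + 1) q h) e).trans ?_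
  rw [← coeff_eq_cechPart _ (m := l + q + 1) (by omega) (by omega)]
  refine (congrFun (Qd_succ_apply c _) _).trans ?_
  exact cechd_succ_apply _ _

theorem cechPart_cocycle {k l q : ℕ} (h : l + q + 0 = 2 * k) (c : QX (cech U) 0) :
    (cechCos U q).d l (cechPart U 0 k l q h c) = 0 := by
  have h1 : cechd U (l + q) (c.1 ⟨(k, l + q), h⟩) = 0 :=
    (cech_d U _ _).symm.trans (c.2 rfl ⟨(k, l + q), h⟩)
  have h2 := congrFun h1 ⟨(l + 1, q), by simp only; omega⟩
  exact (cechd_succ_apply _ _).symm.trans h2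

theorem exists_cechPart {p : ℕ} (f : ∀ k l q, l + q + p = 2 * k → (cechCos U q).G l)
    (hf : p = 0 → ∀ k l q h, (cechCos U q).d l (f k l q h) = 0) :
    ∃ c : QX (cech U) p, ∀ k l q h, cechPart U p k l q h c = f k l q h := by
  refine ⟨⟨fun t => (fun b => f t.1.1 b.1.1 b.1.2 (by rw [b.2, t.2]) : CechX U t.1.2), ?_⟩,
    fun k l q h => rfl⟩
  rintro hp ⟨⟨k, m⟩, h⟩
  refine (cech_d U m _).trans (funext ?_)
  rintro ⟨⟨l, q⟩, hm⟩
  cases l with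
  | zero => rfl
  | succ l => exact (cechd_succ_apply _ _).trans (hf hp _ _ _ _)

variable (U) in
/-- Restriction of forms on the Čech nerve to its pieces. -/
abbrev restrict (q l : ℕ) : (formsCos U q).G l →+ (cechCos U q).G l :=
  ((restrictPieces U (holForms q)).app ⦋l⦌).hom

theorem restrict_map {q l m : ℕ} (a : ⦋l⦌ ⟶ ⦋m⦌) (z : (formsCos U q).G l) :
    restrict U q m ((formsCos U q).map a z) = (cechCos U q).map a (restrict U q l z) :=
  ConcreteCategory.congr_hom ((restrictPieces U (holForms q)).naturality a) z

theorem restrict_d {q l : ℕ} (z : (formsCos U q).G l) :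
    restrict U q (l + 1) ((formsCos U q).d l z) = (cechCos U q).d l (restrict U q l z) :=
  Cos.map_d (formsCos U q) (fun l => restrict U q l) restrict_map l z

/-- The sign that relates the Eilenberg-Zilber map and the differential of `DK`. -/
def ezSign (p : ℕ) : ℤ := (-1) ^ (p * (p - 1) / 2)

theorem ezSign_succ (p : ℕ) : ezSign (p + 1) = (-1) ^ p * ezSign p := by
  have e : (p + 1) * (p + 1 - 1) / 2 = p + p * (p - 1) / 2 := by
    rw [← Nat.choose_two_right, ← Nat.choose_two_right, Nat.choose_succ_succ' p 1,
      Nat.choose_one_right]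
  rw [ezSign, ezSign, e, pow_add]

theorem ezSign_mul_self (p : ℕ) : ezSign p * ezSign p = 1 := by
  rw [ezSign, ← mul_pow]
  simp

variable {n : SimplexCategory}

/-- The relation between a simplex of the Dold-Kan construction on the Čech-Hodge complex and a
family of cocycles in the total complexes of the chains with values in the forms on the nerve. -/
def CechRel (y : ∀ (j : FormIndex) (p l : ℕ), (chains (formsCosFamily U j) n).G l p)
    (x : (DK.obj (Q.obj (cech U))).obj (op n)) : Prop :=
  ∀ (p : ℕ) (σ : ⦋p⦌ ⟶ n) (k l q N : ℕ) (h : l + q + p = 2 * k) (hN : q + N = 2 * k),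
    p + l = N → cechPart U p k l q h (DKval (C := Q.obj (cech U)) x σ) =
      ezSign p • restrict U q l (y ⟨(k, q, N), hN⟩ p l σ)

/-- The values in chain degree zero have to be cocycles. They are, since in bidegree `(l + 1, 0)` the total
differential only has the part that raises the first degree. -/
theorem exists_cechRel (y : ∀ (j : FormIndex) (p l : ℕ), (chains (formsCosFamily U j) n).G l p)
    (hy : ∀ j, (chains (formsCosFamily U j) n).IsTotCocycle j.deg (y j)) :
    ∃ x : (DK.obj (Q.obj (cech U))).obj (op n), CechRel y x := by
  have hy' := fun k q N h => chains_isTotCocycle_iff.1 (hy ⟨(k, q, N), h⟩)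
  have key : ∀ (p : ℕ) (σ : ⦋p⦌ ⟶ n), ∃ c : QX (cech U) p, ∀ (k l q N : ℕ)
      (h : l + q + p = 2 * k) (hN : q + N = 2 * k), p + l = N →
      cechPart U p k l q h c = ezSign p • restrict U q l (y ⟨(k, q, N), hN⟩ p l σ) := by
    intro p σ
    obtain ⟨c, hc⟩ := exists_cechPart (U := U) (p := p) (fun k l q h =>
      ezSign p • restrict U q l (y ⟨(k, q, p + l), by simp only; omega⟩ p l σ)) (by
        rintro rfl k l q h
        have h1 := (hy' k q (0 + l) (by simp only; omega)).2.2.1 l σ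
        rw [map_zsmul, ← restrict_d]
        exact (congrArg (fun w => ezSign 0 • restrict U q (l + 1) w) h1).trans
          ((congrArg (ezSign 0 • ·) (map_zero _)).trans (smul_zero _)))
    refine ⟨c, ?_⟩
    rintro k l q N h hN rfl
    exact hc k l q h
  choose f hf using key
  have hdeg : ∀ (p : ℕ) (i : Fin (p + 1)) (σ : ⦋p⦌ ⟶ n),
      f (p + 1) (SimplexCategory.σ i ≫ σ) = 0 := by
    intro p i σ
    refine QX_cech_ext fun k l q h => ?_
    rw [hf (p + 1) _ k l q (p + 1 + l) h (by omega) rfl]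
    have h1 := (hy' k q (p + 1 + l) (by simp only; omega)).2.1 p l i σ
    exact (congrArg (fun w => ezSign (p + 1) • restrict U q l w) h1).trans
      ((congrArg (ezSign (p + 1) • ·) (map_zero _)).trans (smul_zero _))
  have hd : ∀ (p : ℕ) (σ : ⦋p + 1⦌ ⟶ n),
      ((Q.obj (cech U)).d (p + 1) p).hom (f (p + 1) σ) =
        ∑ i : Fin (p + 2), (-1 : ℤ) ^ (i : ℕ) • f p (SimplexCategory.δ i ≫ σ) := by
    intro p σ
    refine QX_cech_ext fun k l q h => ?_
    refine Eq.trans ?_ (map_sum_zsmul (cechPart U p k l q h) Finset.univ _ _).symm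
    obtain ⟨-, -, -, hb, hc⟩ := hy' k q (p + l) (by simp only; omega)
    have hR : ∑ i : Fin (p + 2), (-1 : ℤ) ^ (i : ℕ) •
        cechPart U p k l q h (f p (SimplexCategory.δ i ≫ σ)) =
        ezSign p • restrict U q l (∑ i : Fin (p + 2), (-1 : ℤ) ^ (i : ℕ) •
          y ⟨(k, q, p + l), by simp only; omega⟩ p l (SimplexCategory.δ i ≫ σ)) := by
      rw [map_sum_zsmul, Finset.smul_sum]
      exact Finset.sum_congr rfl fun i _ => by
        rw [hf p _ k l q (p + l) h (by omega) rfl, smul_comm]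
    refine Eq.trans ?_ hR.symm
    cases l with
    | zero =>
      refine (cechPart_d_zero h _).trans (Eq.symm ?_)
      exact (congrArg (fun w => ezSign p • restrict U q 0 w) (hb p σ)).trans
        ((congrArg (ezSign p • ·) (map_zero _)).trans (smul_zero _))
    | succ l =>
      refine (cechPart_d_succ h _).trans (Eq.symm ?_)
      rw [hf (p + 1) σ k l q (p + (l + 1)) (by omega) (by omega) (by omega)]
      refine (congrArg (fun w => ezSign p • restrict U q (l + 1) w) (hc p l σ)).trans ?_
      refine (congrArg (ezSign p • ·) ((map_zsmul (restrict U q (l + 1)) _ _).trans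
        (congrArg ((-1 : ℤ) ^ p • ·) (restrict_d _)))).trans ?_
      rw [smul_smul, mul_comm, ← ezSign_succ]
      exact (map_zsmul ((cechCos U q).d l) _ _).symm
  obtain ⟨x, hx⟩ := exists_DKval (C := Q.obj (cech U)) f hdeg hd
  exact ⟨x, fun p σ k l q N h hN e => (congrArg _ (hx p σ)).trans (hf p σ k l q N h hN e)⟩

end CechCochains

/-! ### The Eilenberg-Zilber map to the Dold-Kan construction on Čech cochains -/

section Comparison

variable {M : CMan.{u}} {I : Type u} {U : I → Opens M} {n : SimplexCategory}

theorem CechRel.unique {y : ∀ (j : FormIndex) (p l : ℕ), (chains (formsCosFamily U j) n).G l p}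
    {x x' : (DK.obj (Q.obj (cech U))).obj (op n)} (h : CechRel y x) (h' : CechRel y x') :
    x = x' :=
  DKval_ext (C := Q.obj (cech U)) fun p σ => QX_cech_ext fun k l q hk =>
    (h p σ k l q (p + l) hk (by omega) rfl).trans (h' p σ k l q (p + l) hk (by omega) rfl).symm

theorem CechRel.map {y : ∀ (j : FormIndex) (p l : ℕ), (chains (formsCosFamily U j) n).G l p}
    {x : (DK.obj (Q.obj (cech U))).obj (op n)} (h : CechRel y x) {m : SimplexCategory}
    (θ : m ⟶ n) : CechRel (fun j p l => (chainsMap (formsCosFamily U j) θ).app l p (y j p l))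
      ((DK.obj (Q.obj (cech U))).map θ.op x) := fun p σ k l q N hk hN e =>
  (congrArg (cechPart U p k l q hk) (DKval_map (C := Q.obj (cech U)) x θ σ)).trans
    (h p (σ ≫ θ) k l q N hk hN e)

theorem sum_cechPart {x : (DK.obj (Q.obj (cech U))).obj (op n)} {p k l q : ℕ}
    (h : l + q + p = 2 * k) (σ : ⦋p + 1⦌ ⟶ n) :
    ∑ i : Fin (p + 2), (-1 : ℤ) ^ (i : ℕ) • cechPart U p k l q h
      (DKval (C := Q.obj (cech U)) x (SimplexCategory.δ i ≫ σ)) =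
      cechPart U p k l q h (((Q.obj (cech U)).d (p + 1) p).hom
        (DKval (C := Q.obj (cech U)) x σ)) := by
  refine Eq.trans ?_ (congrArg (cechPart U p k l q h) (DKval_d (C := Q.obj (cech U)) x σ)).symm
  exact (map_sum_zsmul (cechPart U p k l q h) Finset.univ _ _).symm

/-- Every simplex of the Dold-Kan construction comes from a family of cocycles, if forms on the nerve are the
same as families of forms on its pieces. -/
theorem exists_of_cechRel (hR : ∀ q l, Function.Bijective (restrict U q l))
    (x : (DK.obj (Q.obj (cech U))).obj (op n)) :
    ∃ y : ∀ (j : FormIndex) (p l : ℕ), (chains (formsCosFamily U j) n).G l p,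
      (∀ j, (chains (formsCosFamily U j) n).IsTotCocycle j.deg (y j)) ∧ CechRel y x := by
  choose r hr using fun q l => (hR q l).2
  let y (j : FormIndex) (p l : ℕ) : (chains (formsCosFamily U j) n).G l p := fun σ =>
    if h : p + l = j.deg then r j.1.2.1 l (ezSign p • cechPart U p j.1.1 l j.1.2.1
      (by have := j.2; simp only [FormIndex.deg] at h; omega) (DKval (C := Q.obj (cech U)) x σ)) else 0
  have hy : ∀ (k q N : ℕ) (hN : q + N = 2 * k) (p l : ℕ) (h : p + l = N) (σ : ⦋p⦌ ⟶ n),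
      restrict U q l (y ⟨(k, q, N), hN⟩ p l σ) = ezSign p • cechPart U p k l q (by omega)
        (DKval (C := Q.obj (cech U)) x σ) := fun k q N hN p l h σ =>
    (congrArg (restrict U q l) (dif_pos h)).trans (hr q l _)
  have hy0 : ∀ (j : FormIndex) (p l : ℕ), p + l ≠ j.deg → y j p l = 0 := fun j p l h =>
    funext fun σ => dif_neg h
  refine ⟨y, ?_, fun p σ k l q N hk hN e => ?_⟩
  · rintro ⟨⟨k, q, N⟩, hN⟩
    refine chains_isTotCocycle_iff.2 ⟨hy0 _, fun p l i σ => ?_, fun l σ => ?_, fun p σ => ?_,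
      fun p l σ => ?_⟩
    · by_cases h : p + 1 + l = N
      · refine (hR q l).1 ((hy k q N hN _ _ h _).trans (Eq.trans ?_ (map_zero _).symm))
        rw [DKval_degenerate]
        exact (congrArg _ (map_zero _)).trans (smul_zero _)
      · exact congrFun (hy0 ⟨(k, q, N), hN⟩ (p + 1) l h) _
    · by_cases h : 0 + l = N
      · refine (hR q (l + 1)).1 ((restrict_d _).trans (Eq.trans ?_ (map_zero _).symm))
        refine (congrArg ((cechCos U q).d l) (hy k q N hN _ _ h _)).trans ?_
        rw [map_zsmul]
        exact (congrArg _ (cechPart_cocycle _ _)).trans (smul_zero _)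
      · refine (congrArg ((formsCos U q).d l) (congrFun (hy0 ⟨(k, q, N), hN⟩ 0 l h) σ)).trans ?_
        exact map_zero _
    · by_cases h : p + 0 = N
      · refine (hR q 0).1 ((map_sum_zsmul _ _ _ _).trans (Eq.trans ?_ (map_zero _).symm))
        refine (Finset.sum_congr rfl fun i _ => congrArg _ (hy k q N hN p 0 h _)).trans ?_
        simp only [smul_comm _ (ezSign p)]
        rw [← Finset.smul_sum, sum_cechPart]
        exact (congrArg (ezSign p • ·) (cechPart_d_zero _ _)).trans (smul_zero _)
      · refine Finset.sum_eq_zero fun i _ => ?_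
        refine (congrArg _ (congrFun (hy0 ⟨(k, q, N), hN⟩ p 0 h) _)).trans ?_
        exact smul_zero _
    · by_cases h : p + (l + 1) = N
      · refine (hR q (l + 1)).1 ((map_sum_zsmul _ _ _ _).trans (Eq.trans ?_
          ((map_zsmul _ _ _).trans (congrArg _ (restrict_d _))).symm))
        refine (Finset.sum_congr rfl fun i _ => congrArg _ (hy k q N hN p (l + 1) h _)).trans ?_
        refine Eq.trans ?_ (congrArg (fun c => (-1 : ℤ) ^ p • (cechCos U q).d l c)
          (hy k q N hN (p + 1) l (by omega) σ)).symm
        simp only [smul_comm _ (ezSign p)]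
        rw [← Finset.smul_sum, sum_cechPart]
        refine (congrArg (ezSign p • ·) (cechPart_d_succ _ _)).trans ?_
        rw [map_zsmul, smul_smul, ezSign_succ, ← mul_assoc, ← mul_pow]
        simp
      · refine (Finset.sum_eq_zero fun i _ => ?_).trans (Eq.symm ?_)
        · exact (congrArg _ (congrFun (hy0 ⟨(k, q, N), hN⟩ p (l + 1) h) _)).trans (smul_zero _)
        · refine (congrArg (fun c => (-1 : ℤ) ^ p • (formsCos U q).d l c)
            (congrFun (hy0 ⟨(k, q, N), hN⟩ (p + 1) l (show p + 1 + l ≠ N by omega)) σ)).trans ?_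
          exact (congrArg _ (map_zero _)).trans (smul_zero _)
  · rw [hy k q N hN p l e, smul_smul, ezSign_mul_self, one_smul]

/-- Families of cocycles in the total complexes are simplices of the Dold-Kan construction on the
Čech-Hodge complex. -/
def cocyclesToCech : totCocycles (formsCosFamily U) FormIndex.deg ⟶ DKu.obj (Q.obj (cech U)) where
  app _ := TypeCat.ofHom fun y => ULift.up (exists_cechRel y.down.1 y.down.2).choose
  naturality n m θ := by
    refine ConcreteCategory.hom_ext _ _ fun y => ?_
    refine ULift.ext _ _ ?_
    let y' := (totCocycles (formsCosFamily U) FormIndex.deg).map θ y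
    exact (exists_cechRel y'.down.1 y'.down.2).choose_spec.unique
      ((exists_cechRel y.down.1 y.down.2).choose_spec.map θ.unop)

theorem cocyclesToCech_rel (y : (totCocycles (formsCosFamily U) FormIndex.deg).obj (op n)) :
    CechRel y.down.1 (cocyclesToCech.app (op n) y).down :=
  (exists_cechRel y.down.1 y.down.2).choose_spec

theorem isIso_cocyclesToCech (hR : ∀ q l, Function.Bijective (restrict U q l)) :
    IsIso (cocyclesToCech (U := U)) := by
  rw [NatTrans.isIso_iff_isIso_app]
  intro n
  rw [isIso_iff_bijective]
  refine ⟨fun y y' h => ?_, fun x => ?_⟩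
  · refine ulift_subtype_ext (funext fun j => funext fun p => funext fun l => ?_)
    obtain ⟨⟨k, q, N⟩, hN⟩ := j
    by_cases e : p + l = N
    · funext σ
      have h1 := cocyclesToCech_rel (n := n.unop) y p σ k l q N (by simp only at hN; omega) hN e
      have h2 := cocyclesToCech_rel (n := n.unop) y' p σ k l q N (by simp only at hN; omega) hN e
      have h3 := h1.symm.trans ((congrArg (fun x : (DKu.obj (Q.obj (cech U))).obj n =>
        cechPart U p k l q (by simp only at hN; omega)
          (DKval (C := Q.obj (cech U)) x.down σ)) h).trans h2)
      have h4 := congrArg (ezSign p • ·) h3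
      simp only [smul_smul, ezSign_mul_self, one_smul] at h4
      exact (hR q l).1 h4
    · exact ((y.down.2 ⟨(k, q, N), hN⟩).support p l e).trans
        ((y'.down.2 ⟨(k, q, N), hN⟩).support p l e).symm
  · obtain ⟨y, hy, hx⟩ := exists_of_cechRel hR x.down
    refine ⟨⟨⟨y, hy⟩⟩, ULift.ext _ _ ?_⟩
    exact (cocyclesToCech_rel (n := n.unop) ⟨⟨y, hy⟩⟩).unique hx

variable (U) in
/-- The Eilenberg-Zilber map from the totalization of the forms on the Čech nerve. -/
def ezMap : Tot.obj ((cechNerve U).rightOp ⋙ Omega.{u}) ⟶ DKu.obj (Q.obj (cech U)) :=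
  totToCocycles ≫ shuffleCocycles _ _ ≫ cocyclesToCech

theorem isWeakEquivalence_ezMap (hR : ∀ q l, Function.Bijective (restrict U q l)) :
    IsWeakEquivalence (ezMap U) := by
  have := isIso_cocyclesToCech hR
  exact (isWeakEquivalence_shuffleCocycles (formsCosFamily U) FormIndex.deg).iso_comp_iso
    (asIso totToCocycles) (asIso cocyclesToCech)

theorem isEZMap_ezMap : IsEZMap U (ezMap U) := by
  intro n x p σ k l q h a
  have h0 := cocyclesToCech_rel ((shuffleCocycles (formsCosFamily U) FormIndex.deg).app (op n)
    (totToCocycles.app (op n) x)) p σ k l q (p + l) h (by omega) rfl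
  refine (congrFun h0 a).trans ?_
  refine congrArg (fun w : HolForm (openMan (inter U a)) q => ezSign p • w) ?_
  have h1 := BiCos.shuffle_eq_sum (p + l) (chains (formsCos U q) n) (p := p) (l := l) rfl
    ((totToCocycles.app (op n) x).down.1 ⟨(k, q, p + l), by simp only; omega⟩)
  have h2 := congrArg (fun w : HolForm ((cechNerve U).obj (op ⦋l⦌)) q =>
    HolForm.pull (pieceIncl U (l := ⦋l⦌) a) q w) (congrFun h1 σ)
  refine h2.trans ?_
  rw [← Finset.sum_filter, Finset.sum_apply]
  refine (map_sum (HolForm.pull (pieceIncl U (l := ⦋l⦌) a) q) _ _).trans ?_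
  refine (Finset.sum_subtype (p := fun S : Finset (Fin (p + l)) => S.card = p)
    (F := inferInstance) _ (fun S => by simp) _).trans ?_
  refine Finset.sum_congr rfl fun S _ => ?_
  refine (map_zsmul (HolForm.pull (pieceIncl U (l := ⦋l⦌) a) q) _ _).trans ?_
  refine congrArg (fun w : HolForm ((cechNerve U).obj (op ⦋l⦌)) q =>
    shuffleSign S.1 • HolForm.pull (pieceIncl U (l := ⦋l⦌) a) q w) ?_
  have h3 := DKval_tot (B := formsComplex U) x (stepMap S.1ᶜ (card_compl_shuffle S.2))
    (stepMap S.1 S.2 ≫ σ) (𝟙 ⦋p + l⦌)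
  rw [Category.id_comp, Category.id_comp] at h3
  rw [stepClamp_eq_stepMap (card_compl_shuffle S.2), stepClamp_eq_stepMap S.2]
  exact (congrArg (fun c : QX (holComplex.obj (op ((cechNerve U).obj (op ⦋l⦌)))) (p + l) =>
    c.1 ⟨(k, q), by simp only; omega⟩) h3).symm

end Comparison

/-! ### Forms on a disjoint union -/

section Pieces

/-- The pullback of a form at a point depends on the germ of the map only. -/
theorem HolForm.pull_congr {X Y : CMan.{u}} {φ ψ : X ⟶ Y} {s : X} (h : ∀ᶠ t in 𝓝 s, φ t = ψ t)
    {q : ℕ} (η : HolForm Y q) : (HolForm.pull φ q η).1 s = (HolForm.pull ψ q η).1 s := by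
  ext v
  have h1 : φ s = ψ s := h.self_of_nhds
  have h2 : mfderiv X.I Y.I φ s = mfderiv X.I Y.I ψ s :=
    Filter.EventuallyEq.mfderiv_eq h
  exact congrArg₂ (fun (y : Y) (D : EuclideanSpace ℂ (Fin X.dim) →L[ℂ] EuclideanSpace ℂ (Fin Y.dim)) =>
    η.1 y (fun i => D (v i))) h1 h2

theorem HolForm.pull_pull {X Y Z : CMan.{u}} (φ : X ⟶ Y) (ψ : Y ⟶ Z) {q : ℕ} (η : HolForm Z q) :
    HolForm.pull φ q (HolForm.pull ψ q η) = HolForm.pull (φ ≫ ψ) q η :=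
  (ConcreteCategory.congr_hom ((holForms q).map_comp ψ.op φ.op) η).symm

theorem HolForm.pull_id {X : CMan.{u}} {q : ℕ} (η : HolForm X q) :
    HolForm.pull (𝟙 X) q η = η :=
  ConcreteCategory.congr_hom ((holForms q).map_id (op X)) η

variable {M : CMan.{u}} {I : Type u} (U : I → Opens M) {l : SimplexCategory}

open Classical in
/-- The map from the nerve to one of its pieces which is the identity on this piece and constant on
the others. -/
def pieceRetract (a : Fin (l.len + 1) → I) (x : inter U a) :
    (cechNerve U).obj (op l) ⟶ openMan (inter U a) :=
  (⟨fun s => if h : s.1 = a then h ▸ s.2 else x, by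
    refine contMDiff_sigma fun b => ?_
    by_cases h : b = a
    · subst h
      simp only [dite_true]
      exact contMDiff_id
    · simpa [h] using contMDiff_const⟩ :
    C^ω⟮M.I, Σ a : Fin (l.len + 1) → I, inter U a; M.I, inter U a⟯)

theorem pieceRetract_apply (a : Fin (l.len + 1) → I) (x y : inter U a) :
    pieceRetract U a x (⟨a, y⟩ : Σ a : Fin (l.len + 1) → I, inter U a) = y :=
  dif_pos rfl

theorem pieceIncl_pieceRetract (a : Fin (l.len + 1) → I) (x : inter U a) :
    pieceIncl U a ≫ pieceRetract U a x = 𝟙 _ :=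
  ContMDiffMap.ext fun y => pieceRetract_apply U a x y

theorem eventually_mem_piece (a : Fin (l.len + 1) → I) (x : inter U a)
    {P : (Σ a : Fin (l.len + 1) → I, inter U a) → Prop} (h : ∀ y, P ⟨a, y⟩) :
    ∀ᶠ s in 𝓝 (⟨a, x⟩ : Σ a : Fin (l.len + 1) → I, inter U a), P s := by
  have := (IsOpenEmbedding.sigmaMk (σ := fun a : Fin (l.len + 1) → I => inter U a)
    (i := a)).isOpen_range.mem_nhds (Set.mem_range_self x)
  filter_upwards [this]
  rintro _ ⟨y, rfl⟩
  exact h y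

/-- A form on the disjoint union is given near a point by its restriction to the piece of this point, by way
of the retraction to the piece. -/
theorem bijective_pull_pieces (q : ℕ) (l : SimplexCategory) : Function.Bijective
    (fun (η : HolForm ((cechNerve U).obj (op l)) q) (a : Fin (l.len + 1) → I) =>
      HolForm.pull (pieceIncl U a) q η) := by
  constructor
  · intro η η' h
    refine Subtype.ext (funext ?_)
    rintro ⟨a, x⟩
    -- near `⟨a, x⟩` the form is the pullback along the retraction of its restriction
    have key : ∀ η : HolForm ((cechNerve U).obj (op l)) q, η.1 (⟨a, x⟩ : Σ a, inter U a) =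
        (HolForm.pull (pieceRetract U a x) q (HolForm.pull (pieceIncl U a) q η)).1
          (⟨a, x⟩ : Σ a, inter U a) := by
      intro η
      rw [HolForm.pull_pull]
      refine (congrArg (fun η : HolForm ((cechNerve U).obj (op l)) q =>
        η.1 (⟨a, x⟩ : Σ a, inter U a)) (HolForm.pull_id η)).symm.trans ?_
      exact HolForm.pull_congr (eventually_mem_piece U a x fun y =>
        (congrArg (fun z => (⟨a, z⟩ : Σ a, inter U a)) (pieceRetract_apply U a x y)).symm) η
    refine (key η).trans (Eq.trans ?_ (key η').symm)
    exact congrArg (fun c => (HolForm.pull (pieceRetract U a x) q c).1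
      (⟨a, x⟩ : Σ a, inter U a)) (congrFun h a)
  · intro c
    refine ⟨⟨fun s => (HolForm.pull (pieceRetract U s.1 s.2) q (c s.1)).1 s, ?_⟩, ?_⟩
    · rintro ⟨a, x⟩ V hV
      refine ((HolForm.pull (pieceRetract U a x) q (c a)).2 _ V hV).congr' ?_
      refine eventually_mem_piece U a x fun y => ?_
      refine congrArg (fun ξ : TangentSpace M.I (⟨a, y⟩ : Σ a, inter U a) [⋀^Fin q]→ₗ[ℂ] ℂ =>
        ξ fun i => V i (⟨a, y⟩ : Σ a, inter U a)) ?_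
      exact HolForm.pull_congr (eventually_mem_piece U a y fun z =>
        (pieceRetract_apply U a y z).trans (pieceRetract_apply U a x z).symm) (c a)
    · funext a
      refine Subtype.ext (funext fun x => ?_)
      have := (HolForm.pull_pull (pieceIncl U a) (pieceRetract U a x) (c a)).trans
        ((congrArg (fun φ => HolForm.pull φ q (c a)) (pieceIncl_pieceRetract U a x)).trans
          (HolForm.pull_id _))
      have h := congrArg (fun η : HolForm (openMan (inter U a)) q => η.1 x) this
      exact h

theorem isIso_restrictPieces (q : ℕ) : IsIso (restrictPieces U (holForms q)) := by
  refine (NatTrans.isIso_iff_isIso_app (restrictPieces U (holForms q))).2 fun l => ?_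
  exact (ConcreteCategory.isIso_iff_bijective _).2 (bijective_pull_pieces U q l)

theorem bijective_restrict (q l : ℕ) : Function.Bijective (restrict U q l) :=
  bijective_pull_pieces U q ⦋l⦌

end Pieces

/-! ### Traces of products of differences of connections -/

theorem val_succAbove_eq_ite {n : ℕ} (p : Fin (n + 1)) (i : Fin n) :
    (p.succAbove i : ℕ) = if (i : ℕ) < p then (i : ℕ) else i + 1 := by
  rw [Fin.succAbove]
  simp only [Fin.lt_def, Fin.val_castSucc]
  split <;> rfl

section WedgeTrace

variable {T V W : Type*} [AddCommGroup T] [Module ℂ T] [AddCommGroup V] [Module ℂ V]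
  [AddCommGroup W] [Module ℂ W] {l : ℕ}

/-- The alternating form `tr (b (l - 1) ∧ ⋯ ∧ b 0)` of endomorphism valued linear forms. -/
def wedgeTrace (b : Fin l → T →ₗ[ℂ] Module.End ℂ V) : T [⋀^Fin l]→ₗ[ℂ] ℂ :=
  MultilinearMap.alternatization ((LinearMap.trace ℂ V).compMultilinearMap
    ((MultilinearMap.mkPiAlgebraFin ℂ l (Module.End ℂ V)).compLinearMap fun i => b i.rev))

theorem wedgeTrace_apply (b : Fin l → T →ₗ[ℂ] Module.End ℂ V) (v : Fin l → T) :
    wedgeTrace b v = ∑ π : Equiv.Perm (Fin l), (Equiv.Perm.sign π : ℤ) •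
      LinearMap.trace ℂ V (List.ofFn fun i => b i.rev (v (π i))).prod := by
  rw [wedgeTrace, MultilinearMap.alternatization_apply]
  refine Finset.sum_congr rfl fun π _ => ?_
  simp [Units.smul_def]

theorem wedgeTrace_eq_zero (b : Fin l → T →ₗ[ℂ] Module.End ℂ V) (i : Fin l) (h : b i = 0) :
    wedgeTrace b = 0 := by
  ext v
  rw [wedgeTrace_apply]
  refine Finset.sum_eq_zero fun π _ => ?_
  rw [List.prod_eq_zero, map_zero, smul_zero]
  rw [List.mem_ofFn]
  exact ⟨i.rev, by simp [h]⟩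

theorem wedgeTrace_update_add (b : Fin l → T →ₗ[ℂ] Module.End ℂ V) (p : Fin l)
    (c c' : T →ₗ[ℂ] Module.End ℂ V) :
    wedgeTrace (Function.update b p (c + c')) =
      wedgeTrace (Function.update b p c) + wedgeTrace (Function.update b p c') := by
  ext v
  rw [AlternatingMap.add_apply, wedgeTrace_apply, wedgeTrace_apply, wedgeTrace_apply,
    ← Finset.sum_add_distrib]
  refine Finset.sum_congr rfl fun π _ => ?_
  rw [← smul_add, ← map_add]
  congr 2
  have h (c : T →ₗ[ℂ] Module.End ℂ V) :
      (fun i : Fin l => Function.update b p c i.rev (v (π i))) =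
        Function.update (fun i => b i.rev (v (π i))) p.rev (c (v (π p.rev))) := by
    funext i
    by_cases hi : i = p.rev
    · subst hi
      rw [Fin.rev_rev, Function.update_self, Function.update_self]
    · rw [Function.update_of_ne hi, Function.update_of_ne]
      exact fun e => hi (by rw [← e, Fin.rev_rev])
  have key := (MultilinearMap.mkPiAlgebraFin ℂ l (Module.End ℂ V)).map_update_add
    (fun i => b i.rev (v (π i))) p.rev (c (v (π p.rev))) (c' (v (π p.rev)))
  simp only [MultilinearMap.mkPiAlgebraFin_apply] at key
  rw [h, h, h, LinearMap.add_apply]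
  exact key

/-- Invariance under transport along an isomorphism, from that of the trace. -/
theorem wedgeTrace_conj (e : V ≃ₗ[ℂ] W) (b : Fin l → T →ₗ[ℂ] Module.End ℂ V)
    (b' : Fin l → T →ₗ[ℂ] Module.End ℂ W) (h : ∀ i t, b' i t = e.conj (b i t)) :
    wedgeTrace b' = wedgeTrace b := by
  ext v
  rw [wedgeTrace_apply, wedgeTrace_apply]
  refine Finset.sum_congr rfl fun π _ => ?_
  congr 1
  have : (List.ofFn fun i => b' i.rev (v (π i))).prod =
      e.conj (List.ofFn fun i => b i.rev (v (π i))).prod := by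
    simp only [h]
    have := map_list_prod (e.conjAlgEquiv ℂ) (List.ofFn fun i => b i.rev (v (π i)))
    rw [List.map_ofFn] at this
    exact this.symm
  rw [this, LinearMap.trace_conj']

/-- The form `tr ((D l - D (l - 1)) ∧ ⋯ ∧ (D 1 - D 0))`, for the endomorphism valued forms `D j` by
which `l + 1` connections on one bundle differ from a reference connection. -/
def differenceTrace (D : Fin (l + 1) → T →ₗ[ℂ] Module.End ℂ V) : T [⋀^Fin l]→ₗ[ℂ] ℂ :=
  wedgeTrace fun i => D i.succ - D i.castSucc

/-- If a connection is repeated, one of the differences vanishes. -/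
theorem differenceTrace_degenerate (D : Fin (l + 1) → T →ₗ[ℂ] Module.End ℂ V) (i : Fin (l + 1)) :
    differenceTrace (D ∘ i.predAbove) = 0 := by
  refine wedgeTrace_eq_zero _ i ?_
  simp

theorem sum_alternating_telescope {G : Type*} [AddCommGroup G] {l : ℕ} (c : Fin (l + 2) → G)
    (w : Fin (l + 1) → G) (h0 : c 0 = w 0) (h1 : c (Fin.last (l + 1)) = w (Fin.last l))
    (h : ∀ p : Fin l, c p.castSucc.succ = w p.castSucc + w p.succ) :
    ∑ i : Fin (l + 2), (-1 : ℤ) ^ (i : ℕ) • c i = 0 := by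
  have e1 := Fin.sum_univ_succ fun q : Fin (l + 1) => (-1 : ℤ) ^ (q : ℕ) • w q
  rw [Fin.sum_univ_castSucc] at e1
  rw [Fin.sum_univ_succ, Fin.sum_univ_castSucc, Fin.succ_last, h0, h1]
  simp only [h, smul_add, Finset.sum_add_distrib]
  simp only [Fin.val_succ, Fin.val_castSucc, Fin.val_zero, Fin.val_last, pow_succ, mul_neg,
    mul_one, neg_smul, Finset.sum_neg_distrib, pow_zero, one_smul] at e1 ⊢
  have e2 := congrArg (fun g => g - w 0) e1
  simp only [add_sub_cancel_left] at e2
  rw [← e2]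
  abel

/-- Omitting an inner connection replaces two adjacent differences by their sum. By multilinearity the form
becomes the sum of those with one of the two differences, and the alternating sum telescopes. -/
theorem sum_differenceTrace (D : Fin (l + 2) → T →ₗ[ℂ] Module.End ℂ V) :
    ∑ i : Fin (l + 2), (-1 : ℤ) ^ (i : ℕ) • differenceTrace (D ∘ i.succAbove) = 0 := by
  let a : Fin (l + 1) → T →ₗ[ℂ] Module.End ℂ V := fun j => D j.succ - D j.castSucc
  refine sum_alternating_telescope _ (fun p => wedgeTrace (a ∘ p.succAbove)) ?_ ?_ fun p => ?_
  · rfl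
  · refine congrArg wedgeTrace (funext fun j => ?_)
    simp [a]
  · have e1 : (fun j : Fin l => (D ∘ p.castSucc.succ.succAbove) j.succ -
        (D ∘ p.castSucc.succ.succAbove) j.castSucc) =
        Function.update (a ∘ p.castSucc.succAbove) p (a p.castSucc + a p.succ) := by
      funext j
      rcases lt_trichotomy j p with h | rfl | h
      · rw [Function.update_of_ne h.ne]
        have h1 : p.castSucc.succ.succAbove j.succ = j.castSucc.succ := by
          ext; simp only [val_succAbove_eq_ite, Fin.val_succ, Fin.val_castSucc]; split_ifs <;> omega
        have h2 : p.castSucc.succ.succAbove j.castSucc = j.castSucc.castSucc := by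
          ext; simp only [val_succAbove_eq_ite, Fin.val_succ, Fin.val_castSucc]; split_ifs <;> omega
        have h3 : p.castSucc.succAbove j = j.castSucc := by
          ext; simp only [val_succAbove_eq_ite, Fin.val_castSucc]; split_ifs <;> omega
        simp only [Function.comp_apply, h1, h2, h3, a]
      · rw [Function.update_self]
        have h1 : j.castSucc.succ.succAbove j.succ = j.succ.succ := by
          ext; simp only [val_succAbove_eq_ite, Fin.val_succ, Fin.val_castSucc]; split_ifs <;> omega
        have h2 : j.castSucc.succ.succAbove j.castSucc = j.castSucc.castSucc := by
          ext; simp only [val_succAbove_eq_ite, Fin.val_succ, Fin.val_castSucc]; split_ifs <;> omega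
        simp only [Function.comp_apply, h1, h2, a]
        rw [← Fin.succ_castSucc]
        abel
      · rw [Function.update_of_ne h.ne']
        have h1 : p.castSucc.succ.succAbove j.succ = j.succ.succ := by
          ext; simp only [val_succAbove_eq_ite, Fin.val_succ, Fin.val_castSucc]; split_ifs <;> omega
        have h2 : p.castSucc.succ.succAbove j.castSucc = j.succ.castSucc := by
          ext; simp only [val_succAbove_eq_ite, Fin.val_succ, Fin.val_castSucc]; split_ifs <;> omega
        have h3 : p.castSucc.succAbove j = j.succ := by
          ext; simp only [val_succAbove_eq_ite, Fin.val_succ, Fin.val_castSucc]; split_ifs <;> omega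
        simp only [Function.comp_apply, h1, h2, h3, a]
    rw [differenceTrace, e1, wedgeTrace_update_add, add_comm]
    congr 2
    · funext j
      by_cases h : j = p
      · subst h
        rw [Function.update_self]
        simp
      · rw [Function.update_of_ne h]
    · funext j
      by_cases h : j = p
      · subst h
        rw [Function.update_self]
        simp
      · rw [Function.update_of_ne h]
        refine congrArg a (Fin.ext ?_)
        have : (j : ℕ) ≠ p := fun e => h (Fin.ext e)
        simp only [val_succAbove_eq_ite, Fin.val_succ, Fin.val_castSucc]
        split_ifs <;> omega

end WedgeTrace

/-! ### The derivative of an isomorphism of bundles with connection -/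

section HomNabla

variable {X Y : CMan.{u}} {E F G : HVBObj X}

/-- A holomorphic section through a given point of a fibre, with constant coefficients in a local frame. -/
theorem exists_holAt_eq (E : HVBObj X) (y : X) (w : E.fib y) :
    ∃ s : Π x, E.fib x, E.HolAt s y ∧ s y = w := by
  obtain ⟨r, e, he⟩ := E.isBundle y
  have he := he.self_of_nhds
  let b : Module.Basis (Fin r) ℂ (E.fib y) := Module.Basis.mk he.indep he.span
  refine ⟨fun x => ∑ i, b.repr w i • e i x, E.holAt_sum _ fun i _ =>
    E.holAt_smul (HolFn.const X _ y) (E.frame_holAt he i), ?_⟩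
  refine Eq.trans (Finset.sum_congr rfl fun i _ => ?_) (b.sum_repr w)
  rw [Module.Basis.mk_apply]

theorem homNabla_spec (f : E ⟶ F) {y : X} {s : Π x, E.fib x} (hs : E.HolAt s y) (v : X.T y) :
    homNabla f y v (s y) = F.nabla (fun x => HVBObj.Hom.equiv f x (s x)) y v -
      HVBObj.Hom.equiv f y (E.nabla s y v) :=
  (exists_homNabla f y).choose_spec s hs v

/-- As holomorphic sections pass through all points of a fibre, the formula for `∇ f` on them determines it. -/
theorem homNabla_unique (f : E ⟶ F) {y : X} {v : X.T y} {A : E.fib y →ₗ[ℂ] F.fib y}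
    (h : ∀ s : Π x, E.fib x, E.HolAt s y → A (s y) =
      F.nabla (fun x => HVBObj.Hom.equiv f x (s x)) y v -
        HVBObj.Hom.equiv f y (E.nabla s y v)) : homNabla f y v = A := by
  ext w
  obtain ⟨s, hs, rfl⟩ := exists_holAt_eq E y w
  rw [h s hs, homNabla_spec f hs]

/-- The Leibniz rule. -/
theorem homNabla_comp (f : E ⟶ F) (g : F ⟶ G) (y : X) (v : X.T y) :
    homNabla (f ≫ g) y v = homNabla g y v ∘ₗ (HVBObj.Hom.equiv f y).toLinearMap +
      (HVBObj.Hom.equiv g y).toLinearMap ∘ₗ homNabla f y v := by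
  refine homNabla_unique _ fun s hs => ?_
  change homNabla g y v (HVBObj.Hom.equiv f y (s y)) +
    HVBObj.Hom.equiv g y (homNabla f y v (s y)) = G.nabla (fun x => HVBObj.Hom.equiv g x
      (HVBObj.Hom.equiv f x (s x))) y v - HVBObj.Hom.equiv g y (HVBObj.Hom.equiv f y (E.nabla s y v))
  rw [homNabla_spec f hs, homNabla_spec g (s := fun x => HVBObj.Hom.equiv f x (s x))
    ((HVBObj.Hom.hol f s y).1 hs), map_sub]
  abel

theorem homNabla_holAt (f : E ⟶ F) {y : X} {V : Π x, X.T x} (hV : HolVF X V y)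
    {s : Π x, E.fib x} (hs : E.HolAt s y) : F.HolAt (fun x => homNabla f x (V x) (s x)) y := by
  have h1 := F.isConn.hol ((HVBObj.Hom.hol f s y).1 hs) hV
  have h2 := (HVBObj.Hom.hol f _ y).1 (E.isConn.hol hs hV)
  refine F.holAt_congr (F.holAt_add h1 (F.holAt_smul (HolFn.const X (-1) y) h2)) ?_
  filter_upwards [E.holAt_eventually hs] with x hx
  rw [homNabla_spec f hx, neg_one_smul, sub_eq_add_neg]

/-- The formula for `∇ f` on sections along `φ`, which are combinations of pulled back sections with
holomorphic coefficients. The derivatives of the coefficients cancel. -/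
theorem pullNabla_equiv (φ : Y ⟶ X) (f : E ⟶ F) {y : Y} {s : Π y, E.fib (φ y)}
    (p : E.Pres φ s y) (v : Y.T y) :
    homNabla f (φ y) (dmap φ y v) (s y) =
      F.pullNabla φ (fun z => HVBObj.Hom.equiv f (φ z) (s z)) y v -
        HVBObj.Hom.equiv f (φ y) (E.pullNabla φ s y v) := by
  let q : F.Pres φ (fun z => HVBObj.Hom.equiv f (φ z) (s z)) y :=
    @HVBObj.Pres.mk _ _ F φ _ y p.ι p.fin p.c (fun i x => HVBObj.Hom.equiv f x (p.s i x)) p.hc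
      (fun i => (HVBObj.Hom.hol f _ _).1 (p.hs i)) (by
        filter_upwards [p.eq] with z hz
        rw [hz, map_sum]
        simp only [map_smul])
  rw [F.pullNabla_eq q, E.pullNabla_eq p, q.deriv_apply, p.deriv_apply, p.eq.self_of_nhds,
    map_sum, map_sum]
  refine Eq.trans (Finset.sum_congr rfl fun i _ => ?_) (Finset.sum_sub_distrib _ _)
  simp only [map_smul, map_add]
  rw [homNabla_spec f (p.hs i), smul_sub]
  change _ = dfn Y (p.c i) y v • HVBObj.Hom.equiv f (φ y) (p.s i (φ y)) +
    p.c i y • F.nabla (fun x => HVBObj.Hom.equiv f x (p.s i x)) (φ y) (dmap φ y v) - _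
  abel

theorem homNabla_pull (φ : Y ⟶ X) (f : E ⟶ F) (y : Y) (v : Y.T y) :
    homNabla ((HVBObj.pullFunctor φ).map f) y v = homNabla f (φ y) (dmap φ y v) :=
  homNabla_unique (E := E.pull φ) (F := F.pull φ) _ fun _ ⟨p⟩ => pullNabla_equiv φ f p v

/-- The difference, at a point, of the connection pulled back along an isomorphism of bundles and
the given connection. -/
def connDiff (f : E ⟶ F) (y : X) : X.T y →ₗ[ℂ] Module.End ℂ (E.fib y) :=
  (LinearMap.compRight ℂ (HVBObj.Hom.equiv f y).symm.toLinearMap) ∘ₗ homNabla f y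

theorem connDiff_apply (f : E ⟶ F) (y : X) (v : X.T y) :
    connDiff f y v = (HVBObj.Hom.equiv f y).symm.toLinearMap ∘ₗ homNabla f y v := rfl

/-- By transport to the first bundle, the differences of connections along a composite add. -/
theorem connDiff_comp (f : E ⟶ F) (g : F ⟶ G) (y : X) (v : X.T y) :
    connDiff (f ≫ g) y v = (HVBObj.Hom.equiv f y).symm.conj (connDiff g y v) +
      connDiff f y v := by
  rw [connDiff_apply, homNabla_comp]
  ext w
  change (HVBObj.Hom.equiv f y).symm ((HVBObj.Hom.equiv g y).symm
    (homNabla g y v (HVBObj.Hom.equiv f y w) + HVBObj.Hom.equiv g y (homNabla f y v w))) = _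
  rw [map_add, LinearEquiv.symm_apply_apply, map_add]
  rfl

theorem connDiff_pull (φ : Y ⟶ X) (f : E ⟶ F) (y : Y) :
    connDiff ((HVBObj.pullFunctor φ).map f) y = connDiff f (φ y) ∘ₗ dmap φ y := by
  ext1 v
  exact congrArg (fun A => (HVBObj.Hom.equiv f (φ y)).symm.toLinearMap ∘ₗ A) (homNabla_pull φ f y v)

theorem connDiff_holAt (f : E ⟶ F) {y : X} {V : Π x, X.T x} (hV : HolVF X V y)
    {s : Π x, E.fib x} (hs : E.HolAt s y) : E.HolAt (fun x => connDiff f x (V x) (s x)) y :=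
  (HVBObj.Hom.hol (HVBObj.Hom.symm f) _ y).1 (homNabla_holAt f hV hs)

/-- The trace of an endomorphism that preserves holomorphic sections is a holomorphic function: in a frame it
is the sum of the diagonal coefficients. -/
theorem trace_holFn (E : HVBObj X) {y : X} {B : Π x, Module.End ℂ (E.fib x)}
    (hB : ∀ s : Π x, E.fib x, E.HolAt s y → E.HolAt (fun x => B x (s x)) y) :
    HolFn X (fun x => LinearMap.trace ℂ (E.fib x) (B x)) y := by
  obtain ⟨r, e, he⟩ := E.isBundle y
  choose c hc h using fun j => (he.self_of_nhds.iff _).1 (hB _ (E.frame_holAt he.self_of_nhds j))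
  refine (HolFn.sum' Finset.univ fun i (_ : i ∈ Finset.univ) => hc i i).congr' ?_
  filter_upwards [he, Filter.eventually_all.2 h] with x hx h'
  let b : Module.Basis (Fin r) ℂ (E.fib x) := Module.Basis.mk hx.indep hx.span
  rw [LinearMap.trace_eq_matrix_trace ℂ b, Matrix.trace]
  refine Finset.sum_congr rfl fun i _ => ?_
  have hb : ∀ j, e j x = b j := fun j => (Module.Basis.mk_apply hx.indep hx.span j).symm
  rw [Matrix.diag_apply, LinearMap.toMatrix_apply, ← hb, h']
  simp only [hb]
  simp [Finsupp.single_apply]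

theorem prod_holAt (E : HVBObj X) {y : X} {l : ℕ} (B : Fin l → Π x, Module.End ℂ (E.fib x))
    (hB : ∀ i, ∀ s : Π x, E.fib x, E.HolAt s y → E.HolAt (fun x => B i x (s x)) y)
    (s : Π x, E.fib x) (hs : E.HolAt s y) :
    E.HolAt (fun x => (List.ofFn fun i => B i x).prod (s x)) y := by
  induction l with
  | zero => simpa using hs
  | succ l ih =>
    simp only [List.ofFn_succ, List.prod_cons]
    exact hB 0 _ (ih (fun i => B i.succ) fun i => hB i.succ)

theorem differenceTrace_holFn (E : HVBObj X) {y : X} {l : ℕ}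
    (D : Fin (l + 1) → Π x, X.T x →ₗ[ℂ] Module.End ℂ (E.fib x)) {V : Fin l → Π x, X.T x}
    (hD : ∀ j i, ∀ s : Π x, E.fib x, E.HolAt s y → E.HolAt (fun x => D j x (V i x) (s x)) y) :
    HolFn X (fun x => differenceTrace (fun j => D j x) (fun i => V i x)) y := by
  simp only [differenceTrace, wedgeTrace_apply]
  refine HolFn.sum' _ fun π _ => ?_
  have h := trace_holFn E (prod_holAt E (y := y) (fun i x => (D i.rev.succ x - D i.rev.castSucc x)
    (V (π i) x)) ?_)
  · refine ((HolFn.const X ((Equiv.Perm.sign π : ℤ) : ℂ) y).mul' h).congr' ?_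
    exact Filter.Eventually.of_forall fun x => zsmul_eq_mul _ _
  · intro i s hs
    refine E.holAt_congr (E.holAt_add (hD i.rev.succ (π i) s hs)
      (E.holAt_smul (HolFn.const X (-1) y) (hD i.rev.castSucc (π i) s hs))) ?_
    refine Filter.Eventually.of_forall fun x => ?_
    rw [LinearMap.sub_apply, LinearMap.sub_apply, neg_one_smul, sub_eq_add_neg]

end HomNabla

/-! ### The Chern form of a sequence of isomorphisms -/

section TraceForm

theorem induction_mul_eq_prod {A : Type*} [Monoid A] {l : ℕ} (m : Fin l → A) :
    Fin.induction (motive := fun _ => A) 1 (fun i P => m i * P) (Fin.last l) =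
      (List.ofFn fun i => m i.rev).prod := by
  induction l with
  | zero => simp
  | succ l ih =>
    have h : ∀ j : Fin (l + 1), Fin.induction (motive := fun _ => A) 1 (fun i P => m i * P)
        j.castSucc = Fin.induction (motive := fun _ => A) 1 (fun i P => m i.castSucc * P) j := by
      intro j
      induction j using Fin.induction with
      | zero => rfl
      | succ j hj =>
        rw [← Fin.succ_castSucc, Fin.induction_succ, Fin.induction_succ, hj]
    rw [← Fin.succ_last, Fin.induction_succ, h, ih, List.ofFn_succ, List.prod_cons, Fin.rev_zero]
    simp only [Fin.rev_succ]

theorem sub_eq_conj_sub {V W : Type*} [AddCommGroup V] [Module ℂ V] [AddCommGroup W] [Module ℂ W]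
    (e : V ≃ₗ[ℂ] W) {A A' : Module.End ℂ W} {B B' C : Module.End ℂ V}
    (h : B = e.symm.conj A + C) (h' : B' = e.symm.conj A' + C) : A - A' = e.conj (B - B') := by
  rw [h, h', add_sub_add_right_eq_sub, ← map_sub]
  exact (e.conj.apply_symm_apply _).symm

variable {X : CMan.{u}} {l n : ℕ}

/-- For a sequence `E 0 → ⋯ → E n` of isomorphisms of bundles with connection, the differences of the
connections transported to `E 0` and the connection of `E 0`. -/
def connDiffs (x : ComposableArrows (HVBObj X) n) (y : X) (j : Fin (n + 1)) :
    X.T y →ₗ[ℂ] Module.End ℂ ((x.obj 0).fib y) :=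
  connDiff (x.map (homOfLE (Fin.zero_le j))) y

/-- The product of derivatives `∇ f_j ⋯ ∇ f_1` is, after transport to `E 0`, the product of the differences
of consecutive connections. -/
theorem nablaPath_eq (x : ComposableArrows (HVBObj X) l) (y : X) (v : Fin l → X.T y)
    (j : Fin (l + 1)) : nablaPath x y v j =
      (HVBObj.Hom.equiv (x.map (homOfLE (Fin.zero_le j))) y).toLinearMap ∘ₗ
        Fin.induction (motive := fun _ => Module.End ℂ ((x.obj 0).fib y)) 1
          (fun i P => (connDiffs x y i.succ - connDiffs x y i.castSucc) (v i.rev) * P) j := by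
  induction j using Fin.induction with
  | zero =>
    have h : x.map (homOfLE (Fin.zero_le 0)) = 𝟙 (x.obj 0) := x.map_id 0
    rw [h]
    rfl
  | succ i ih =>
    have h : x.map (homOfLE (Fin.zero_le i.succ)) =
      x.map (homOfLE (Fin.zero_le i.castSucc)) ≫ x.map (homOfLE i.castSucc_le_succ) :=
      x.map_comp (homOfLE (Fin.zero_le i.castSucc)) (homOfLE i.castSucc_le_succ)
    rw [nablaPath, Fin.induction_succ, Fin.induction_succ]
    refine (congrArg (fun P => homNabla (x.map (homOfLE i.castSucc_le_succ)) y (v i.rev) ∘ₗ P)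
      ih).trans ?_
    rw [LinearMap.sub_apply, connDiffs, connDiffs, h, connDiff_comp, add_sub_cancel_right]
    ext w
    set w' := Fin.induction (motive := fun _ => Module.End ℂ ((x.obj 0).fib y)) 1
          (fun i P => (connDiffs x y i.succ - connDiffs x y i.castSucc) (v i.rev) * P)
          i.castSucc w
    set f := x.map (homOfLE (Fin.zero_le i.castSucc))
    set g := x.map (homOfLE i.castSucc_le_succ)
    change homNabla g y (v i.rev) (HVBObj.Hom.equiv f y w') =
      HVBObj.Hom.equiv g y (HVBObj.Hom.equiv f y ((HVBObj.Hom.equiv f y).symm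
        ((HVBObj.Hom.equiv g y).symm (homNabla g y (v i.rev) (HVBObj.Hom.equiv f y w')))))
    rw [LinearEquiv.apply_symm_apply, LinearEquiv.apply_symm_apply]

/-- The Chern form only depends on the differences of the connections. -/
theorem traceForm_eq (x : ComposableArrows (HVBObj X) l) (y : X) (v : Fin l → X.T y) :
    traceForm x y v = differenceTrace (connDiffs x y) v := by
  rw [traceForm, differenceTrace, wedgeTrace_apply]
  refine Finset.sum_congr rfl fun π _ => ?_
  congr 2
  rw [nablaPath_eq, induction_mul_eq_prod]
  ext w
  refine (LinearEquiv.symm_apply_apply _ _).trans ?_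
  simp only [Fin.rev_rev, Function.comp_apply]

/-- For a face that does not begin at `E 0`, the reference connection changes and the transport is to another
bundle. The differences are only conjugated, which the trace does not see. -/
theorem traceForm_map {n : SimplexCategory} (x : (HVB.obj (op X)).obj (op n)) (σ : ⦋l⦌ ⟶ n)
    (y : X) (v : Fin l → X.T y) :
    traceForm ((HVB.obj (op X)).map σ.op x : ComposableArrows (HVBObj X) l) y v =
      differenceTrace (connDiffs (x : ComposableArrows (HVBObj X) n.len) y ∘ σ.toOrderHom) v := by
  refine (traceForm_eq _ y v).trans ?_
  let x₀ : ComposableArrows (HVBObj X) n.len := x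
  let x' : ComposableArrows (HVBObj X) l := (HVB.obj (op X)).map σ.op x
  let f := x₀.map (homOfLE (Fin.zero_le (σ.toOrderHom 0)))
  have key (j : Fin (l + 1)) (t : X.T y) : connDiffs x₀ y (σ.toOrderHom j) t =
      (HVBObj.Hom.equiv f y).symm.conj (connDiffs x' y j t) +
        connDiffs x₀ y (σ.toOrderHom 0) t := by
    have h : x₀.map (homOfLE (Fin.zero_le (σ.toOrderHom j))) =
      f ≫ x₀.map (homOfLE (σ.toOrderHom.monotone (Fin.zero_le j))) :=
      x₀.map_comp (homOfLE (Fin.zero_le (σ.toOrderHom 0)))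
        (homOfLE (σ.toOrderHom.monotone (Fin.zero_le j)))
    rw [connDiffs, h, connDiff_comp]
    rfl
  refine congrArg (fun η => η v) (wedgeTrace_conj (HVBObj.Hom.equiv f y) _ _ fun i t => ?_)
  change (connDiffs x' y i.succ - connDiffs x' y i.castSucc) t = (HVBObj.Hom.equiv f y).conj
    ((connDiffs x₀ y (σ.toOrderHom i.succ) - connDiffs x₀ y (σ.toOrderHom i.castSucc)) t)
  exact sub_eq_conj_sub (HVBObj.Hom.equiv f y) (key i.succ t) (key i.castSucc t)

/-- The form `tr (f⁻¹ ∇ f_l ∧ ⋯ ∧ ∇ f_1)` of a face of a simplex of `HVB`. -/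
def chernForm {n : SimplexCategory} (x : (HVB.obj (op X)).obj (op n)) (σ : ⦋l⦌ ⟶ n) :
    HolForm X l :=
  ⟨fun y => differenceTrace (connDiffs (x : ComposableArrows (HVBObj X) n.len) y ∘ σ.toOrderHom),
    fun y _ hV => differenceTrace_holFn
      ((x : ComposableArrows (HVBObj X) n.len).obj 0) (y := y) (fun j y =>
        connDiffs (x : ComposableArrows (HVBObj X) n.len) y (σ.toOrderHom j))
        fun _ i _ hs => connDiff_holAt _ (hV i) hs⟩

end TraceForm

/-! ### The Chern character as a map of simplicial presheaves -/

section ChernCharacter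

variable {X Y : CMan.{u}} {n : SimplexCategory}

theorem chernForm_degenerate (x : (HVB.obj (op X)).obj (op n)) {l : ℕ} (i : Fin (l + 1))
    (σ : ⦋l⦌ ⟶ n) : chernForm x (SimplexCategory.σ i ≫ σ) = 0 :=
  Subtype.ext (funext fun y => differenceTrace_degenerate
    (connDiffs (x : ComposableArrows (HVBObj X) n.len) y ∘ σ.toOrderHom) i)

theorem sum_chernForm (x : (HVB.obj (op X)).obj (op n)) {l : ℕ} (σ : ⦋l + 1⦌ ⟶ n) :
    ∑ i : Fin (l + 2), (-1 : ℤ) ^ (i : ℕ) • chernForm x (SimplexCategory.δ i ≫ σ) = 0 := by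
  refine Subtype.ext (funext fun y => ?_)
  refine Eq.trans ?_ (sum_differenceTrace
    (connDiffs (x : ComposableArrows (HVBObj X) n.len) y ∘ σ.toOrderHom))
  rw [AddSubgroup.val_finsetSum, Finset.sum_apply]
  rfl

/-- The part in `m`-forms of the Chern character of a face of a simplex of `HVB`. -/
def chernCoeff (x : (HVB.obj (op X)).obj (op n)) {l : ℕ} (σ : ⦋l⦌ ⟶ n) (m : ℕ) : HolForm X m :=
  if h : l = m then h ▸ chernForm x σ else 0

theorem chernCoeff_self (x : (HVB.obj (op X)).obj (op n)) {l : ℕ} (σ : ⦋l⦌ ⟶ n) :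
    chernCoeff x σ l = chernForm x σ := dif_pos rfl

theorem chernCoeff_of_ne (x : (HVB.obj (op X)).obj (op n)) {l m : ℕ} (h : l ≠ m) (σ : ⦋l⦌ ⟶ n) :
    chernCoeff x σ m = 0 := dif_neg h

theorem chernCoeff_apply (x : (HVB.obj (op X)).obj (op n)) {l : ℕ} (σ : ⦋l⦌ ⟶ n) (m : ℕ) (y : X)
    (v : Fin m → X.T y) : (chernCoeff x σ m).1 y v = if h : l = m then
      traceForm ((HVB.obj (op X)).map σ.op x : ComposableArrows (HVBObj X) l) y (v ∘ Fin.cast h)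
      else 0 := by
  by_cases h : l = m
  · subst h
    rw [dif_pos rfl, chernCoeff_self]
    exact (traceForm_map x σ y v).symm
  · rw [dif_neg h, chernCoeff_of_ne x h]
    rfl

theorem Q_holComplex_d (X : CMan.{u}ᵒᵖ) (p : ℕ) (c : (Q.obj (holComplex.obj X)).X (p + 1)) :
    ((Q.obj (holComplex.obj X)).d (p + 1) p).hom c = 0 := by
  refine (congrArg (fun f => f.hom c) (QObj_d (holComplex.obj X) p)).trans
    (Subtype.ext (funext ?_))
  rintro ⟨⟨k, m⟩, h⟩
  cases m <;> rfl

/-- The Chern character of a face of a simplex of `HVB`. -/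
def chernValue (x : (HVB.obj (op X)).obj (op n)) (l : ℕ) (σ : ⦋l⦌ ⟶ n) :
    QX (holComplex.obj (op X)) l :=
  ⟨fun p => chernCoeff x σ p.1.2, fun _ _ => rfl⟩

theorem exists_chernSimplex (x : (HVB.obj (op X)).obj (op n)) :
    ∃ z : (DK.obj (Q.obj (holComplex.obj (op X)))).obj (op n),
      ∀ l σ, DKval (C := Q.obj (holComplex.obj (op X))) z (p := l) σ = chernValue x l σ := by
  refine exists_DKval (C := Q.obj (holComplex.obj (op X))) (chernValue x)
    (fun l i σ => Subtype.ext (funext fun p => ?_)) fun l σ => ?_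
  · obtain ⟨⟨k, m⟩, h⟩ := p
    by_cases e : l + 1 = m
    · subst e
      exact (chernCoeff_self x _).trans (chernForm_degenerate x i σ)
    · exact chernCoeff_of_ne x e _
  · refine (Q_holComplex_d (op X) l _).trans (Eq.symm ?_)
    refine Subtype.ext (funext fun p => ?_)
    obtain ⟨⟨k, m⟩, h⟩ := p
    refine (map_sum_zsmul ((Pi.evalAddMonoidHom _ (⟨(k, m), h⟩ : {p : ℕ × ℕ // p.2 + l = 2 * p.1})).comp
      (QX (holComplex.obj (op X)) l).subtype) Finset.univ _ _).trans ?_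
    change ∑ i : Fin (l + 2), (-1 : ℤ) ^ (i : ℕ) • chernCoeff x (SimplexCategory.δ i ≫ σ) m = 0
    by_cases e : l = m
    · subst e
      simp only [chernCoeff_self]
      exact sum_chernForm x σ
    · simp only [chernCoeff_of_ne x e, smul_zero, Finset.sum_const_zero]

/-- The simplex of forms given by the Chern character of a simplex of `HVB`. -/
def chernSimplex (x : (HVB.obj (op X)).obj (op n)) :
    (DK.obj (Q.obj (holComplex.obj (op X)))).obj (op n) :=
  (exists_chernSimplex x).choose

theorem DKval_chernSimplex (x : (HVB.obj (op X)).obj (op n)) {l : ℕ} (σ : ⦋l⦌ ⟶ n) :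
    DKval (C := Q.obj (holComplex.obj (op X))) (chernSimplex x) σ = chernValue x l σ :=
  (exists_chernSimplex x).choose_spec l σ

theorem chernSimplex_map (x : (HVB.obj (op X)).obj (op n)) {m : SimplexCategory} (θ : m ⟶ n) :
    chernSimplex ((HVB.obj (op X)).map θ.op x) =
      (DK.obj (Q.obj (holComplex.obj (op X)))).map θ.op (chernSimplex x) := by
  refine DKval_ext (C := Q.obj (holComplex.obj (op X))) fun l σ => ?_
  rw [DKval_chernSimplex]
  refine Eq.trans ?_ ((DKval_map (C := Q.obj (holComplex.obj (op X))) (chernSimplex x) θ σ).trans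
    (DKval_chernSimplex x (σ ≫ θ))).symm
  refine Subtype.ext (funext fun p => Subtype.ext (funext fun y => AlternatingMap.ext fun v => ?_))
  exact (chernCoeff_apply _ σ _ y v).trans (chernCoeff_apply x (σ ≫ θ) _ y v).symm

theorem chernForm_pull (φ : Y ⟶ X) (x : (HVB.obj (op X)).obj (op n)) {l : ℕ} (σ : ⦋l⦌ ⟶ n) :
    chernForm ((HVB.map φ.op).app (op n) x) σ = HolForm.pull φ l (chernForm x σ) := by
  refine Subtype.ext (funext fun y => AlternatingMap.ext fun v => ?_)
  let x₀ : ComposableArrows (HVBObj X) n.len := x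
  let x' : ComposableArrows (HVBObj Y) n.len := (HVB.map φ.op).app (op n) x
  have key (j : Fin (n.len + 1)) (t : Y.T y) :
      connDiffs x' y j t = connDiffs x₀ (φ y) j (dmap φ y t) :=
    congrArg (fun A => A t) (connDiff_pull φ (x₀.map (homOfLE (Fin.zero_le j))) y)
  change differenceTrace (connDiffs x' y ∘ σ.toOrderHom) v =
    differenceTrace (connDiffs x₀ (φ y) ∘ σ.toOrderHom) fun i => dmap φ y (v i)
  rw [differenceTrace, differenceTrace, wedgeTrace_apply, wedgeTrace_apply]
  simp only [Function.comp_apply, LinearMap.sub_apply, key]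
  rfl

theorem chernSimplex_pull (φ : Y ⟶ X) (x : (HVB.obj (op X)).obj (op n)) :
    chernSimplex ((HVB.map φ.op).app (op n) x) =
      (DK.map (Q.map (holComplex.map φ.op))).app (op n) (chernSimplex x) := by
  refine DKval_ext (C := Q.obj (holComplex.obj (op Y))) fun l σ => ?_
  refine (DKval_chernSimplex _ σ).trans (Eq.trans ?_
    ((DKval_comp (Q.map (holComplex.map φ.op)) (chernSimplex x) σ).trans
      (congrArg ((Q.map (holComplex.map φ.op)).f l).hom (DKval_chernSimplex x σ))).symm)
  refine Subtype.ext (funext fun p => ?_)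
  obtain ⟨⟨k, m⟩, h⟩ := p
  change chernCoeff _ σ m = HolForm.pull φ m (chernCoeff x σ m)
  by_cases e : l = m
  · subst e
    rw [chernCoeff_self, chernCoeff_self]
    exact chernForm_pull φ x σ
  · rw [chernCoeff_of_ne _ e, chernCoeff_of_ne _ e, map_zero]

/-- The Chern character. -/
def chernCharacter : HVB.{u} ⟶ Omega.{u} where
  app X :=
    { app := fun n => TypeCat.ofHom fun x => ULift.up (chernSimplex (X := X.unop) (n := n.unop) x)
      naturality := fun n m θ => by
        refine ConcreteCategory.hom_ext _ _ fun x => ?_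
        refine ULift.ext _ _ ?_
        exact chernSimplex_map (X := X.unop) x θ.unop }
  naturality X Y φ := by
    refine NatTrans.ext (funext fun n => ?_)
    refine ConcreteCategory.hom_ext _ _ fun x => ?_
    refine ULift.ext _ _ ?_
    exact chernSimplex_pull (n := n.unop) φ.unop x

theorem isChernCharacter_chernCharacter : IsChernCharacter chernCharacter.{u} := by
  intro X n x l σ p y v
  exact (congrArg (fun c : QX (holComplex.obj (op X)) l => (c.1 p : HolForm X p.1.2).1 y v)
    (DKval_chernSimplex x σ)).trans (chernCoeff_apply x σ _ y v)

/-- Simplices of the Dold-Kan construction are determined by their values, which the property prescribes. -/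
theorem IsChernCharacter.unique {Ch Ch' : HVB.{u} ⟶ Omega.{u}} (h : IsChernCharacter Ch)
    (h' : IsChernCharacter Ch') : Ch' = Ch := by
  refine NatTrans.ext (funext fun X => NatTrans.ext (funext fun n => ?_))
  refine ConcreteCategory.hom_ext _ _ fun x => ?_
  refine ULift.ext _ _ ?_
  refine DKval_ext (C := Q.obj (holComplex.obj X)) fun l σ => ?_
  refine Subtype.ext (funext fun p => Subtype.ext (funext fun y => AlternatingMap.ext fun v => ?_))
  exact (h' X.unop n.unop x l σ p y v).trans (h X.unop n.unop x l σ p y v).symm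

end ChernCharacter

/-! ### Vanishing of the Chern character in high powers of `u` -/

section Polynomial

theorem HolForm.eq_zero_of_dim_lt {X : CMan.{u}} {q : ℕ} (h : X.dim < q) (η : HolForm X q) :
    η = 0 := by
  refine Subtype.ext (funext fun y => AlternatingMap.ext fun v => ?_)
  refine (η.1 y).map_linearDependent v fun hv => ?_
  have h1 := LinearIndependent.fintype_card_le_finrank (R := ℂ) (M := EuclideanSpace ℂ (Fin X.dim)) hv
  simp only [Fintype.card_fin, finrank_euclideanSpace] at h1
  omega

/-- Only forms of degree `l` occur in the value on a face of dimension `l`. As `u` has degree `-2`, they come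
with `u ^ l`, so that a large exponent of `u` means forms of a degree above the dimension. -/
theorem IsChernCharacter.coeff_eq_zero {Ch : HVB.{u} ⟶ Omega.{u}} (h : IsChernCharacter Ch)
    {X : CMan.{u}} {n : SimplexCategory} (x : (HVB.obj (op X)).obj (op n)) {l : ℕ} (σ : ⦋l⦌ ⟶ n)
    (p : {p : ℕ × ℕ // p.2 + l = 2 * p.1}) (hp : X.dim < p.1.1) :
    ((DKval (C := Q.obj (holComplex.obj (op X))) ((Ch.app (op X)).app (op n) x).down σ :
      QX (holComplex.obj (op X)) l).1 p : HolForm X p.1.2) = 0 := by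
  obtain ⟨⟨k, m⟩, hkm⟩ := p
  simp only at hkm hp
  by_cases e : l = m
  · exact HolForm.eq_zero_of_dim_lt (show X.dim < m by omega) _
  · refine Subtype.ext (funext fun y => AlternatingMap.ext fun v => ?_)
    exact (h X n x l σ ⟨(k, m), hkm⟩ y v).trans (dif_neg e)

variable {M : CMan.{u}} {I : Type u} {U : I → Opens M}

theorem hasPolynomialValues {Ch : HVB.{u} ⟶ Omega.{u}} (h : IsChernCharacter Ch)
    {w : Tot.obj ((cechNerve U).rightOp ⋙ Omega.{u}) ⟶ DKu.obj (Q.obj (cech U))}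
    (hw : IsEZMap U w) : HasPolynomialValues (totMap U Ch ≫ w) M.dim := by
  rintro n x p σ ⟨⟨k, m⟩, hk⟩
  intro c hd
  funext ⟨⟨l, q⟩, hm⟩
  simp only at hm hd hk
  subst hm
  funext a
  refine (hw n ((totMap U Ch).app (op n) x) p σ k l q hk a).trans ?_
  refine (congrArg ((-1 : ℤ) ^ (p * (p - 1) / 2) • ·) (Finset.sum_eq_zero fun S _ => ?_)).trans
    (smul_zero _)
  refine (congrArg (fun η : HolForm ((cechNerve U).obj (op ⦋l⦌)) q =>
    shuffleSign S.1 • HolForm.pull (pieceIncl U (l := ⦋l⦌) a) q η)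
    (h.coeff_eq_zero (X := (cechNerve U).obj (op ⦋l⦌)) _ (𝟙 ⦋p + l⦌)
      ⟨(k, q), by simp only; omega⟩ hd)).trans ?_
  refine (congrArg (shuffleSign S.1 • ·) (map_zero _)).trans (smul_zero _)

end Polynomial

end ChernTot

end

open ChernTot in
theorem corollary3p3 (M : CMan.{u}) {I : Type u} (U : I → Opens M) (hU : ⨆ i, U i = ⊤) :
    ∃ Ch : HVB.{u} ⟶ Omega.{u}, IsChernCharacter Ch ∧ (∀ Ch', IsChernCharacter Ch' → Ch' = Ch) ∧
      (∀ q, IsIso (restrictPieces U (holForms q))) ∧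
      ∃ w : Tot.obj ((cechNerve U).rightOp ⋙ Omega.{u}) ⟶ DKu.obj (Q.obj (cech U)),
        IsEZMap U w ∧ IsWeakEquivalence w ∧ HasPolynomialValues (totMap U Ch ≫ w) M.dim :=
  ⟨chernCharacter, isChernCharacter_chernCharacter,
    fun _ h => isChernCharacter_chernCharacter.unique h, isIso_restrictPieces U,
    ezMap U, isEZMap_ezMap, isWeakEquivalence_ezMap (bijective_restrict U),
    hasPolynomialValues isChernCharacter_chernCharacter isEZMap_ezMap⟩
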